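/- **Theorem.** \textsc{Portal} with portals (and arbitrary level geometry, in particular long falls) can be solved in pseudopolynomial time. Precisely, consider the following game. All positions, velocities and times are fixed-point numbers; lengths are measured in units of the resolution, so that they are integers, and time proceeds in unit steps. *Instance.* A level is a finite list of polygonal surfaces in space, each a convex polygon with integer vertices marked portalable or not (a non-convex polygon is given as several convex ones), together with a start location and an end location in $\mathbb Z^3$, a terminal velocity $V\in\mathbb N$, and a bound $B\in\mathbb N$ on the coordinates of positions. *Avatar.* The avatar is an axis-parallel box (of smaller height when crouched) with a position, a velocity, an orientation and a posture; a blue and an orange portal may be present. Its interior never moves into a surface. In every time step the player chooses a cursor position from a fixed finite grid of yaw and pitch values (which becomes the orientation), walking directions, whether to jump, whether to crouch (standing up needs room), and whether to fire the Portal Gun for one of the two colours. A shot goes from the eye in the direction of view to the closest surface it crosses; if that surface is portalable, a portal facing the avatar is created there, at the rounded point of the crossing, and replaces the old portal of the same colour; otherwise nothing happens. An avatar on the ground runs with a fixed speed in the chosen direction and may jump; in the air it keeps its horizontal velocity and may drift with a small fixed speed; gravity lowers the vertical velocity in every step; every velocity component is limited to $[-V,V]$. The avatar moves along a digitized line segment;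 it climbs steps of a fixed height, and is otherwise stopped along an axis in which it is obstructed. If it runs into the surface that carries one of the two portals at the place of this portal, while both portals are present, it is instantly transported in front of the other one (if there is room for it), its velocity being turned accordingly and rounded; this ends its motion in that time step. An avatar whose position at the end of a time step has a coordinate outside $[-B,B]$ is lost. *Problem.* Starting at rest at the start location without portals, can the player reach a state in which the avatar's box contains the end location? For every choice of the constants of the game engine (dimensions of the avatar, gravity, running, drifting and jumping speed, step height, resolution of the cursor and of directions, reach of a portal), there are a random access machine program and a polynomial $p$ such that the program decides this problem on every level in at most $p(\ell+m)$ steps, where $\ell$ is the count of the numbers that describe the level and $m$ is the largest absolute value among them (including $V$, $B$ and the list lengths). The machine has addition, truncated subtraction, indirect loads and stores and tests for zero, each counted as one step. -/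

import Mathlib

/-! ## Machine model: random access machine programs with a step count -/

/-- Programs of a random access machine.  The machine has registers and a memory, both holding
natural numbers.  The only arithmetic is addition and truncated subtraction, so that one
instruction lengthens the longest number by at most one bit and the number of executed
instructions is polynomially related to the running time of a Turing machine. -/
inductive RAM : Type
  /-- `reg x := c` -/
  | const (x c : ℕ)
  /-- `reg x := reg y + reg z` -/
  | add (x y z : ℕ)
  /-- `reg x := reg y - reg z` (truncated at `0`) -/
  | sub (x y z : ℕ)
  /-- `reg x := mem (reg y)` -/
  | load (x y : ℕ)
  /-- `mem (reg x) := reg y` -/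
  | store (x y : ℕ)
  | seq (c d : RAM)
  /-- `if reg x ≠ 0 then c else d` -/
  | cond (x : ℕ) (c d : RAM)
  /-- `while reg x ≠ 0 do c` -/
  | loop (x : ℕ) (c : RAM)

namespace RAM

/-- A memory configuration. -/
structure Config where
  reg : ℕ → ℕ
  mem : ℕ → ℕ

/-- `Exec c σ t τ`: started on `σ`, the program `c` halts in configuration `τ` after exactly
`t` steps.  Every assignment and every test of a condition is one step. -/
inductive Exec : RAM → Config → ℕ → Config → Prop
  | const (x c : ℕ) (σ : Config) :
      Exec (.const x c) σ 1 { σ with reg := Function.update σ.reg x c }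
  | add (x y z : ℕ) (σ : Config) :
      Exec (.add x y z) σ 1 { σ with reg := Function.update σ.reg x (σ.reg y + σ.reg z) }
  | sub (x y z : ℕ) (σ : Config) :
      Exec (.sub x y z) σ 1 { σ with reg := Function.update σ.reg x (σ.reg y - σ.reg z) }
  | load (x y : ℕ) (σ : Config) :
      Exec (.load x y) σ 1 { σ with reg := Function.update σ.reg x (σ.mem (σ.reg y)) }
  | store (x y : ℕ) (σ : Config) :
      Exec (.store x y) σ 1 { σ with mem := Function.update σ.mem (σ.reg x) (σ.reg y) }
  | seq {c d : RAM} {σ τ υ : Config} {s t : ℕ} :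
      Exec c σ s τ → Exec d τ t υ → Exec (.seq c d) σ (s + t) υ
  | condTrue {x : ℕ} {c d : RAM} {σ τ : Config} {t : ℕ} :
      σ.reg x ≠ 0 → Exec c σ t τ → Exec (.cond x c d) σ (t + 1) τ
  | condFalse {x : ℕ} {c d : RAM} {σ τ : Config} {t : ℕ} :
      σ.reg x = 0 → Exec d σ t τ → Exec (.cond x c d) σ (t + 1) τ
  | loopStop {x : ℕ} {c : RAM} {σ : Config} :
      σ.reg x = 0 → Exec (.loop x c) σ 1 σ
  | loopStep {x : ℕ} {c : RAM} {σ τ υ : Config} {s t : ℕ} :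
      σ.reg x ≠ 0 → Exec c σ s τ → Exec (.loop x c) τ t υ → Exec (.loop x c) σ (s + t + 1) υ

/-- The initial configuration on the input `w`: the numbers of `w` stand in the memory cells
`0, 1, 2, …`, their count stands in register `0`, and everything else is `0`. -/
def init (w : List ℕ) : Config where
  reg := fun x => if x = 0 then w.length else 0
  mem := fun i => w.getD i 0

end RAM

/-- The decision problem `L` on the instances satisfying `valid`, an instance `a` being written as
the list of numbers `enc a`, is solvable in pseudopolynomial time: one program halts on every
instance with the correct answer (in register `0`, nonzero meaning yes), and the number of steps is
bounded by a polynomial in the count of the numbers of the input plus the largest of them. -/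
def SolvableInPseudopolynomialTime {α : Type} (enc : α → List ℕ) (valid L : α → Prop) : Prop :=
  ∃ (c : RAM) (p : Polynomial ℕ), ∀ a : α, valid a →
    ∃ (t : ℕ) (τ : RAM.Config),
      RAM.Exec c (RAM.init (enc a)) t τ ∧
      t ≤ p.eval ((enc a).length + (enc a).foldr max 0) ∧
      (τ.reg 0 ≠ 0 ↔ L a)

/-! ## The game -/

namespace PortalGame

noncomputable section

/-- Fixed-point vectors: the unit is the resolution of the fixed-point representation.
Coordinate `2` is the height. -/
abbrev V3 : Type := Fin 3 → ℤ

/-- A fixed-point vector as a point of space. -/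
def toReal (v : V3) : Fin 3 → ℝ := fun i => (v i : ℝ)

/-- The constants of the game engine (lengths in fixed-point units, speeds in units per time
step). -/
structure Engine where
  /-- half the width of the avatar -/
  halfWidth : ℕ
  /-- heights of the avatar -/
  standHeight : ℕ
  crouchHeight : ℕ
  /-- heights of the eye above the feet -/
  standEye : ℕ
  crouchEye : ℕ
  /-- loss of vertical velocity per time step -/
  gravity : ℕ
  /-- horizontal speed on the ground -/
  runSpeed : ℕ
  /-- the fixed speed with which the player can move horizontally in the air -/
  airSpeed : ℕ
  /-- initial vertical speed of a jump -/
  jumpSpeed : ℕ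
  /-- height of the steps that are climbed by walking -/
  stepHeight : ℕ
  /-- resolution of the two cursor coordinates -/
  yawSteps : ℕ
  pitchSteps : ℕ
  /-- fixed-point scale of direction vectors -/
  dirScale : ℕ
  /-- how far from the avatar's body the centre of a portal may be when the avatar enters it -/
  portalReach : ℕ
  halfWidth_pos : 0 < halfWidth
  two_le_crouchHeight : 2 ≤ crouchHeight
  crouchHeight_le : crouchHeight ≤ standHeight
  standEye_lt : standEye < standHeight
  crouchEye_lt : crouchEye < crouchHeight
  yawSteps_pos : 0 < yawSteps
  pitchSteps_pos : 0 < pitchSteps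
  dirScale_pos : 0 < dirScale

/-- A polygonal surface: a convex polygon, given by three non-collinear vertices and its further
vertices, that may or may not admit portals. -/
structure Surface where
  a : V3
  b : V3
  c : V3
  others : List V3
  portalable : Bool

namespace Surface

def verts (s : Surface) : List V3 := s.a :: s.b :: s.c :: s.others

/-- A normal vector of the surface (not of unit length). -/
def normal (s : Surface) : V3 := crossProduct (s.b - s.a) (s.c - s.a)

/-- The points of the polygon. -/
def region (s : Surface) : Set (Fin 3 → ℝ) := convexHull ℝ {x | ∃ v ∈ s.verts, x = toReal v}

/-- The first three vertices are not collinear and all vertices lie in their plane. -/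
def WellFormed (s : Surface) : Prop :=
  s.normal ≠ 0 ∧ ∀ v ∈ s.others, s.normal ⬝ᵥ (v - s.a) = 0

end Surface

/-- An instance: the polygons, the start and end location, the terminal velocity, and the bound on
the absolute values of the coordinates of positions (an avatar that leaves this range is lost). -/
structure Level where
  surfaces : List Surface
  start : V3
  goal : V3
  terminalVelocity : ℕ
  bound : ℕ

def Level.WellFormed (L : Level) : Prop := ∀ s ∈ L.surfaces, s.WellFormed

/-! ### The written form of an instance -/

/-- An integer is written as its positive part and its negative part. -/
def encodeInt (z : ℤ) : List ℕ := [z.toNat, (-z).toNat]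

def encodeVec (v : V3) : List ℕ := encodeInt (v 0) ++ encodeInt (v 1) ++ encodeInt (v 2)

def Surface.encode (s : Surface) : List ℕ :=
  s.portalable.toNat :: s.verts.length :: s.verts.flatMap encodeVec

def Level.encode (L : Level) : List ℕ :=
  L.terminalVelocity :: L.bound :: (encodeVec L.start ++ encodeVec L.goal ++
    L.surfaces.length :: L.surfaces.flatMap Surface.encode)

/-! ### Orientation, portals, states and inputs -/

/-- The orientation of the avatar, which is the position of the cursor: yaw and pitch. -/
abbrev Orientation (E : Engine) : Type := Fin E.yawSteps × Fin (E.pitchSteps + 1)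

/-- The yaw goes once around. -/
def yawAngle (E : Engine) (o : Orientation E) : ℝ := 2 * Real.pi * (o.1 : ℕ) / E.yawSteps

/-- The pitch goes from straight down to straight up. -/
def pitchAngle (E : Engine) (o : Orientation E) : ℝ :=
  -(Real.pi / 2) + Real.pi * (o.2 : ℕ) / E.pitchSteps

/-- The direction in which the avatar looks and shoots. -/
def viewDir (E : Engine) (o : Orientation E) : V3 :=
  ![round (E.dirScale * (Real.cos (pitchAngle E o) * Real.cos (yawAngle E o))),
    round (E.dirScale * (Real.cos (pitchAngle E o) * Real.sin (yawAngle E o))),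
    round (E.dirScale * Real.sin (pitchAngle E o))]

/-- The horizontal direction to the right of the avatar. -/
def rightDir (E : Engine) (o : Orientation E) : V3 :=
  ![round (E.dirScale * Real.sin (yawAngle E o)), round (-(E.dirScale * Real.cos (yawAngle E o))), 0]

/-- A portal: the surface that carries it, its position, the normal vector of the surface that
points away from the portal to the front, and the horizontal direction to the right as seen by
someone who faces the portal. -/
structure Portal where
  surface : Surface
  pos : V3
  normal : V3
  right : V3

/-- The upward direction of a portal. -/
def Portal.up (P : Portal) : V3 := crossProduct P.normal P.right

inductive Colour : Type
  | blue
  | orange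

/-- A game state.  The position of the avatar is that of the centre of its feet. -/
structure State (E : Engine) where
  pos : V3
  vel : V3
  orientation : Orientation E
  crouched : Bool
  blue : Option Portal
  orange : Option Portal

/-- The user input in one time step. -/
structure Input (E : Engine) where
  cursor : Orientation E
  /-- backward, nothing, forward -/
  walk : SignType
  /-- left, nothing, right -/
  strafe : SignType
  jump : Bool
  crouch : Bool
  /-- fire the Portal Gun -/
  fire : Option Colour

/-! ### The body of the avatar -/

def height (E : Engine) (crouched : Bool) : ℕ := if crouched then E.crouchHeight else E.standHeight

def eyeHeight (E : Engine) (crouched : Bool) : ℕ := if crouched then E.crouchEye else E.standEye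

/-- Lower corner of the body. -/
def bodyLow (E : Engine) (p : V3) : V3 := p - ![(E.halfWidth : ℤ), (E.halfWidth : ℤ), 0]

/-- Upper corner of the body. -/
def bodyHigh (E : Engine) (crouched : Bool) (p : V3) : V3 :=
  p + ![(E.halfWidth : ℤ), (E.halfWidth : ℤ), (height E crouched : ℤ)]

/-- The space that the avatar occupies at position `p`: an open box, so that the avatar may touch
a surface. -/
def body (E : Engine) (crouched : Bool) (p : V3) : Set (Fin 3 → ℝ) :=
  {x | ∀ i, (bodyLow E p i : ℝ) < x i ∧ x i < (bodyHigh E crouched p i : ℝ)}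

/-- No surface stands in the way of an avatar at position `p`. -/
def Free (E : Engine) (L : Level) (crouched : Bool) (p : V3) : Prop :=
  ∀ s ∈ L.surfaces, Disjoint (body E crouched p) s.region

/-- One unit upward. -/
def e₃ : V3 := ![0, 0, 1]

/-- The avatar stands on something. -/
def Grounded (E : Engine) (L : Level) (crouched : Bool) (p : V3) : Prop :=
  ¬ Free E L crouched (p - e₃)

/-! ### The Portal Gun -/

/-- The ray from `eye` in direction `d` crosses the surface `s` at parameter `t`. -/
def Hits (eye d : V3) (s : Surface) (t : ℝ) : Prop :=
  0 ≤ t ∧ s.normal ⬝ᵥ d ≠ 0 ∧ toReal eye + t • toReal d ∈ s.region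

/-- `L.surfaces[j]` is the closest surface on the ray, and is crossed at parameter `t` (of several
surfaces crossed at the same point, the first in the list). -/
def ClosestHit (L : Level) (eye d : V3) (j : Fin L.surfaces.length) (t : ℝ) : Prop :=
  Hits eye d (L.surfaces.get j) t ∧
    ∀ (j' : Fin L.surfaces.length) (t' : ℝ), Hits eye d (L.surfaces.get j') t' →
      t < t' ∨ (t = t' ∧ j ≤ j')

/-- The portal that is created on the surface `s`, crossed at parameter `t`: its position is the
point of the crossing, rounded, and it faces the avatar.  A portal on a wall is upright, one on a
floor or a ceiling is aligned with the orientation of the avatar. -/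
def newPortal (E : Engine) (eye : V3) (o : Orientation E) (s : Surface) (t : ℝ) : Portal :=
  let d := viewDir E o
  let n : V3 := if s.normal ⬝ᵥ d < 0 then s.normal else -s.normal
  { surface := s
    pos := fun i => round ((eye i : ℝ) + t * (d i : ℝ))
    normal := n
    right := if n 0 = 0 ∧ n 1 = 0 then rightDir E o else crossProduct e₃ n }

open scoped Classical in
/-- What a shot from `eye` creates: a portal on the closest surface if it is portalable, and
nothing otherwise. -/
def shot (E : Engine) (L : Level) (eye : V3) (o : Orientation E) : Option Portal :=
  if h : ∃ jt : Fin L.surfaces.length × ℝ, ClosestHit L eye (viewDir E o) jt.1 jt.2 then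
    let s := L.surfaces.get h.choose.1
    if s.portalable then some (newPortal E eye o s h.choose.2) else none
  else none

/-- The portals after a shot: a new portal replaces the old one of the same colour. -/
def shoot (E : Engine) (L : Level) (eye : V3) (o : Orientation E) (fire : Option Colour)
    (bo : Option Portal × Option Portal) : Option Portal × Option Portal :=
  match fire with
  | none => bo
  | some .blue => ((shot E L eye o).or bo.1, bo.2)
  | some .orange => (bo.1, (shot E L eye o).or bo.2)

/-! ### Passing through portals -/

/-- Limit the components of a velocity to the terminal velocity. -/
def Level.clamp (L : Level) (v : V3) : V3 :=
  fun i => max (-(L.terminalVelocity : ℤ)) (min (L.terminalVelocity : ℤ) (v i))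

/-- The component of `v` along `u`, turned into the direction of `w`, in fixed-point arithmetic:
`(v · u / |u|) w / |w|`, rounded toward zero. -/
def transfer (u w v : V3) : V3 :=
  fun i => (((v ⬝ᵥ u) * w i).tdiv (Nat.sqrt ((u ⬝ᵥ u) * (w ⬝ᵥ w)).toNat : ℤ))

/-- The velocity after entering `P` with velocity `v` and leaving `Q`: what goes into `P` comes
out of `Q`, and up remains up. -/
def turnVelocity (P Q : Portal) (v : V3) : V3 :=
  -transfer P.right Q.right v + transfer P.up Q.up v - transfer P.normal Q.normal v

/-- The position of the avatar with the middle of its body `k` units in front of the portal `Q`. -/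
def exitPos (E : Engine) (crouched : Bool) (Q : Portal) (k : ℕ) : V3 :=
  (fun i => Q.pos i + ((k : ℤ) * Q.normal i).tdiv (Nat.sqrt (Q.normal ⬝ᵥ Q.normal).toNat : ℤ))
    - ![0, 0, ((height E crouched / 2 : ℕ) : ℤ)]

open scoped Classical in
/-- Where the avatar leaves `Q`: the first free position in front of it (`none` if the exit is
obstructed). -/
def exit (E : Engine) (L : Level) (crouched : Bool) (Q : Portal) : Option V3 :=
  ((List.range (2 * E.halfWidth + E.standHeight + 5)).map (exitPos E crouched Q)).find?
    (fun p => decide (Free E L crouched p))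

/-- An avatar that tries to move by `u` to the position `p` runs into the portal `P`: it moves
toward the front of `P`, is held up by the surface that carries `P`, and is at the place of `P`. -/
def Enters (E : Engine) (crouched : Bool) (u p : V3) (P : Portal) : Prop :=
  u ⬝ᵥ P.normal < 0 ∧ ¬ Disjoint (body E crouched p) P.surface.region ∧
    ∀ i, bodyLow E p i - E.portalReach ≤ P.pos i ∧
      P.pos i ≤ bodyHigh E crouched p i + E.portalReach

open scoped Classical in
/-- Entering `P` and leaving `Q`: the new position and velocity, if the avatar does so. -/
def passOne (E : Engine) (L : Level) (crouched : Bool) (u p v : V3) (P Q : Option Portal) :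
    Option (V3 × V3) :=
  match P, Q with
  | some P, some Q =>
    if Enters E crouched u p P then
      (exit E L crouched Q).map (fun p' => (p', L.clamp (turnVelocity P Q v)))
    else none
  | _, _ => none

/-- Entering the blue and leaving the orange portal, or the other way round. -/
def pass (E : Engine) (L : Level) (crouched : Bool) (u p v : V3)
    (bo : Option Portal × Option Portal) : Option (V3 × V3) :=
  (passOne E L crouched u p v bo.1 bo.2).or (passOne E L crouched u p v bo.2 bo.1)

/-! ### Motion -/

/-- The avatar in the course of one time step; `disp` is the displacement per time step that is
still in effect, and `done` says that the avatar has gone through a portal, which ends its motion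
in this time step. -/
structure Motion where
  pos : V3
  vel : V3
  disp : V3
  done : Bool

open scoped Classical in
/-- The height to which the avatar climbs in order to move by `u` (`none` if it cannot). -/
def climb (E : Engine) (L : Level) (crouched : Bool) (p u : V3) : Option ℕ :=
  (List.range (E.stepHeight + 1)).find? (fun k =>
    decide (Grounded E L crouched p ∧ (∀ j ≤ k, Free E L crouched (p + (j : ℤ) • e₃)) ∧
      Free E L crouched (p + (k : ℤ) • e₃ + u)))

open scoped Classical in
/-- Move by `ε` (which is `-1`, `0` or `1`) along the axis `i`.  An obstructed avatar goes through
a portal, or climbs a step, or is stopped. -/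
def moveAxis (E : Engine) (L : Level) (crouched : Bool) (bo : Option Portal × Option Portal)
    (i : Fin 3) (ε : ℤ) (m : Motion) : Motion :=
  let u : V3 := Pi.single i ε
  if m.done ∨ ε = 0 then m
  else if Free E L crouched (m.pos + u) then { m with pos := m.pos + u }
  else match pass E L crouched u (m.pos + u) m.vel bo with
    | some (p', v') => { m with pos := p', vel := v', done := true }
    | none =>
      match (if i = 2 then none else climb E L crouched m.pos u) with
      | some k => { m with pos := m.pos + (k : ℤ) • e₃ + u }
      | none => { m with vel := Function.update m.vel i 0, disp := Function.update m.disp i 0 }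

/-- The `k`-th of `N` parts of the displacement `x`, in whole units. -/
def part (N k : ℕ) (x : ℤ) : ℤ :=
  x.sign * (((k + 1) * x.natAbs / N - k * x.natAbs / N : ℕ) : ℤ)

/-- The `k`-th of `N` parts of the motion. -/
def subMove (E : Engine) (L : Level) (crouched : Bool) (bo : Option Portal × Option Portal)
    (N : ℕ) (m : Motion) (k : ℕ) : Motion :=
  let m₀ := moveAxis E L crouched bo 0 (part N k (m.disp 0)) m
  let m₁ := moveAxis E L crouched bo 1 (part N k (m₀.disp 1)) m₀
  moveAxis E L crouched bo 2 (part N k (m₁.disp 2)) m₁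

/-- The whole motion of a time step, along a straight line as long as nothing is in the way. -/
def travel (E : Engine) (L : Level) (crouched : Bool) (bo : Option Portal × Option Portal)
    (m : Motion) : Motion :=
  let N := max (m.disp 0).natAbs (max (m.disp 1).natAbs (m.disp 2).natAbs)
  (List.range N).foldl (subMove E L crouched bo N) m

/-- The horizontal velocity of given speed in the direction chosen by the player. -/
def wish (E : Engine) (speed : ℕ) (inp : Input E) : V3 :=
  let θ := yawAngle E inp.cursor
  let f : ℝ := ((inp.walk : ℤ) : ℝ)
  let r : ℝ := ((inp.strafe : ℤ) : ℝ)
  ![round (speed * (f * Real.cos θ + r * Real.sin θ)),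
    round (speed * (f * Real.sin θ - r * Real.cos θ)), 0]

open scoped Classical in
/-- One time step of the game: turn and crouch, shoot, then move. -/
def next (E : Engine) (L : Level) (s : State E) (inp : Input E) : State E :=
  let crouched : Bool := inp.crouch || !decide (Free E L false s.pos)
  let bo := shoot E L (s.pos + (eyeHeight E crouched : ℤ) • e₃) inp.cursor inp.fire
    (s.blue, s.orange)
  let fall : V3 := s.vel - (E.gravity : ℤ) • e₃
  let vd : V3 × V3 :=
    if Grounded E L crouched s.pos then
      let run := wish E E.runSpeed inp
      let v := L.clamp ![run 0, run 1, if inp.jump then (E.jumpSpeed : ℤ) else fall 2]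
      (v, v)
    else (L.clamp fall, L.clamp (L.clamp fall + wish E E.airSpeed inp))
  let m := travel E L crouched bo ⟨s.pos, vd.1, vd.2, false⟩
  { pos := m.pos
    vel := m.vel
    orientation := inp.cursor
    crouched := crouched
    blue := bo.1
    orange := bo.2 }

/-! ### The decision problem -/

/-- The avatar stands still at the start location, and there are no portals. -/
def initial (E : Engine) (L : Level) : State E where
  pos := L.start
  vel := 0
  orientation := (⟨0, E.yawSteps_pos⟩, 0)
  crouched := false
  blue := none
  orange := none

/-- Some user input leads from `s` to `s'`, and the avatar is still inside the world. -/
def Step (E : Engine) (L : Level) (s s' : State E) : Prop :=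
  (∃ inp : Input E, next E L s inp = s') ∧ ∀ i, |s'.pos i| ≤ (L.bound : ℤ)

/-- The end location lies within the avatar. -/
def Wins (E : Engine) (L : Level) (s : State E) : Prop :=
  ∀ i, bodyLow E s.pos i ≤ L.goal i ∧ L.goal i ≤ bodyHigh E s.crouched s.pos i

/-- The decision problem: can the player bring the avatar from the start location to the end
location? -/
def Traversable (E : Engine) (L : Level) : Prop :=
  ∃ s : State E, Relation.ReflTransGen (Step E L) (initial E L) s ∧ Wins E L s

end

end PortalGame

/-! ## Reasoning about running programs -/

namespace RAM

/-! The theorem rests on counting states. A surviving position is bounded by the coordinate bound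
and a velocity by the terminal velocity. A portal lies at a rounded point of one of the listed
polygons, and its normal and right direction come from that polygon or from the finitely many cursor
positions. Hence all reachable states have codes polynomial in the size of the level, however long
the game lasts. For a fixed engine there is a fixed number of inputs, so the problem is reachability
in a polynomially large graph of constant out-degree. It remains to compute one edge of this graph
in pseudopolynomial time and to run the search on the machine.

Computing an edge. `PT f` says that a program computes `f` on codes, in time polynomial in the level
size plus the numerical value of the code. The class is closed under composition, pairing, case
distinction (`PT.optionElim`) and recursion with polynomially bounded values (`PT.rec`). Bounded
search and integer arithmetic follow, and `PT.next` is assembled from these rules. The real numbers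
in the game are removed in three ways. Sines and cosines depend only on the input and are tabulated
(`PT.of_input`). A ray meets the plane of a surface at a rational parameter, so distances are
compared by cross-multiplication (`hits_iff`, `closestHit_iff`). Whether a box meets a polygon is
decided by brute force (`Surface.meets_iff`): by Carathéodory four vertices suffice, and their
weights solve a homogeneous system of linear inequalities in four unknowns. Fourier-Motzkin
elimination with control of the coefficients (`exists_small_solution`) shows that a solvable system
has integer solutions of polynomial size.

Searching. One mark per code is kept in memory behind the input. Each pass tries every code with
every input. A pass that marks nothing new proves the marked set closed, and otherwise the set
grows, so as many passes as there are possible codes are enough (`Marks.complete_or_card`). Winning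
is turned into reaching one extra object `none`, whose code is `0` (`traversable_iff`), so the
answer is a single mark. The bounds on codes are `next_bounded` and `codesBdd_state`. -/

/-- The program `c`, started on `σ`, halts after at most `T` steps in a configuration that
satisfies `Q`. -/
def Runs (c : RAM) (σ : Config) (T : ℕ) (Q : Config → Prop) : Prop :=
  ∃ t τ, Exec c σ t τ ∧ t ≤ T ∧ Q τ

/-! ### Rules for running times of program constructs -/

theorem Runs.mono {c : RAM} {σ : Config} {T T' : ℕ} {Q Q' : Config → Prop} (h : Runs c σ T Q)
    (hT : T ≤ T') (hQ : ∀ τ, Q τ → Q' τ) : Runs c σ T' Q' := by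
  obtain ⟨t, τ, h₁, h₂, h₃⟩ := h
  exact ⟨t, τ, h₁, h₂.trans hT, hQ τ h₃⟩

theorem runs_const {x c : ℕ} {σ : Config} {Q : Config → Prop}
    (h : Q { σ with reg := Function.update σ.reg x c }) : Runs (.const x c) σ 1 Q :=
  ⟨_, _, .const x c σ, le_rfl, h⟩

theorem runs_add {x y z : ℕ} {σ : Config} {Q : Config → Prop}
    (h : Q { σ with reg := Function.update σ.reg x (σ.reg y + σ.reg z) }) :
    Runs (.add x y z) σ 1 Q :=
  ⟨_, _, .add x y z σ, le_rfl, h⟩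

theorem runs_sub {x y z : ℕ} {σ : Config} {Q : Config → Prop}
    (h : Q { σ with reg := Function.update σ.reg x (σ.reg y - σ.reg z) }) :
    Runs (.sub x y z) σ 1 Q :=
  ⟨_, _, .sub x y z σ, le_rfl, h⟩

theorem runs_load {x y : ℕ} {σ : Config} {Q : Config → Prop}
    (h : Q { σ with reg := Function.update σ.reg x (σ.mem (σ.reg y)) }) :
    Runs (.load x y) σ 1 Q :=
  ⟨_, _, .load x y σ, le_rfl, h⟩

theorem runs_store {x y : ℕ} {σ : Config} {Q : Config → Prop}
    (h : Q { σ with mem := Function.update σ.mem (σ.reg x) (σ.reg y) }) :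
    Runs (.store x y) σ 1 Q :=
  ⟨_, _, .store x y σ, le_rfl, h⟩

theorem Runs.seq {c d : RAM} {σ : Config} {s t : ℕ} {Q : Config → Prop}
    (h : Runs c σ s fun τ => Runs d τ t Q) : Runs (.seq c d) σ (s + t) Q := by
  obtain ⟨s', τ, h₁, h₂, t', υ, h₃, h₄, h₅⟩ := h
  exact ⟨_, υ, .seq h₁ h₃, by omega, h₅⟩

theorem runs_cond {x : ℕ} {c d : RAM} {σ : Config} {T : ℕ} {Q : Config → Prop}
    (h₁ : σ.reg x ≠ 0 → Runs c σ T Q) (h₀ : σ.reg x = 0 → Runs d σ T Q) :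
    Runs (.cond x c d) σ (T + 1) Q := by
  by_cases h : σ.reg x = 0
  · obtain ⟨t, τ, h₁, h₂, h₃⟩ := h₀ h
    exact ⟨_, τ, .condFalse h h₁, by omega, h₃⟩
  · obtain ⟨t, τ, h₁, h₂, h₃⟩ := h₁ h
    exact ⟨_, τ, .condTrue h h₁, by omega, h₃⟩

/-- A loop with the invariant `I k`, where `k` is the number of rounds that are left. -/
theorem runs_loop {x : ℕ} {c : RAM} (I : ℕ → Config → Prop) (T : ℕ)
    (h0 : ∀ τ, I 0 τ → τ.reg x = 0)
    (hs : ∀ k τ, I (k + 1) τ → τ.reg x ≠ 0 ∧ Runs c τ T (I k)) (n : ℕ) :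
    ∀ σ, I n σ → Runs (.loop x c) σ (n * (T + 1) + 1) (I 0) := by
  induction n with
  | zero => exact fun σ h => ⟨1, σ, .loopStop (h0 σ h), by omega, h⟩
  | succ n ih =>
    intro σ h
    obtain ⟨hx, s, τ, h₁, h₂, h₃⟩ := hs n σ h
    obtain ⟨t, υ, h₄, h₅, h₆⟩ := ih τ h₃
    exact ⟨_, υ, .loopStep hx h₁ h₄, by rw [Nat.succ_mul]; omega, h₆⟩

/-- The memory and the registers below `r` are the same in both configurations. -/
def Keeps (r : ℕ) (σ τ : Config) : Prop := τ.mem = σ.mem ∧ ∀ i < r, τ.reg i = σ.reg i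

theorem Keeps.refl (r : ℕ) (σ : Config) : Keeps r σ σ := ⟨rfl, fun _ _ => rfl⟩

theorem Keeps.mono {r s : ℕ} {σ τ : Config} (h : Keeps s σ τ) (hr : r ≤ s := by omega) :
    Keeps r σ τ :=
  ⟨h.1, fun i hi => h.2 i (by omega)⟩

theorem Keeps.trans {r s : ℕ} {σ τ υ : Config} (h₁ : Keeps r σ τ) (h₂ : Keeps s τ υ)
    (h : r ≤ s := by omega) : Keeps r σ υ :=
  ⟨h₂.1.trans h₁.1, fun i hi => (h₂.2 i (by omega)).trans (h₁.2 i hi)⟩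

theorem Keeps.update {r x v : ℕ} {σ τ : Config} (h : Keeps r σ τ) (hx : r ≤ x := by omega) :
    Keeps r σ { τ with reg := Function.update τ.reg x v } :=
  ⟨h.1, fun i hi => by simpa [Function.update_apply, Nat.ne_of_lt (lt_of_lt_of_le hi hx)] using h.2 i hi⟩

/-- Copy register `y` to register `x`. -/
def move (x y : ℕ) : RAM := .seq (.const x 0) (.add x y x)

theorem runs_move {x y : ℕ} {σ : Config} {Q : Config → Prop} (hxy : y ≠ x)
    (h : Q { σ with reg := Function.update σ.reg x (σ.reg y) }) : Runs (move x y) σ 2 Q := by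
  refine (runs_const (runs_add ?_)).seq (s := 1) (t := 1)
  simpa [Function.update_apply, hxy] using h

end RAM

/-! ## Polynomial bounds -/

/-- `g` is bounded by a power of its argument (beginning with the argument `2`). -/
def PolyBound (g : ℕ → ℕ) : Prop := ∃ k, ∀ N, 2 ≤ N → g N ≤ N ^ k

namespace PolyBound

theorem id : PolyBound fun N => N := ⟨1, fun _ _ => by simp⟩

theorem const (c : ℕ) : PolyBound fun _ => c :=
  ⟨c, fun _ hN => (Nat.lt_two_pow_self).le.trans (Nat.pow_le_pow_left hN c)⟩

theorem mul {f g : ℕ → ℕ} : PolyBound f → PolyBound g → PolyBound fun N => f N * g N := by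
  rintro ⟨j, hj⟩ ⟨k, hk⟩
  exact ⟨j + k, fun N hN => by rw [pow_add]; exact Nat.mul_le_mul (hj N hN) (hk N hN)⟩

theorem add {f g : ℕ → ℕ} : PolyBound f → PolyBound g → PolyBound fun N => f N + g N := by
  rintro ⟨j, hj⟩ ⟨k, hk⟩
  refine ⟨j + k + 1, fun N hN => ?_⟩
  have h₁ : N ^ j ≤ N ^ (j + k) := Nat.pow_le_pow_right (by omega) (by omega)
  have h₂ : N ^ k ≤ N ^ (j + k) := Nat.pow_le_pow_right (by omega) (by omega)
  -- The factor 2 of the sum is absorbed by one more power of `N`; this is why arguments start at 2.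
  have h₃ : N ^ (j + k) * 2 ≤ N ^ (j + k) * N := Nat.mul_le_mul_left _ hN
  have := hj N hN
  have := hk N hN
  rw [pow_succ]
  beta_reduce
  omega

theorem pow {f : ℕ → ℕ} (hf : PolyBound f) (e : ℕ) : PolyBound fun N => f N ^ e := by
  obtain ⟨k, hk⟩ := hf
  exact ⟨k * e, fun N hN => by rw [pow_mul]; exact Nat.pow_le_pow_left (hk N hN) e⟩

end PolyBound

namespace PortalGame

open RAM

/-! ## Representation of objects by numbers -/

/-- `Rep.R L n a`: in the level `L`, the number `n` is a code of the object `a`. -/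
class Rep (α : Type) where
  R : Level → ℕ → α → Prop

/-- The size of a level, in which running times are measured. -/
def levelSize (L : Level) : ℕ := L.encode.length + L.encode.foldr max 0

/-- The level `L` is present in the memory. -/
def Loaded (L : Level) (σ : Config) : Prop :=
  σ.reg 0 = L.encode.length ∧ ∀ i < L.encode.length, σ.mem i = L.encode.getD i 0

theorem Loaded.keeps {L : Level} {σ τ : Config} {r : ℕ} (h : Loaded L σ) (hk : Keeps r σ τ)
    (hr : 1 ≤ r := by omega) : Loaded L τ :=
  ⟨(hk.2 0 (by omega)).trans h.1, fun i hi => by rw [hk.1, h.2 i hi]⟩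

variable {α β γ δ : Type} [Rep α] [Rep β] [Rep γ] [Rep δ]

/-- The function `f` is computable in pseudopolynomial time: for each register `r` there is a
program that takes a code of the argument from register `r` and puts a code of the value there;
the memory and the lower registers are not changed. -/
def PT (f : α → β) : Prop :=
  ∀ r, 1 ≤ r → ∃ (c : RAM) (k : ℕ), ∀ L : Level, L.WellFormed → ∀ (n : ℕ) (a : α), Rep.R L n a →
    ∀ σ : Config, Loaded L σ → σ.reg r = n →
      Runs c σ ((levelSize L + n + 2) ^ k) fun τ =>
        Keeps r σ τ ∧ τ.reg r ≤ (levelSize L + n + 2) ^ k ∧ Rep.R L (τ.reg r) (f a)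

/-- The codes of the values of `f` are polynomially bounded in the codes of the arguments. -/
def PolyBdd (f : α → β) : Prop :=
  ∃ k : ℕ, ∀ L : Level, L.WellFormed → ∀ (n : ℕ) (a : α), Rep.R L n a →
    ∀ m, Rep.R L m (f a) → m ≤ (levelSize L + n + 2) ^ k

/-- Criterion for `PT` in terms of a polynomial bound. -/
theorem PT.of_program {f : α → β}
    (h : ∀ r, 1 ≤ r → ∃ (c : RAM) (g : ℕ → ℕ), PolyBound g ∧
      ∀ L : Level, L.WellFormed → ∀ (n : ℕ) (a : α), Rep.R L n a →
      ∀ σ : Config, Loaded L σ → σ.reg r = n →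
        Runs c σ (g (levelSize L + n + 2)) fun τ =>
          Keeps r σ τ ∧ τ.reg r ≤ g (levelSize L + n + 2) ∧ Rep.R L (τ.reg r) (f a)) : PT f := by
  intro r hr
  obtain ⟨c, g, ⟨k, hk⟩, hc⟩ := h r hr
  refine ⟨c, k, fun L hL n a ha σ hσ hn => ?_⟩
  have := hk (levelSize L + n + 2) (by omega)
  exact (hc L hL n a ha σ hσ hn).mono this fun τ hτ => ⟨hτ.1, hτ.2.1.trans this, hτ.2.2⟩

/-- The same program works for both functions when their codes agree. Most types below borrow their
codes from pairs, numbers or options, and this carries computability over to them. -/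
theorem PT.transport {f : α → β} {g : γ → δ} (hg : PT g)
    (h : ∀ L : Level, L.WellFormed → ∀ (n : ℕ) (a : α), Rep.R L n a → ∃ b : γ, Rep.R L n b ∧
      ∀ m, Rep.R L m (g b) → Rep.R L m (f a)) : PT f := by
  intro r hr
  obtain ⟨c, k, hc⟩ := hg r hr
  refine ⟨c, k, fun L hL n a ha σ hσ hn => ?_⟩
  obtain ⟨b, hb, hm⟩ := h L hL n a ha
  exact (hc L hL n b hb σ hσ hn).mono le_rfl fun τ hτ => ⟨hτ.1, hτ.2.1, hm _ hτ.2.2⟩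

theorem PT.of_rep {f : α → β}
    (h : ∀ L : Level, L.WellFormed → ∀ (n : ℕ) (a : α), Rep.R L n a → Rep.R L n (f a)) :
    PT f := by
  -- The machine has no empty program; writing to the scratch register `r + 1` takes its place.
  refine PT.of_program fun r hr => ⟨.const (r + 1) 0, fun N => N + 1, .add .id (.const 1), ?_⟩
  intro L hL n a ha σ hσ hn
  beta_reduce
  refine (runs_const ?_).mono (by omega) (fun _ h => h)
  refine ⟨(Keeps.refl r σ).update, ?_, ?_⟩
  · simp; omega
  · simpa [Function.update_apply, hn] using h L hL n a ha

theorem PT.id : PT fun a : α => a := .of_rep fun _ _ _ _ h => h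

/-- The second program is polynomial in the code it receives, so the code of the intermediate value
has to be polynomially bounded. This is the reason for the bound on the output in `PT`. -/
theorem PT.comp {g : β → γ} {f : α → β} (hg : PT g) (hf : PT f) : PT fun a => g (f a) := by
  refine PT.of_program fun r hr => ?_
  obtain ⟨c, j, hc⟩ := hf r hr
  obtain ⟨d, k, hd⟩ := hg r hr
  refine ⟨.seq c d, fun N => N ^ j + (N ^ j + N) ^ k, .add (.pow .id j) (.pow (.add (.pow .id j)
    .id) k), fun L hL n a ha σ hσ hn => ?_⟩
  beta_reduce
  refine Runs.seq ((hc L hL n a ha σ hσ hn).mono le_rfl ?_)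
  rintro τ ⟨h₁, h₂, h₃⟩
  have hle : (levelSize L + τ.reg r + 2) ^ k ≤
      ((levelSize L + n + 2) ^ j + (levelSize L + n + 2)) ^ k :=
    Nat.pow_le_pow_left (by omega) k
  refine (hd L hL _ _ h₃ τ (hσ.keeps h₁) rfl).mono hle ?_
  rintro υ ⟨h₄, h₅, h₆⟩
  exact ⟨h₁.trans h₄, by omega, h₆⟩

theorem PT.congr {f g : α → β} (hf : PT f) (h : ∀ a, f a = g a) : PT g := by
  rwa [show g = f from (funext h).symm]

/-! ### Pairs -/

/-- The triangular numbers. -/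
def tri : ℕ → ℕ
  | 0 => 0
  | n + 1 => tri n + (n + 1)

/-- The code of a pair. -/
def cpair (a b : ℕ) : ℕ := tri (a + b) + a

theorem tri_mono {a b : ℕ} (h : a ≤ b) : tri a ≤ tri b := by
  induction h with
  | refl => exact le_rfl
  | step _ ih => exact ih.trans (by simp [tri])

theorem le_tri (n : ℕ) : n ≤ tri n := by
  cases n <;> simp [tri]

theorem tri_le (n : ℕ) : tri n ≤ n * n := by
  induction n with
  | zero => simp [tri]
  | succ n ih => simp only [tri]; nlinarith

theorem left_le_cpair (a b : ℕ) : a ≤ cpair a b := by simp [cpair]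

theorem right_le_cpair (a b : ℕ) : b ≤ cpair a b := by
  have := le_tri (a + b)
  simp only [cpair]; omega

theorem cpair_le (a b : ℕ) : cpair a b ≤ (a + b + 1) ^ 2 := by
  have := tri_le (a + b)
  simp only [cpair]; nlinarith

theorem cpair_mono {a b c d : ℕ} (h₁ : a ≤ c) (h₂ : b ≤ d) : cpair a b ≤ cpair c d :=
  Nat.add_le_add (tri_mono (by omega)) h₁

theorem cpair_inj {a b c d : ℕ} (h : cpair a b = cpair c d) : a = c ∧ b = d := by
  -- A code lies on the diagonal of its sum: the next triangular number exceeds `tri (c + d) + c`,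
  -- so a larger sum gives a larger code.
  have key : ∀ {a b c d : ℕ}, cpair a b = cpair c d → a + b ≤ c + d := by
    intro a b c d h
    by_contra! hlt
    have h₁ := tri_mono (show c + d + 1 ≤ a + b from hlt)
    simp only [cpair, tri] at h h₁
    omega
  have h₁ := key h
  have h₂ := key h.symm
  have h₃ : a + b = c + d := le_antisymm h₁ h₂
  simp only [cpair, h₃] at h
  omega

/-- Put the code of the pair of the registers `x` and `y` into register `r`. -/
def pairProg (x y r : ℕ) : RAM :=
  .seq (.add (r + 1) x y) (.seq (move r x) (.seq (.const (r + 2) 1)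
    (.loop (r + 1) (.seq (.add r r (r + 1)) (.sub (r + 1) (r + 1) (r + 2))))))

/-- The triangular number is summed by counting `k` down from the sum of the two parts: register `r`
plus `tri k` does not change. No multiplication is needed and the time is linear. -/
theorem runs_pairProg {x y r : ℕ} (hx : x < r) (σ : Config) :
    Runs (pairProg x y r) σ (4 * (σ.reg x + σ.reg y) + 10) fun τ =>
      Keeps r σ τ ∧ τ.reg r = cpair (σ.reg x) (σ.reg y) := by
  set s := σ.reg x + σ.reg y with hs
  refine Runs.mono (T := 1 + (2 + (1 + (s * (2 + 1) + 1)))) ?_ (by omega) (fun _ h => h)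
  refine Runs.seq (runs_add (Runs.seq (runs_move (by omega) (Runs.seq (runs_const ?_)))))
  refine Runs.mono (runs_loop (fun k τ => Keeps r σ τ ∧ τ.reg (r + 1) = k ∧ τ.reg (r + 2) = 1 ∧
    τ.reg r + tri k = cpair (σ.reg x) (σ.reg y)) 2 ?_ ?_ s _ ?_) le_rfl ?_
  · exact fun τ h => h.2.1
  · rintro k τ ⟨h₁, h₂, h₃, h₄⟩
    refine ⟨by omega, Runs.seq (s := 1) (t := 1) (runs_add (runs_sub ?_))⟩
    refine ⟨h₁.update.update, ?_, ?_, ?_⟩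
    · simp [h₂, h₃]
    · simp [h₃]
    · simp only [tri] at h₄
      simp [h₂]; omega
  · refine ⟨(Keeps.refl r σ).update.update.update, ?_, ?_, ?_⟩ <;>
      simp [cpair, hs, (hx.trans r.lt_succ_self).ne]
    omega
  · rintro τ ⟨h₁, -, -, h₄⟩
    exact ⟨h₁, by simpa [tri] using h₄⟩

/-- Split the code in register `r` into the two parts, in the registers `r` and `r + 1`. -/
def unpairProg (r : ℕ) : RAM :=
  .seq (.const (r + 1) 0) (.seq (.const (r + 2) 1) (.seq (.sub (r + 3) r (r + 1))
    (.seq (.loop (r + 3) (.seq (.add (r + 1) (r + 1) (r + 2)) (.seq (.sub r r (r + 1))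
      (.sub (r + 3) r (r + 1))))) (.sub (r + 1) (r + 1) r))))

/-- Subtracting `1, 2, 3, …` from the code keeps `code - tri d` in register `r`, where `d` is in
register `r + 1`. The first `d` not below this remainder is `a + b`; then the remainder is `a` and
`d - a` is `b`. -/
theorem runs_unpairProg {a b r : ℕ} (σ : Config) (h : σ.reg r = cpair a b) :
    Runs (unpairProg r) σ (4 * (a + b) + 10) fun τ =>
      Keeps r σ τ ∧ τ.reg r = a ∧ τ.reg (r + 1) = b := by
  refine Runs.mono (T := 1 + (1 + (1 + (((a + b) * (3 + 1) + 1) + 1)))) ?_ (by omega)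
    (fun _ h => h)
  refine Runs.seq (runs_const (Runs.seq (runs_const (Runs.seq (runs_sub (Runs.seq ?_))))))
  refine Runs.mono (runs_loop (fun k τ => Keeps r σ τ ∧ τ.reg (r + 1) + k = a + b ∧
    τ.reg (r + 2) = 1 ∧ τ.reg r + tri (τ.reg (r + 1)) = cpair a b ∧
    τ.reg (r + 3) = τ.reg r - τ.reg (r + 1)) 3 ?_ ?_ (a + b) _ ?_) le_rfl ?_
  · rintro τ ⟨h₁, h₂, h₃, h₄, h₅⟩
    rw [add_zero] at h₂
    rw [h₅]
    simp only [cpair, h₂] at h₄ ⊢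
    omega
  · rintro k τ ⟨h₁, h₂, h₃, h₄, h₅⟩
    have h₆ : tri (τ.reg (r + 1) + 1) ≤ tri (a + b) := tri_mono (by omega)
    simp only [cpair, tri] at h₄ h₆
    refine ⟨by omega, Runs.seq (s := 1) (t := 2) (runs_add (Runs.seq (s := 1) (t := 1)
      (runs_sub (runs_sub ?_))))⟩
    refine ⟨h₁.update.update.update, ?_, ?_, ?_, ?_⟩
    · simp [h₃]; omega
    · simp [h₃]
    · simp [h₃, tri, cpair]; omega
    · simp [h₃]
  · refine ⟨(Keeps.refl r σ).update.update.update, ?_, ?_, ?_, ?_⟩ <;>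
      simp [h, tri]
  · rintro τ ⟨h₁, h₂, h₃, h₄, h₅⟩
    refine runs_sub ⟨h₁.update, ?_⟩
    rw [add_zero] at h₂
    simp only [cpair, h₂] at h₄
    simp [h₂]; omega

instance : Rep ℕ := ⟨fun _ n a => n = a⟩

instance : Rep (α × β) :=
  ⟨fun L n x => ∃ a b, n = cpair a b ∧ Rep.R L a x.1 ∧ Rep.R L b x.2⟩

theorem PT.fst : PT (Prod.fst : α × β → α) := by
  refine PT.of_program fun r hr => ⟨unpairProg r, fun N => 8 * N + 10,
    .add (.mul (.const 8) .id) (.const 10), ?_⟩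
  rintro L hL n x ⟨a, b, hn, ha, hb⟩ σ hσ hr
  beta_reduce
  have h₁ := left_le_cpair a b
  have h₂ := right_le_cpair a b
  refine (runs_unpairProg σ (hr.trans hn)).mono (by omega) ?_
  rintro τ ⟨h₃, h₄, h₅⟩
  exact ⟨h₃, by omega, by rwa [h₄]⟩

theorem PT.snd : PT (Prod.snd : α × β → β) := by
  refine PT.of_program fun r hr => ⟨.seq (unpairProg r) (move r (r + 1)), fun N => 8 * N + 12,
    .add (.mul (.const 8) .id) (.const 12), ?_⟩
  rintro L hL n x ⟨a, b, hn, ha, hb⟩ σ hσ hr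
  beta_reduce
  have h₁ := left_le_cpair a b
  have h₂ := right_le_cpair a b
  refine Runs.mono (T := 4 * (a + b) + 10 + 2) (Runs.seq ?_) (by omega) (fun _ h => h)
  refine (runs_unpairProg σ (hr.trans hn)).mono (by omega) ?_
  rintro τ ⟨h₃, h₄, h₅⟩
  refine runs_move (by omega) ⟨h₃.update, ?_, ?_⟩
  · simp [h₅]; omega
  · simpa [h₅] using hb

/-- The programs run on copies in the registers `r + 1` and `r + 2`, so that the argument survives
the first and the first result survives the second. This is what the freedom of `r` in `PT` is for.
-/
theorem PT.prodMk {f : α → β} {g : α → γ} (hf : PT f) (hg : PT g) : PT fun a => (f a, g a) := by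
  refine PT.of_program fun r hr => ?_
  obtain ⟨c, j, hc⟩ := hf (r + 1) (by omega)
  obtain ⟨d, k, hd⟩ := hg (r + 2) (by omega)
  refine ⟨.seq (move (r + 1) r) (.seq c (.seq (move (r + 2) r) (.seq d (.seq
    (pairProg (r + 1) (r + 2) (r + 3)) (move r (r + 3)))))),
    fun N => 20 + 5 * (N ^ j + N ^ k) + (N ^ j + N ^ k + 1) ^ 2,
    .add (.add (.const 20) (.mul (.const 5) (.add (.pow .id j) (.pow .id k))))
      (.pow (.add (.add (.pow .id j) (.pow .id k)) (.const 1)) 2), ?_⟩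
  intro L hL n a ha σ hσ hn
  beta_reduce
  generalize hN : levelSize L + n + 2 = N at *
  refine Runs.mono (T := 2 + (N ^ j + (2 + (N ^ k + (4 * (N ^ j + N ^ k) + 10 + 2))))) ?_
    (by omega) (fun _ h => h)
  refine Runs.seq (runs_move (by omega) (Runs.seq ?_))
  have hσ₁ : Keeps (r + 1) σ { σ with reg := Function.update σ.reg (r + 1) (σ.reg r) } :=
    (Keeps.refl _ _).update
  refine (hc L hL n a ha _ (hσ.keeps hσ₁) (by simpa using hn)).mono (by rw [hN]) ?_
  rintro τ ⟨h₁, h₂, h₃⟩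
  rw [hN] at h₂
  replace h₁ := hσ₁.trans h₁
  refine Runs.seq (runs_move (by omega) (Runs.seq ?_))
  have hτ : Keeps (r + 2) τ { τ with reg := Function.update τ.reg (r + 2) (τ.reg r) } :=
    (Keeps.refl _ _).update
  refine (hd L hL n a ha _ ((hσ.keeps h₁).keeps hτ) (by simp [h₁.2 r (by omega), hn])).mono
    (by rw [hN]) ?_
  rintro υ ⟨h₄, h₅, h₆⟩
  rw [hN] at h₅
  replace h₄ := hτ.trans h₄
  have h₇ := h₄.2 (r + 1) (by omega)
  refine Runs.seq ((runs_pairProg (by omega) υ).mono (by omega) ?_)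
  rintro ω ⟨h₈, h₉⟩
  refine runs_move (by omega) ⟨?_, ?_, ?_⟩
  · exact ((h₁.mono.trans h₄ : Keeps r σ υ).trans h₈).update
  · have h₁₀ := cpair_le (υ.reg (r + 1)) (υ.reg (r + 2))
    have : (υ.reg (r + 1) + υ.reg (r + 2) + 1) ^ 2 ≤ (N ^ j + N ^ k + 1) ^ 2 :=
      Nat.pow_le_pow_left (by omega) 2
    simp only [Function.update_self, h₉]
    omega
  · exact ⟨_, _, by simpa using h₉, by rwa [h₇], h₆⟩

/-! ### Basic functions -/

theorem PT.const_nat (c : ℕ) : PT fun _ : α => c := by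
  refine PT.of_program fun r hr => ⟨.const r c, fun _ => 1 + c, .const _, ?_⟩
  intro L hL n a ha σ hσ hn
  beta_reduce
  refine (runs_const ⟨(Keeps.refl r σ).update, ?_, ?_⟩).mono (by omega) (fun _ h => h)
  · simp
  · simp [Rep.R]

theorem PT.natAdd : PT fun x : ℕ × ℕ => x.1 + x.2 := by
  refine PT.of_program fun r hr => ⟨.seq (unpairProg r) (.add r r (r + 1)), fun N => 8 * N + 11,
    .add (.mul (.const 8) .id) (.const 11), ?_⟩
  rintro L hL n _ ⟨a, b, hn, ha, hb⟩ σ hσ hr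
  beta_reduce
  have h₁ := left_le_cpair a b
  have h₂ := right_le_cpair a b
  refine Runs.mono (T := 4 * (a + b) + 10 + 1) (Runs.seq ?_) (by omega) (fun _ h => h)
  refine (runs_unpairProg σ (hr.trans hn)).mono (by omega) ?_
  rintro τ ⟨h₃, h₄, h₅⟩
  refine runs_add ⟨h₃.update, ?_, ?_⟩
  · simp [h₄, h₅]; omega
  · simp only [Rep.R] at ha hb
    simp [h₄, h₅, Rep.R, ha, hb]

theorem PT.natSub : PT fun x : ℕ × ℕ => x.1 - x.2 := by
  refine PT.of_program fun r hr => ⟨.seq (unpairProg r) (.sub r r (r + 1)), fun N => 8 * N + 11,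
    .add (.mul (.const 8) .id) (.const 11), ?_⟩
  rintro L hL n _ ⟨a, b, hn, ha, hb⟩ σ hσ hr
  beta_reduce
  have h₁ := left_le_cpair a b
  have h₂ := right_le_cpair a b
  refine Runs.mono (T := 4 * (a + b) + 10 + 1) (Runs.seq ?_) (by omega) (fun _ h => h)
  refine (runs_unpairProg σ (hr.trans hn)).mono (by omega) ?_
  rintro τ ⟨h₃, h₄, h₅⟩
  refine runs_sub ⟨h₃.update, ?_, ?_⟩
  · simp [h₄, h₅]; omega
  · simp only [Rep.R] at ha hb
    simp [h₄, h₅, Rep.R, ha, hb]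

/-! ### The input -/

/-- A level carries no information in its code: the only represented level is the one in memory, and
any number, in particular `0`, stands for it. -/
instance : Rep Level := ⟨fun L _ L' => L' = L⟩

theorem PT.inputLength : PT fun L : Level => L.encode.length := by
  refine PT.of_program fun r hr => ⟨move r 0, fun N => N + 2, .add .id (.const 2), ?_⟩
  rintro L hL n _ rfl σ hσ hr
  beta_reduce
  refine Runs.mono (T := 2) (runs_move (by omega) ⟨(Keeps.refl r σ).update, ?_, ?_⟩) (by omega)
    (fun _ h => h)
  · simp only [Function.update_self, hσ.1, levelSize]; omega
  · simp [Rep.R, hσ.1]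

theorem getD_le_foldr_max (l : List ℕ) (i : ℕ) : l.getD i 0 ≤ l.foldr max 0 := by
  induction l generalizing i with
  | nil => simp
  | cons a l ih =>
    cases i with
    | zero => simp
    | succ i => simpa using Or.inr (ih i)

/-- The index is compared with the length in register `0` before the access, because the memory
behind the input is not known to be zero (the search keeps its marks there). -/
theorem PT.inputGet : PT fun x : Level × ℕ => x.1.encode.getD x.2 0 := by
  refine PT.of_program fun r hr => ⟨.seq (unpairProg r) (.seq (.sub r 0 (r + 1))
    (.cond r (.load r (r + 1)) (.const r 0))), fun N => 8 * N + 13,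
    .add (.mul (.const 8) .id) (.const 13), ?_⟩
  rintro L hL n ⟨L', i'⟩ ⟨a, i, hn, hL', hi⟩ σ hσ hr
  beta_reduce
  obtain rfl : L' = L := hL'
  obtain rfl : i = i' := hi
  have h₁ := left_le_cpair a i
  have h₂ := right_le_cpair a i
  refine Runs.mono (T := 4 * (a + i) + 10 + (1 + (1 + 1))) (Runs.seq ?_) (by omega)
    (fun _ h => h)
  refine (runs_unpairProg σ (hr.trans hn)).mono (by omega) ?_
  rintro τ ⟨h₃, h₄, h₅⟩
  have hτ := hσ.keeps h₃
  have hle : L'.encode.getD i 0 ≤ levelSize L' := by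
    have := getD_le_foldr_max L'.encode i
    rw [List.getD_eq_getElem?_getD] at this ⊢
    simp only [levelSize]; omega
  rw [List.getD_eq_getElem?_getD] at hle
  refine Runs.seq (runs_sub (runs_cond (fun h => runs_load ?_) (fun h => runs_const ?_)))
  all_goals simp [h₅, hτ.1] at h
  · refine ⟨h₃.update.update, ?_, ?_⟩
    · simp [h₅, hτ.2 i (Nat.lt_of_sub_ne_zero h)]; omega
    · simp [h₅, hτ.2 i (Nat.lt_of_sub_ne_zero h), Rep.R]
  · refine ⟨h₃.update.update, ?_, ?_⟩
    · simp
    · simp [Rep.R, List.getElem?_eq_none (Nat.sub_eq_zero_iff_le.1 h)]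

end PortalGame

namespace PortalGame

open RAM

variable {α β γ δ : Type} [Rep α] [Rep β] [Rep γ] [Rep δ]

/-! ### Case distinctions and recursion -/

instance : Rep (Option α) :=
  ⟨fun L n o => match o with
    | none => n = 0
    | some a => ∃ m, n = m + 1 ∧ Rep.R L m a⟩

/-- Since `none` has the code `0` and `some` the codes shifted by one, the case distinction is a
test for zero. This is the source of all branching below. -/
theorem PT.optionElim {o : α → Option β} {f : α → γ} {g : α × β → γ} (ho : PT o) (hf : PT f)
    (hg : PT g) : PT fun a => (o a).elim (f a) fun b => g (a, b) := by
  refine PT.of_program fun r hr => ?_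
  obtain ⟨co, i, hco⟩ := ho (r + 1) (by omega)
  obtain ⟨cf, j, hcf⟩ := hf r hr
  obtain ⟨cg, k, hcg⟩ := hg r hr
  refine ⟨.seq (move (r + 1) r) (.seq co (.cond (r + 1)
    (.seq (.const (r + 2) 1) (.seq (.sub (r + 1) (r + 1) (r + 2))
      (.seq (pairProg r (r + 1) (r + 2)) (.seq (move r (r + 2)) cg)))) cf)),
    fun N => 20 + 4 * (N + N ^ i) + N ^ i + N ^ j + (N + (N + N ^ i + 1) ^ 2) ^ k,
    .add (.add (.add (.add (.const 20) (.mul (.const 4) (.add .id (.pow .id i)))) (.pow .id i))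
      (.pow .id j)) (.pow (.add .id (.pow (.add (.add .id (.pow .id i)) (.const 1)) 2)) k), ?_⟩
  intro L hL n a ha σ hσ hn
  beta_reduce
  generalize hN : levelSize L + n + 2 = N at *
  refine Runs.mono (T := 2 + (N ^ i + ((1 + (1 + (4 * (N + N ^ i) + 10 + (2 +
    (N + (N + N ^ i + 1) ^ 2) ^ k))) + N ^ j) + 1))) ?_ (by omega) (fun _ h => h)
  refine Runs.seq (runs_move (by omega) (Runs.seq ?_))
  have hσ₁ : Keeps (r + 1) σ { σ with reg := Function.update σ.reg (r + 1) (σ.reg r) } :=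
    (Keeps.refl _ _).update
  refine (hco L hL n a ha _ (hσ.keeps hσ₁) (by simpa using hn)).mono (by rw [hN]) ?_
  rintro τ ⟨h₁, h₂, h₃⟩
  rw [hN] at h₂
  replace h₁ := hσ₁.trans h₁
  have hτr : τ.reg r = n := (h₁.2 r (by omega)).trans hn
  have hkτ : Keeps r σ τ := h₁.mono
  refine runs_cond (fun h => ?_) (fun h => ?_)
  · cases hoa : o a with
    | none => rw [hoa] at h₃; exact absurd h₃ h
    | some b =>
      rw [hoa] at h₃
      obtain ⟨m, hm, hb⟩ := h₃
      refine Runs.mono (T := 1 + (1 + (4 * (N + N ^ i) + 10 + (2 +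
        (N + (N + N ^ i + 1) ^ 2) ^ k)))) ?_ (by omega) (fun _ h => h)
      refine Runs.seq (runs_const (Runs.seq (runs_sub (Runs.seq ?_))))
      refine (runs_pairProg (by omega) _).mono ?_ ?_
      · simp [hm, hτr]; omega
      rintro υ ⟨h₄, h₅⟩
      simp [hm, hτr] at h₅
      refine Runs.seq (runs_move (by omega) ?_)
      have hυ : Keeps r σ υ := hkτ.update.update.trans h₄
      have h₆ : cpair n m ≤ (N + N ^ i + 1) ^ 2 :=
        (cpair_le n m).trans (Nat.pow_le_pow_left (by omega) 2)
      have h₇ : (levelSize L + cpair n m + 2) ^ k ≤ (N + (N + N ^ i + 1) ^ 2) ^ k :=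
        Nat.pow_le_pow_left (by omega) k
      refine (hcg L hL (cpair n m) (a, b) ⟨n, m, rfl, ha, hb⟩ _ (hσ.keeps hυ.update)
        (by simpa using h₅)).mono h₇ ?_
      rintro ω ⟨h₈, h₉, h₁₀⟩
      exact ⟨hυ.update.trans h₈, by omega, h₁₀⟩
  · cases hoa : o a with
    | some b =>
      rw [hoa] at h₃
      obtain ⟨m, hm, -⟩ := h₃
      omega
    | none =>
      refine (hcf L hL n a ha τ (hσ.keeps h₁) hτr).mono (by rw [hN]; omega) ?_
      rintro υ ⟨h₄, h₅, h₆⟩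
      rw [hN] at h₅
      exact ⟨hkτ.trans h₄, by omega, h₆⟩

/-- Iterating a polynomial-time step can make values explode, so a bound on `F` itself is demanded;
with it every round costs a polynomial amount, and the number of rounds is at most the code of the
argument. -/
theorem PT.rec {F : α × ℕ → β} {init : α → β} {body : (α × ℕ) × β → β} (hi : PT init)
    (hb : PT body) (hF : PolyBdd F) (h0 : ∀ a, F (a, 0) = init a)
    (hs : ∀ a k, F (a, k + 1) = body ((a, k), F (a, k))) : PT F := by
  refine PT.of_program fun r hr => ?_
  obtain ⟨ci, i, hci⟩ := hi (r + 2) (by omega)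
  obtain ⟨cb, j, hcb⟩ := hb (r + 5) (by omega)
  obtain ⟨k, hk⟩ := hF
  refine ⟨.seq (unpairProg r) (.seq (move (r + 2) r) (.seq ci (.seq (.const (r + 3) 0) (.seq
    (.loop (r + 1) (.seq (pairProg r (r + 3) (r + 4)) (.seq (pairProg (r + 4) (r + 2) (r + 5))
      (.seq cb (.seq (move (r + 2) (r + 5)) (.seq (.const (r + 4) 1)
        (.seq (.add (r + 3) (r + 3) (r + 4)) (.sub (r + 1) (r + 1) (r + 4))))))))) (move r (r + 2)))))),
    fun N => 20 + 8 * N + N ^ i + N ^ k +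
      N * (8 * N + 30 + 4 * (N + N ^ k) + (N + (N + N ^ k + 1) ^ 2) ^ j),
    .add (.add (.add (.add (.const 20) (.mul (.const 8) .id)) (.pow .id i)) (.pow .id k))
      (.mul .id (.add (.add (.add (.mul (.const 8) .id) (.const 30))
        (.mul (.const 4) (.add .id (.pow .id k))))
        (.pow (.add .id (.pow (.add (.add .id (.pow .id k)) (.const 1)) 2)) j))), ?_⟩
  rintro L hL n ⟨a, K'⟩ ⟨e, K, hn', ha, hK⟩ σ hσ hn
  beta_reduce
  obtain rfl : K = K' := hK
  replace ha : Rep.R L e a := ha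
  have he : e ≤ n := hn' ▸ left_le_cpair e K
  have hKn : K ≤ n := hn' ▸ right_le_cpair e K
  -- The codes of `(a, q)` with `q ≤ K` do not exceed the code of `(a, K)`, so one bound serves all
  -- intermediate values.
  have hbd : ∀ q ≤ K, ∀ m, Rep.R L m (F (a, q)) → m ≤ (levelSize L + n + 2) ^ k := by
    intro q hq m hm
    refine (hk L hL (cpair e q) (a, q) ⟨e, q, rfl, ha, rfl⟩ m hm).trans ?_
    refine Nat.pow_le_pow_left ?_ k
    have : cpair e q ≤ n := hn' ▸ cpair_mono le_rfl hq
    omega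
  have hcp : ∀ q ≤ K, cpair e q ≤ n := fun q hq => hn' ▸ cpair_mono le_rfl hq
  generalize hN : levelSize L + n + 2 = N at *
  refine Runs.mono (T := (8 * N + 10) + (2 + (N ^ i + (1 + ((K * ((8 * N + 10 +
    (4 * (N + N ^ k) + 10 + ((N + (N + N ^ k + 1) ^ 2) ^ j + (2 + (1 + (1 + 1)))))) + 1) + 1) +
      2))))) ?_ ?_ (fun _ h => h)
  swap
  · have h₁ := Nat.mul_le_mul (show K ≤ N by omega) (le_refl ((8 * N + 10 +
      (4 * (N + N ^ k) + 10 + ((N + (N + N ^ k + 1) ^ 2) ^ j + (2 + (1 + (1 + 1)))))) + 1))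
    have h₂ : N * ((8 * N + 10 +
      (4 * (N + N ^ k) + 10 + ((N + (N + N ^ k + 1) ^ 2) ^ j + (2 + (1 + (1 + 1)))))) + 1) ≤
      N * (8 * N + 30 + 4 * (N + N ^ k) + (N + (N + N ^ k + 1) ^ 2) ^ j) :=
        Nat.mul_le_mul_left _ (by omega)
    omega
  refine Runs.seq ((runs_unpairProg σ (hn.trans hn')).mono (by omega) ?_)
  rintro τ ⟨h₁, h₂, h₃⟩
  refine Runs.seq (runs_move (by omega) (Runs.seq ?_))
  have hτ₁ : Keeps (r + 2) τ { τ with reg := Function.update τ.reg (r + 2) (τ.reg r) } :=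
    (Keeps.refl _ _).update
  refine (hci L hL e a ha _ ((hσ.keeps h₁).keeps hτ₁) (by simpa using h₂)).mono ?_ ?_
  · exact Nat.pow_le_pow_left (by omega) i
  rintro υ ⟨h₄, -, h₆⟩
  replace h₄ := hτ₁.trans h₄
  refine Runs.seq (runs_const (Runs.seq ?_))
  -- Register `r` keeps the parameter, `r + 1` counts the rounds left, `r + 3` the rounds done, and
  -- `r + 2` holds the current value.
  refine Runs.mono (runs_loop (fun q ω => Keeps r σ ω ∧ ω.reg r = e ∧ ω.reg (r + 1) = q ∧
    ω.reg (r + 3) + q = K ∧ Rep.R L (ω.reg (r + 2)) (F (a, ω.reg (r + 3))))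
    (8 * N + 10 + (4 * (N + N ^ k) + 10 + ((N + (N + N ^ k + 1) ^ 2) ^ j + (2 + (1 + (1 + 1))))))
    ?_ ?_ K _ ?_) le_rfl ?_
  · exact fun ω h => h.2.2.1
  · rintro q ω ⟨g₁, g₂, g₃, g₄, g₅⟩
    refine ⟨by omega, ?_⟩
    have g₆ := hbd _ (by omega) _ g₅
    have g₇ := hcp (ω.reg (r + 3)) (by omega)
    refine Runs.seq ((runs_pairProg (by omega) ω).mono (by omega) ?_)
    rintro ω₁ ⟨u₁, u₂⟩
    rw [g₂] at u₂
    have v₂ := u₁.2 (r + 2) (by omega)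
    refine Runs.seq ((runs_pairProg (by omega) ω₁).mono (by omega) ?_)
    rintro ω₂ ⟨u₃, u₄⟩
    have u₅ : Keeps (r + 4) ω ω₂ := u₁.trans u₃
    have u₆ : Keeps r σ ω₂ := g₁.trans u₅
    have u₇ : cpair (ω₁.reg (r + 4)) (ω₁.reg (r + 2)) ≤ (N + N ^ k + 1) ^ 2 :=
      (cpair_le _ _).trans (Nat.pow_le_pow_left (by omega) 2)
    refine Runs.seq ((hcb L hL _ ((a, ω.reg (r + 3)), F (a, ω.reg (r + 3))) ⟨_, _, u₄,
      ⟨e, _, u₂, ha, rfl⟩, by rwa [v₂]⟩ ω₂ (hσ.keeps u₆) rfl).mono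
        (Nat.pow_le_pow_left (by omega) j) ?_)
    rintro ω₃ ⟨w₁, -, w₃⟩
    have w₄ : Keeps (r + 4) ω ω₃ := u₅.trans w₁
    have w₅ := w₄.2 r (by omega)
    have w₆ := w₄.2 (r + 1) (by omega)
    have w₇ := w₄.2 (r + 3) (by omega)
    refine Runs.seq (runs_move (by omega) (Runs.seq (runs_const (Runs.seq (runs_add
      (runs_sub ?_))))))
    refine ⟨(g₁.trans w₄).update.update.update.update, ?_, ?_, ?_, ?_⟩
    · simp [w₅, g₂]
    · simp [w₆, g₃]
    · simp [w₇]; omega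
    · simpa [w₇, hs] using w₃
  · have w₅ := h₄.2 r (by omega)
    have w₆ := h₄.2 (r + 1) (by omega)
    refine ⟨(h₁.trans h₄).update, ?_, ?_, ?_, ?_⟩
    · simp [w₅, h₂]
    · simp [w₆, h₃]
    · simp
    · simpa [h0] using h₆
  · rintro ω ⟨g₁, g₂, g₃, g₄, g₅⟩
    obtain rfl : ω.reg (r + 3) = K := g₄
    have := hbd _ le_rfl _ g₅
    refine runs_move (by omega) ⟨g₁.update, ?_, ?_⟩
    · simp only [Function.update_self]; omega
    · simpa using g₅

end PortalGame

namespace PortalGame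

variable {α β γ δ : Type} [Rep α] [Rep β] [Rep γ] [Rep δ]

attribute [fun_prop] PT

/-! ## Computable operations -/

attribute [fun_prop] PT.id PT.comp PT.fst PT.snd PT.prodMk PT.const_nat

@[fun_prop]
theorem PT.fst' {f : α → β × γ} (hf : PT f) : PT fun a => (f a).1 := PT.fst.comp hf

@[fun_prop]
theorem PT.snd' {f : α → β × γ} (hf : PT f) : PT fun a => (f a).2 := PT.snd.comp hf

@[fun_prop]
theorem PT.add_nat {f g : α → ℕ} (hf : PT f) (hg : PT g) : PT fun a => f a + g a :=
  PT.natAdd.comp (hf.prodMk hg)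

@[fun_prop]
theorem PT.sub_nat {f g : α → ℕ} (hf : PT f) (hg : PT g) : PT fun a => f a - g a :=
  PT.natSub.comp (hf.prodMk hg)

/-! ### Propositions and case distinctions -/

instance : Rep Prop := ⟨fun _ n p => n = 1 ∧ p ∨ n = 0 ∧ ¬p⟩
instance : Rep Unit := ⟨fun _ n _ => n = 0⟩
instance : Rep Bool := ⟨fun _ n b => n = b.toNat⟩

@[fun_prop]
theorem PT.ite {P : α → Prop} [∀ a, Decidable (P a)] {f g : α → β} (hP : PT P) (hf : PT f)
    (hg : PT g) : PT fun a => if P a then f a else g a := by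
  have ho : PT fun a => if P a then some () else none := hP.transport fun L _ n a ha =>
    ⟨a, ha, by
      rintro m (⟨rfl, h⟩ | ⟨rfl, h⟩)
      · rw [if_pos h]; exact ⟨0, rfl, rfl⟩
      · rw [if_neg h]; exact rfl⟩
  refine (ho.optionElim hg (hf.comp PT.fst)).congr fun a => ?_
  by_cases h : P a <;> simp [h]

theorem PT.of_nat {P : α → Prop} {f : α → ℕ} (hf : PT f) (h₁ : ∀ a, P a → f a = 1)
    (h₀ : ∀ a, ¬P a → f a = 0) : PT P :=
  hf.transport fun L _ n a ha => ⟨a, ha, fun m hm => by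
    by_cases h : P a
    · exact Or.inl ⟨(show m = f a from hm).trans (h₁ a h), h⟩
    · exact Or.inr ⟨(show m = f a from hm).trans (h₀ a h), h⟩⟩

-- The program may depend on the truth of `p` non-constructively: one of two constant programs is
-- correct.
@[fun_prop]
theorem PT.const_prop (p : Prop) : PT fun _ : α => p := by
  by_cases h : p
  · exact PT.of_nat (PT.const_nat 1) (fun _ _ => rfl) (fun _ h' => absurd h h')
  · exact PT.of_nat (PT.const_nat 0) (fun _ h' => absurd h' h) (fun _ _ => rfl)

open scoped Classical in
@[fun_prop]
theorem PT.not {P : α → Prop} (hP : PT P) : PT fun a => ¬P a :=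
  PT.of_nat (f := fun a => if P a then 0 else 1) (by fun_prop) (by simp) (by simp)

open scoped Classical in
@[fun_prop]
theorem PT.and {P Q : α → Prop} (hP : PT P) (hQ : PT Q) : PT fun a => P a ∧ Q a :=
  (show PT fun a => if P a then Q a else False by fun_prop).congr fun a => by simp

open scoped Classical in
@[fun_prop]
theorem PT.or {P Q : α → Prop} (hP : PT P) (hQ : PT Q) : PT fun a => P a ∨ Q a :=
  (show PT fun a => if P a then True else Q a by fun_prop).congr fun a => by
    by_cases h : P a <;> simp [h]

open scoped Classical in
theorem PT.imp {P Q : α → Prop} (hP : PT P) (hQ : PT Q) : PT fun a => P a → Q a :=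
  (show PT fun a => if P a then Q a else True by fun_prop).congr fun a => by
    by_cases h : P a <;> simp [h]

@[fun_prop]
theorem PT.bool_eq {f : α → Bool} (hf : PT f) : PT fun a => f a = true :=
  hf.transport fun L _ n a ha => ⟨a, ha, fun m hm => by
    rw [show m = (f a).toNat from hm]
    cases f a
    · exact Or.inr ⟨rfl, by simp⟩
    · exact Or.inl ⟨rfl, rfl⟩⟩

@[fun_prop]
theorem PT.decide {P : α → Prop} [∀ a, Decidable (P a)] (hP : PT P) : PT fun a => decide (P a) :=
  hP.transport fun L _ n a ha => ⟨a, ha, by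
    rintro m (⟨rfl, h⟩ | ⟨rfl, h⟩) <;> simp [h, Rep.R]⟩

@[fun_prop]
theorem PT.const_bool (b : Bool) : PT fun _ : α => b :=
  (show PT fun _ : α => Decidable.decide (b = true) by fun_prop).congr fun a => by simp

@[fun_prop]
theorem PT.bor {f g : α → Bool} (hf : PT f) (hg : PT g) : PT fun a => f a || g a :=
  (show PT fun a => Decidable.decide (f a = true ∨ g a = true) by fun_prop).congr fun a => by
    simp

@[fun_prop]
theorem PT.bnot {f : α → Bool} (hf : PT f) : PT fun a => !f a :=
  (show PT fun a => Decidable.decide (¬f a = true) by fun_prop).congr fun a => by simp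

/-! ### Comparison of natural numbers -/

theorem PT.le_nat {f g : α → ℕ} (hf : PT f) (hg : PT g) : PT fun a => f a ≤ g a :=
  PT.of_nat (f := fun a => 1 - (f a - g a)) (by fun_prop) (fun a h => by omega)
    (fun a h => by omega)

theorem PT.lt_nat {f g : α → ℕ} (hf : PT f) (hg : PT g) : PT fun a => f a < g a :=
  (PT.le_nat (f := fun a => f a + 1) (by fun_prop) hg).congr fun a => by simp

theorem PT.eq_nat {f g : α → ℕ} (hf : PT f) (hg : PT g) : PT fun a => f a = g a :=
  ((PT.le_nat hf hg).and (PT.le_nat hg hf)).congr fun a => by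
    rw [eq_iff_iff, le_antisymm_iff]

attribute [fun_prop] PT.le_nat PT.lt_nat PT.eq_nat

@[fun_prop]
theorem PT.max_nat {f g : α → ℕ} (hf : PT f) (hg : PT g) : PT fun a => max (f a) (g a) :=
  (show PT fun a => if f a ≤ g a then g a else f a by fun_prop).congr fun a => by
    rw [max_def]

/-! ### Options -/

theorem PT.elim {o : α → Option β} {f : α → γ} {g : α → β → γ} (ho : PT o) (hf : PT f)
    (hg : PT fun x : α × β => g x.1 x.2) : PT fun a => (o a).elim (f a) (g a) :=
  ho.optionElim hf hg

@[fun_prop]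
theorem PT.none : PT fun _ : α => (Option.none : Option β) :=
  (PT.const_nat 0).transport fun _ _ _ a ha => ⟨a, ha, fun _ h => h⟩

@[fun_prop]
theorem PT.some {f : α → β} (hf : PT f) : PT fun a => Option.some (f a) := by
  have h : PT fun b : β => Option.some b :=
    (show PT fun n : ℕ => n + 1 by fun_prop).transport fun _ _ n a ha =>
      ⟨n, rfl, fun m hm => ⟨n, hm, ha⟩⟩
  exact h.comp hf

@[fun_prop]
theorem PT.or_option {f g : α → Option β} (hf : PT f) (hg : PT g) :
    PT fun a => (f a).or (g a) :=
  (hf.elim hg (g := fun _ b => Option.some b) (by fun_prop)).congr fun a => by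
    cases f a <;> simp

theorem PT.map_option {o : α → Option β} {g : α → β → γ} (ho : PT o)
    (hg : PT fun x : α × β => g x.1 x.2) : PT fun a => (o a).map (g a) :=
  (ho.elim (f := fun _ => Option.none) (g := fun a b => Option.some (g a b)) (by fun_prop)
    (by fun_prop)).congr fun a => by cases o a <;> simp

/-! ### Bounded codes -/

/-- A number is its own code, so the bound on the output of a program is a bound on the value. The
program is run on a configuration made up for this purpose. -/
theorem PT.polyBdd {f : α → ℕ} (hf : PT f) : PolyBdd f := by
  obtain ⟨c, k, hc⟩ := hf 1 le_rfl
  refine ⟨k, fun L hL n a ha m hm => ?_⟩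
  obtain ⟨-, τ, -, -, -, h₁, h₂⟩ := hc L hL n a ha
    ⟨fun i => if i = 0 then L.encode.length else n, fun i => L.encode.getD i 0⟩
    ⟨rfl, fun _ _ => rfl⟩ rfl
  have h₃ : τ.reg 1 = f a := h₂
  have h₄ : m = f a := hm
  omega

theorem PolyBdd.of_le {f g : α → ℕ} (hg : PolyBdd g) (h : ∀ a, f a ≤ g a) : PolyBdd f := by
  obtain ⟨k, hk⟩ := hg
  refine ⟨k, fun L hL n a ha m hm => ?_⟩
  rw [show m = f a from hm]
  exact (h a).trans (hk L hL n a ha _ rfl)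

theorem PolyBdd.mul {f g : α → ℕ} (hf : PolyBdd f) (hg : PolyBdd g) :
    PolyBdd fun a => f a * g a := by
  obtain ⟨j, hj⟩ := hf
  obtain ⟨k, hk⟩ := hg
  refine ⟨j + k, fun L hL n a ha m hm => ?_⟩
  rw [show m = f a * g a from hm, pow_add]
  exact Nat.mul_le_mul (hj L hL n a ha _ rfl) (hk L hL n a ha _ rfl)

/-- If the codes of `f a` are bounded by `g a`, they are polynomially bounded. -/
theorem PolyBdd.of_code_le {f : α → β} {g : α → ℕ} (hg : PolyBdd g)
    (h : ∀ L a m, Rep.R L m (f a) → m ≤ g a) : PolyBdd f := by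
  obtain ⟨k, hk⟩ := hg
  exact ⟨k, fun L hL n a ha m hm => (h L a m hm).trans (hk L hL n a ha _ rfl)⟩

theorem PolyBdd.prodMk {f : α → β} {g : α → γ} (hf : PolyBdd f) (hg : PolyBdd g) :
    PolyBdd fun a => (f a, g a) := by
  obtain ⟨j, hj⟩ := hf
  obtain ⟨k, hk⟩ := hg
  obtain ⟨e, he⟩ : PolyBound fun N => (N ^ j + N ^ k + 1) ^ 2 :=
    .pow (.add (.add (.pow .id _) (.pow .id _)) (.const _)) _
  refine ⟨e, fun L hL n a ha m hm => ?_⟩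
  obtain ⟨p, q, rfl, hp, hq⟩ := hm
  refine le_trans ?_ (he _ (by omega))
  refine (cpair_le p q).trans (Nat.pow_le_pow_left ?_ 2)
  have := hj L hL n a ha p hp
  have := hk L hL n a ha q hq
  omega

/-! ### Multiplication -/

@[fun_prop]
theorem PT.mul_nat {f g : α → ℕ} (hf : PT f) (hg : PT g) : PT fun a => f a * g a := by
  have h : PT fun x : ℕ × ℕ => x.1 * x.2 :=
    PT.rec (init := fun _ => 0) (body := fun x => x.2 + x.1.1) (by fun_prop) (by fun_prop)
      (PT.fst.polyBdd.mul PT.snd.polyBdd) (by simp) (fun a k => by simp [mul_add])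
  exact h.comp (hf.prodMk hg)

@[fun_prop]
theorem PT.pow_nat {f : α → ℕ} (hf : PT f) (k : ℕ) : PT fun a => f a ^ k := by
  induction k with
  | zero => simpa using PT.const_nat 1
  | succ k ih => simpa only [pow_succ] using ih.mul_nat hf

/-! ### Bounded search -/

/-- The search is a recursion on the length of the range, whose values are harmless because an index
that is found lies in the range. A range of length `n a` is affordable since time is measured by the
value of codes. -/
theorem PT.find_range {P : α → ℕ → Prop} [∀ a k, Decidable (P a k)] {n : α → ℕ}
    (hP : PT fun x : α × ℕ => P x.1 x.2) (hn : PT n) :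
    PT fun a => (List.range (n a)).find? fun k => Decidable.decide (P a k) := by
  have h : PT fun x : α × ℕ => (List.range x.2).find? fun k => Decidable.decide (P x.1 k) := by
    refine PT.rec (init := fun _ => Option.none)
      (body := fun x => x.2.or (if P x.1.1 x.1.2 then Option.some x.1.2 else Option.none))
      (by fun_prop) ?_ ?_ (fun a => rfl) (fun a k => ?_)
    · exact PT.snd.or_option (PT.ite (hP.comp PT.fst) (by fun_prop) (by fun_prop))
    · refine PolyBdd.of_code_le (g := fun x => x.2 + 1)
        (show PT fun x : α × ℕ => x.2 + 1 by fun_prop).polyBdd ?_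
      rintro L ⟨a, k⟩ m hm
      dsimp only at hm ⊢
      cases hf : (List.range k).find? fun k => Decidable.decide (P a k) with
      | none => rw [hf] at hm; simp [show m = 0 from hm]
      | some i =>
        rw [hf] at hm
        obtain ⟨i', rfl, hi : i' = i⟩ := hm
        have := List.mem_of_find?_eq_some hf
        rw [List.mem_range] at this
        omega
    · dsimp only
      rw [List.range_succ, List.find?_append]
      by_cases h : P a k <;> simp [h]
  exact h.comp (PT.id.prodMk hn)

open scoped Classical in
theorem PT.exists_lt {P : α → ℕ → Prop} {n : α → ℕ} (hP : PT fun x : α × ℕ => P x.1 x.2)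
    (hn : PT n) : PT fun a => ∃ k < n a, P a k :=
  ((PT.find_range hP hn).elim (f := fun _ => False) (g := fun _ _ => True) (by fun_prop)
    (by fun_prop)).congr fun a => by
      cases h : (List.range (n a)).find? fun k => Decidable.decide (P a k) with
      | none => simpa using h
      | some i =>
        have h₁ := List.mem_of_find?_eq_some h
        have h₂ := List.find?_some h
        simpa using ⟨i, by simpa using h₁, by simpa using h₂⟩

theorem PT.forall_lt {P : α → ℕ → Prop} {n : α → ℕ} (hP : PT fun x : α × ℕ => P x.1 x.2)
    (hn : PT n) : PT fun a => ∀ k < n a, P a k :=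
  (PT.exists_lt (P := fun a k => ¬P a k) (by fun_prop) hn).not.congr fun a => by simp

theorem find_range_eq {p : ℕ → Bool} {n i : ℕ} (hi : i < n) (hp : p i)
    (hmin : ∀ j < i, p j = false) : (List.range n).find? p = some i := by
  rw [List.find?_range_eq_some]
  exact ⟨hp, List.mem_range.2 hi, fun j hj => by simp [hmin j hj]⟩

@[fun_prop]
theorem PT.div_nat {f g : α → ℕ} (hf : PT f) (hg : PT g) : PT fun a => f a / g a := by
  have h : PT fun x : ℕ × ℕ => x.1 / x.2 := by
    -- The quotient is the least `k` with `x < (k + 1) * y`. For `y = 0` there is none, and the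
    -- default `0` agrees with division by zero.
    refine ((PT.find_range (P := fun x k => x.1 < (k + 1) * x.2) (n := fun x => x.1 + 1)
      (by fun_prop) (by fun_prop)).elim (f := fun _ => 0) (g := fun _ k => k) (by fun_prop)
      (by fun_prop)).congr ?_
    rintro ⟨x, y⟩
    rcases Nat.eq_zero_or_pos y with rfl | hy
    · simp [List.find?_eq_none.2]
    · rw [find_range_eq (i := x / y)]
      · rfl
      · exact Nat.lt_succ_of_le (Nat.div_le_self x y)
      · simpa [mul_comm] using Nat.lt_mul_div_succ x hy
      · intro j hj
        simpa using (Nat.le_div_iff_mul_le hy).1 (Nat.succ_le_of_lt hj)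
  exact h.comp (hf.prodMk hg)

@[fun_prop]
theorem PT.mod_nat {f g : α → ℕ} (hf : PT f) (hg : PT g) : PT fun a => f a % g a :=
  (show PT fun a => f a - g a * (f a / g a) by fun_prop).congr fun a =>
    (Nat.mod_eq_sub_mul_div).symm

@[fun_prop]
theorem PT.sqrt {f : α → ℕ} (hf : PT f) : PT fun a => Nat.sqrt (f a) := by
  have h : PT fun x : ℕ => Nat.sqrt x := by
    refine ((PT.find_range (P := fun x k => x < (k + 1) * (k + 1)) (n := fun x => x + 1)
      (by fun_prop) (by fun_prop)).elim (f := fun _ => 0) (g := fun _ k => k) (by fun_prop)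
      (by fun_prop)).congr fun x => ?_
    rw [find_range_eq (i := Nat.sqrt x)]
    · rfl
    · exact Nat.lt_succ_of_le (Nat.sqrt_le_self x)
    · simpa using Nat.lt_succ_sqrt x
    · intro j hj
      have := Nat.le_sqrt.1 (Nat.succ_le_of_lt hj)
      simpa using this
  exact h.comp hf

/-! ### Integers -/

instance : Rep ℤ := ⟨fun _ n z => n = cpair z.toNat (-z).toNat⟩

@[fun_prop]
theorem PT.toNat {f : α → ℤ} (hf : PT f) : PT fun a => (f a).toNat := by
  have h : PT fun z : ℤ => z.toNat := (PT.fst (α := ℕ) (β := ℕ)).transport fun L _ n z hz =>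
    ⟨(z.toNat, (-z).toNat), ⟨_, _, hz, rfl, rfl⟩, fun _ h => h⟩
  exact h.comp hf

theorem PT.toNat_neg {f : α → ℤ} (hf : PT f) : PT fun a => (-f a).toNat := by
  have h : PT fun z : ℤ => (-z).toNat := (PT.snd (α := ℕ) (β := ℕ)).transport fun L _ n z hz =>
    ⟨(z.toNat, (-z).toNat), ⟨_, _, hz, rfl, rfl⟩, fun _ h => h⟩
  exact h.comp hf

/-- The two truncated differences are exactly the positive and the negative part that make up the
code of an integer. The ring operations on integers are reduced to this. -/
theorem PT.natCast_sub {f g : α → ℕ} (hf : PT f) (hg : PT g) :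
    PT fun a => (f a : ℤ) - (g a : ℤ) :=
  (show PT fun a => (f a - g a, g a - f a) by fun_prop).transport fun L _ n a ha =>
    ⟨a, ha, by
      rintro m ⟨p, q, rfl, hp, hq⟩
      rw [show p = f a - g a from hp, show q = g a - f a from hq]
      show cpair _ _ = cpair _ _
      congr 1 <;> omega⟩

@[fun_prop]
theorem PT.natCast {f : α → ℕ} (hf : PT f) : PT fun a => (f a : ℤ) :=
  (PT.natCast_sub hf (.const_nat 0)).congr fun a => by simp

@[fun_prop]
theorem PT.neg_int {f : α → ℤ} (hf : PT f) : PT fun a => -f a :=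
  (PT.natCast_sub hf.toNat_neg hf.toNat).congr fun a => by omega

@[fun_prop]
theorem PT.sub_int {f g : α → ℤ} (hf : PT f) (hg : PT g) : PT fun a => f a - g a :=
  (PT.natCast_sub (f := fun a => (f a).toNat + (-g a).toNat)
    (g := fun a => (-f a).toNat + (g a).toNat) (by fun_prop) (by fun_prop)).congr fun a => by
      omega

@[fun_prop]
theorem PT.add_int {f g : α → ℤ} (hf : PT f) (hg : PT g) : PT fun a => f a + g a :=
  (show PT fun a => f a - (-g a) by fun_prop).congr fun a => by omega

@[fun_prop]
theorem PT.const_int (z : ℤ) : PT fun _ : α => z :=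
  (PT.natCast_sub (.const_nat z.toNat) (.const_nat (-z).toNat)).congr fun a => by omega

@[fun_prop]
theorem PT.mul_int {f g : α → ℤ} (hf : PT f) (hg : PT g) : PT fun a => f a * g a :=
  (PT.natCast_sub (f := fun a => (f a).toNat * (g a).toNat + (-f a).toNat * (-g a).toNat)
    (g := fun a => (f a).toNat * (-g a).toNat + (-f a).toNat * (g a).toNat) (by fun_prop)
      (by fun_prop)).congr fun a => by
    have h₁ : f a = (f a).toNat - (-f a).toNat := by omega
    have h₂ : g a = (g a).toNat - (-g a).toNat := by omega
    conv_rhs => rw [h₁, h₂]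
    push_cast
    ring

@[fun_prop]
theorem PT.natAbs {f : α → ℤ} (hf : PT f) : PT fun a => (f a).natAbs :=
  (show PT fun a => (f a).toNat + (-f a).toNat by fun_prop).congr fun a => by omega

@[fun_prop]
theorem PT.le_int {f g : α → ℤ} (hf : PT f) (hg : PT g) : PT fun a => f a ≤ g a :=
  (show PT fun a => (f a - g a).toNat = 0 by fun_prop).congr fun a => by
    rw [eq_iff_iff]; omega

@[fun_prop]
theorem PT.lt_int {f g : α → ℤ} (hf : PT f) (hg : PT g) : PT fun a => f a < g a :=
  (show PT fun a => f a + 1 ≤ g a by fun_prop).congr fun a => by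
    rw [eq_iff_iff]; omega

@[fun_prop]
theorem PT.eq_int {f g : α → ℤ} (hf : PT f) (hg : PT g) : PT fun a => f a = g a :=
  (show PT fun a => f a ≤ g a ∧ g a ≤ f a by fun_prop).congr fun a => by
    rw [eq_iff_iff]; omega

@[fun_prop]
theorem PT.max_int {f g : α → ℤ} (hf : PT f) (hg : PT g) : PT fun a => max (f a) (g a) :=
  (show PT fun a => if f a ≤ g a then g a else f a by fun_prop).congr fun a => by
    rw [max_def]

@[fun_prop]
theorem PT.min_int {f g : α → ℤ} (hf : PT f) (hg : PT g) : PT fun a => min (f a) (g a) :=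
  (show PT fun a => if f a ≤ g a then f a else g a by fun_prop).congr fun a => by
    rw [min_def]

@[fun_prop]
theorem PT.sign {f : α → ℤ} (hf : PT f) : PT fun a => (f a).sign :=
  (show PT fun a => if 0 < f a then (1 : ℤ) else if f a < 0 then -1 else 0 by fun_prop).congr
    fun a => by
      rcases lt_trichotomy (f a) 0 with h | h | h
      · simp [h.le, h, Int.sign_eq_neg_one_of_neg h]
      · simp [h]
      · simp [h, Int.sign_eq_one_of_pos h]

/-- Rounding toward zero. -/
@[fun_prop]
theorem PT.tdiv {f : α → ℤ} {g : α → ℕ} (hf : PT f) (hg : PT g) :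
    PT fun a => (f a).tdiv (g a : ℤ) :=
  (show PT fun a => (f a).sign * (((f a).natAbs / g a : ℕ) : ℤ) by fun_prop).congr fun a => by
    conv_rhs => rw [← Int.sign_mul_natAbs (f a)]
    rcases lt_trichotomy (f a) 0 with h | h | h
    · simp [Int.sign_eq_neg_one_of_neg h, Int.neg_tdiv,
        Int.tdiv_eq_ediv_of_nonneg (abs_nonneg _)]
    · simp [h]
    · simp [Int.sign_eq_one_of_pos h, Int.tdiv_eq_ediv_of_nonneg (abs_nonneg _)]

/-- Rounding downward. -/
@[fun_prop]
theorem PT.ediv {f : α → ℤ} {g : α → ℕ} (hf : PT f) (hg : PT g) :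
    PT fun a => f a / (g a : ℤ) := by
  -- For a negative numerator, rounding downward is minus the ceiling of the opposite quotient, and
  -- the ceiling arises by adding `g a - 1` before dividing.
  refine (show PT fun a => if g a = 0 then (0 : ℤ) else if 0 ≤ f a then (((f a).toNat / g a : ℕ) : ℤ)
    else -((((-f a).toNat + (g a - 1)) / g a : ℕ) : ℤ) by fun_prop).congr fun a => ?_
  by_cases h₀ : g a = 0
  · simp [h₀]
  rw [if_neg h₀]
  split_ifs with h
  · push_cast; rw [Int.toNat_of_nonneg h]
  · have hc : (0 : ℤ) < g a := by omega
    set n := ((-f a).toNat + (g a - 1)) / g a with hn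
    have h₁ : n * g a ≤ (-f a).toNat + (g a - 1) := Nat.div_mul_le_self _ _
    have h₂ : (-f a).toNat + (g a - 1) < g a * (n + 1) :=
      Nat.lt_mul_div_succ _ (Nat.pos_of_ne_zero h₀)
    zify at h₁ h₂
    rw [Nat.cast_sub (by omega), Int.toNat_of_nonneg (by omega)] at h₁ h₂
    refine le_antisymm ((Int.le_ediv_iff_mul_le hc).2 ?_) (Int.lt_add_one_iff.1
      ((Int.ediv_lt_iff_lt_mul hc).2 ?_)) <;> push_cast at h₁ h₂ ⊢ <;> nlinarith

theorem PolyBdd.int {f : α → ℤ} {g : α → ℕ} (hg : PolyBdd g) (h : ∀ a, (f a).natAbs ≤ g a) :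
    PolyBdd f := by
  have h₁ : PolyBdd fun a => ((f a).toNat, (-f a).toNat) :=
    (hg.of_le fun a => by have := h a; omega).prodMk (hg.of_le fun a => by have := h a; omega)
  obtain ⟨k, hk⟩ := h₁
  exact ⟨k, fun L hL n a ha m hm => hk L hL n a ha m ⟨_, _, hm, rfl, rfl⟩⟩

end PortalGame

namespace PortalGame

variable {α β γ δ : Type} [Rep α] [Rep β] [Rep γ] [Rep δ]

/-! ### Vectors -/

instance : Rep (Fin 3 → ℤ) := ⟨fun L n v => Rep.R L n (v 0, v 1, v 2)⟩

theorem PT.v3 {f : α → V3} (h₀ : PT fun a => f a 0) (h₁ : PT fun a => f a 1)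
    (h₂ : PT fun a => f a 2) : PT f :=
  (h₀.prodMk (h₁.prodMk h₂)).transport fun _ _ _ a ha => ⟨a, ha, fun _ h => h⟩

theorem PT.coord {f : α → V3} (hf : PT f) (i : Fin 3) : PT fun a => f a i := by
  have h : PT fun v : V3 => (v 0, v 1, v 2) := .of_rep fun _ _ _ _ h => h
  have h' := h.comp hf
  fin_cases i
  exacts [h'.fst', h'.snd'.fst', h'.snd'.snd']

theorem PT.const_v3 (v : V3) : PT fun _ : α => v :=
  .v3 (.const_int _) (.const_int _) (.const_int _)

theorem PT.add_v3 {f g : α → V3} (hf : PT f) (hg : PT g) : PT fun a => f a + g a :=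
  .v3 ((hf.coord 0).add_int (hg.coord 0)) ((hf.coord 1).add_int (hg.coord 1))
    ((hf.coord 2).add_int (hg.coord 2))

theorem PT.sub_v3 {f g : α → V3} (hf : PT f) (hg : PT g) : PT fun a => f a - g a :=
  .v3 ((hf.coord 0).sub_int (hg.coord 0)) ((hf.coord 1).sub_int (hg.coord 1))
    ((hf.coord 2).sub_int (hg.coord 2))

theorem PT.neg_v3 {f : α → V3} (hf : PT f) : PT fun a => -f a :=
  .v3 (hf.coord 0).neg_int (hf.coord 1).neg_int (hf.coord 2).neg_int

theorem PT.smul_v3 {f : α → ℤ} {g : α → V3} (hf : PT f) (hg : PT g) : PT fun a => f a • g a :=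
  .v3 (hf.mul_int (hg.coord 0)) (hf.mul_int (hg.coord 1)) (hf.mul_int (hg.coord 2))

theorem PT.dot {f g : α → V3} (hf : PT f) (hg : PT g) : PT fun a => f a ⬝ᵥ g a := by
  simp only [dotProduct, Fin.sum_univ_three]
  exact (((hf.coord 0).mul_int (hg.coord 0)).add_int ((hf.coord 1).mul_int (hg.coord 1))).add_int
    ((hf.coord 2).mul_int (hg.coord 2))

theorem PT.cross {f g : α → V3} (hf : PT f) (hg : PT g) :
    PT fun a => crossProduct (f a) (g a) := by
  have hf₀ := hf.coord 0
  have hf₁ := hf.coord 1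
  have hf₂ := hf.coord 2
  have hg₀ := hg.coord 0
  have hg₁ := hg.coord 1
  have hg₂ := hg.coord 2
  refine .v3 ?_ ?_ ?_ <;> simp only [cross_apply] <;> simp <;> fun_prop

theorem PT.vec {f g h : α → ℤ} (hf : PT f) (hg : PT g) (hh : PT h) :
    PT fun a => (![f a, g a, h a] : V3) := .v3 hf hg hh

/-! ### Finite types -/

instance : Finite Colour :=
  Finite.of_injective (β := Bool) (fun c => match c with | .blue => true | .orange => false)
    fun a b h => by cases a <;> cases b <;> simp_all

instance (E : Engine) : Finite (Input E) :=
  Finite.of_injective (β := Orientation E × SignType × SignType × Bool × Bool × Option Colour)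
    (fun i => (i.cursor, i.walk, i.strafe, i.jump, i.crouch, i.fire))
    fun a b h => by cases a; cases b; simp_all

instance (n : ℕ) : Rep (Fin n) := ⟨fun _ m k => m = (k : ℕ)⟩

noncomputable instance (E : Engine) : Rep (Input E) :=
  ⟨fun _ n inp => n = (Finite.equivFin (Input E) inp : ℕ)⟩

theorem PT.table {g : ℕ → β} (hg : ∀ k, PT fun _ : ℕ => g k) (K : ℕ) :
    PT fun n => if n < K then g n else g 0 := by
  induction K with
  | zero => simpa using hg 0
  | succ K ih =>
    refine (PT.ite (P := fun n => n = K) (by fun_prop) (hg K) ih).congr fun n => ?_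
    rcases lt_trichotomy n K with h | h | h
    · rw [if_neg h.ne, if_pos h, if_pos (by omega)]
    · rw [if_pos h, if_pos (by omega), h]
    · rw [if_neg h.ne', if_neg (by omega), if_neg (by omega)]

/-- For a fixed engine there are finitely many inputs, so the values can be written into the program
as a table. Trigonometric functions and the rounding of their values thus need not be computed. -/
theorem PT.of_input {E : Engine} {f : Input E → β} (hf : ∀ i, PT fun _ : ℕ => f i) : PT f := by
  rcases isEmpty_or_nonempty (Input E) with h | ⟨⟨i₀⟩⟩
  · refine PT.of_rep fun _ _ _ a => h.elim a
  let e := Finite.equivFin (Input E)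
  let g : ℕ → β := fun n => if h : n < Nat.card (Input E) then f (e.symm ⟨n, h⟩) else f i₀
  have hg : ∀ k, PT fun _ : ℕ => g k := fun k => by
    by_cases h : k < Nat.card (Input E)
    · simpa [g, h] using hf _
    · simpa [g, h] using hf _
  refine (PT.table hg (Nat.card (Input E))).transport fun L _ n i hi => ⟨n, rfl, fun m hm => ?_⟩
  have hn : n = (e i : ℕ) := hi
  have hlt : n < Nat.card (Input E) := hn ▸ (e i).2
  rw [if_pos hlt] at hm
  have he : e.symm ⟨n, hlt⟩ = i := by rw [Equiv.symm_apply_eq]; exact Fin.ext hn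
  simpa [g, hlt, he] using hm

/-! ### Reading the level -/

/-- An object together with the level. -/
structure WithLevel (γ : Type) where
  level : Level
  val : γ

instance : Rep (WithLevel γ) := ⟨fun L n x => x.level = L ∧ Rep.R L n x.val⟩

/-- Some codes, such as those of surfaces, mean something only relative to the level. As the level
is always in memory, a program may consult it although it is not part of the argument. -/
theorem PT.transport_level {f : α → β} {g : Level × γ → δ} (hg : PT g)
    (h : ∀ L : Level, L.WellFormed → ∀ (n : ℕ) (a : α), Rep.R L n a → ∃ b : γ, Rep.R L n b ∧
      ∀ m, Rep.R L m (g (L, b)) → Rep.R L m (f a)) : PT f := by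
  have h₁ : PT fun x : WithLevel γ => g (x.level, x.val) :=
    hg.comp (.prodMk (f := WithLevel.level) (g := WithLevel.val)
      (.of_rep fun _ _ _ _ h => And.left h) (.of_rep fun _ _ _ _ h => And.right h))
  refine h₁.transport fun L hL n a ha => ?_
  obtain ⟨b, hb, hm⟩ := h L hL n a ha
  exact ⟨⟨L, b⟩, ⟨rfl, hb⟩, hm⟩

theorem PT.get {L : α → Level} {f : α → ℕ} (hL : PT L) (hf : PT f) :
    PT fun a => (L a).encode.getD (f a) 0 := PT.inputGet.comp (hL.prodMk hf)

theorem encode_eq (L : Level) : L.encode = [L.terminalVelocity, L.bound,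
    (L.start 0).toNat, (-L.start 0).toNat, (L.start 1).toNat, (-L.start 1).toNat,
    (L.start 2).toNat, (-L.start 2).toNat, (L.goal 0).toNat, (-L.goal 0).toNat,
    (L.goal 1).toNat, (-L.goal 1).toNat, (L.goal 2).toNat, (-L.goal 2).toNat,
    L.surfaces.length] ++ L.surfaces.flatMap Surface.encode := rfl

@[fun_prop]
theorem PT.terminalVelocity {L : α → Level} (hL : PT L) : PT fun a => (L a).terminalVelocity :=
  (hL.get (.const_nat 0)).congr fun a => by simp [encode_eq]

@[fun_prop]
theorem PT.bound {L : α → Level} (hL : PT L) : PT fun a => (L a).bound :=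
  (hL.get (.const_nat 1)).congr fun a => by simp [encode_eq]

theorem PT.start {L : α → Level} (hL : PT L) : PT fun a => (L a).start :=
  .v3 ((PT.natCast_sub (hL.get (.const_nat 2)) (hL.get (.const_nat 3))).congr fun a => by
      simp [encode_eq])
    ((PT.natCast_sub (hL.get (.const_nat 4)) (hL.get (.const_nat 5))).congr fun a => by
      simp [encode_eq])
    ((PT.natCast_sub (hL.get (.const_nat 6)) (hL.get (.const_nat 7))).congr fun a => by
      simp [encode_eq])

theorem PT.goal {L : α → Level} (hL : PT L) : PT fun a => (L a).goal :=
  .v3 ((PT.natCast_sub (hL.get (.const_nat 8)) (hL.get (.const_nat 9))).congr fun a => by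
      simp [encode_eq])
    ((PT.natCast_sub (hL.get (.const_nat 10)) (hL.get (.const_nat 11))).congr fun a => by
      simp [encode_eq])
    ((PT.natCast_sub (hL.get (.const_nat 12)) (hL.get (.const_nat 13))).congr fun a => by
      simp [encode_eq])

@[fun_prop]
theorem PT.numSurfaces {L : α → Level} (hL : PT L) : PT fun a => (L a).surfaces.length :=
  (hL.get (.const_nat 14)).congr fun a => by simp [encode_eq]

/-- The code is an index into the list, hence small whatever the number of vertices. A surface that
is listed twice has two codes. -/
instance : Rep Surface := ⟨fun L n s => L.surfaces[n]? = some s⟩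

theorem PT.surface {L : α → Level} {f : α → ℕ} (hL : PT L) (hf : PT f) :
    PT fun a => (L a).surfaces[f a]? := by
  have h : PT fun x : Level × ℕ => x.1.surfaces[x.2]? := by
    refine (show PT fun x : Level × ℕ => if x.2 < x.1.surfaces.length then x.2 + 1 else 0 by
      fun_prop).transport fun L _ n x hx => ⟨x, hx, fun m hm => ?_⟩
    obtain ⟨L', j⟩ := x
    obtain ⟨p, q, -, hL', hq⟩ := hx
    obtain rfl : L' = L := hL'
    rw [show m = _ from hm]
    dsimp only
    split_ifs with h
    · rw [List.getElem?_eq_getElem h]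
      exact ⟨j, rfl, List.getElem?_eq_getElem h⟩
    · rw [List.getElem?_eq_none (not_lt.1 h)]
      rfl
  exact h.comp (hL.prodMk hf)

theorem PT.forall_surface {P : α → Surface → Prop} {L : α → Level}
    (hP : PT fun x : α × Surface => P x.1 x.2) (hL : PT L) :
    PT fun a => ∀ s ∈ (L a).surfaces, P a s := by
  refine (PT.forall_lt (P := fun a k => ((L a).surfaces[k]?).elim True (P a))
    (n := fun a => (L a).surfaces.length) ?_ (by fun_prop)).congr fun a => ?_
  · refine PT.elim (PT.surface (hL.comp .fst) .snd) (by fun_prop) ?_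
    exact hP.comp (f := fun x : (α × ℕ) × Surface => (x.1.1, x.2)) (by fun_prop)
  · simp only [eq_iff_iff]
    constructor
    · intro h s hs
      obtain ⟨k, hk, rfl⟩ := List.mem_iff_getElem.1 hs
      simpa [hk] using h k hk
    · intro h k hk
      simpa [hk] using h _ (List.getElem_mem hk)

/-- Where the `j`-th surface begins in the written form of the level. -/
def surfaceOffset (L : Level) (j : ℕ) : ℕ :=
  15 + ((L.surfaces.take j).flatMap Surface.encode).length

theorem length_encodeVec (v : V3) : (encodeVec v).length = 6 := rfl

theorem length_surface_encode (s : Surface) : s.encode.length = 2 + 6 * s.verts.length := by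
  have h : ∀ l : List V3, (l.flatMap encodeVec).length = 6 * l.length := by
    intro l
    induction l with
    | nil => rfl
    | cons v l ih => rw [List.flatMap_cons, List.length_append, ih, length_encodeVec]; simp; ring
  simp [Surface.encode, h]; ring

theorem getD_surface {L : Level} {j : ℕ} {s : Surface} (h : L.surfaces[j]? = some s) {i : ℕ}
    (hi : i < s.encode.length) :
    L.encode.getD (surfaceOffset L j + i) 0 = s.encode.getD i 0 := by
  obtain ⟨hj, rfl⟩ := List.getElem?_eq_some_iff.1 h
  have hs : L.surfaces = L.surfaces.take j ++ L.surfaces[j] :: L.surfaces.drop (j + 1) := by simp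
  have he : L.encode = (L.encode.take 15 ++ (L.surfaces.take j).flatMap Surface.encode) ++
      (L.surfaces[j].encode ++ (L.surfaces.drop (j + 1)).flatMap Surface.encode) := by
    have hf : L.surfaces.flatMap Surface.encode = (L.surfaces.take j).flatMap Surface.encode ++
        (L.surfaces[j].encode ++ (L.surfaces.drop (j + 1)).flatMap Surface.encode) := by
      conv_lhs => rw [hs]
      rw [List.flatMap_append, List.flatMap_cons]
    conv_lhs => rw [encode_eq, hf]
    simp [encode_eq]
  have hl : (L.encode.take 15 ++ (L.surfaces.take j).flatMap Surface.encode).length =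
      surfaceOffset L j := by
    rw [List.length_append]
    simp [encode_eq, surfaceOffset]
  rw [he, List.getD_append_right _ _ _ _ (by rw [hl]; omega), hl, Nat.add_sub_cancel_left,
    List.getD_append _ _ _ _ hi]

theorem surfaceOffset_succ {L : Level} {j : ℕ} {s : Surface} (h : L.surfaces[j]? = some s) :
    surfaceOffset L (j + 1) = surfaceOffset L j + s.encode.length := by
  simp [surfaceOffset, List.take_add_one, h]; ring

theorem surfaceOffset_le (L : Level) (j : ℕ) : surfaceOffset L j ≤ L.encode.length := by
  have h : ((L.surfaces.take j).flatMap Surface.encode).length ≤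
      (L.surfaces.flatMap Surface.encode).length := by
    conv_rhs => rw [← List.take_append_drop j L.surfaces, List.flatMap_append, List.length_append]
    exact Nat.le_add_right _ _
  rw [encode_eq, List.length_append]
  simp only [surfaceOffset]
  exact Nat.add_le_add_left h 15

/-- Surfaces have written forms of different lengths, so their beginnings are found by walking
through the list, reading each vertex count on the way. The values never exceed the length of the
input. -/
theorem PT.offset {L : α → Level} {f : α → ℕ} (hL : PT L) (hf : PT f) :
    PT fun a => surfaceOffset (L a) (f a) := by
  have h : PT fun x : Level × ℕ => surfaceOffset x.1 x.2 := by
    refine PT.rec (init := fun _ => 15) (body := fun x => if x.1.2 < x.1.1.surfaces.length then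
      x.2 + (2 + 6 * x.1.1.encode.getD (x.2 + 1) 0) else x.2) (by fun_prop) ?_ ?_
      (fun L => rfl) (fun L j => ?_)
    · have := PT.get (α := (Level × ℕ) × ℕ) (L := fun x => x.1.1) (f := fun x => x.2 + 1)
        (by fun_prop) (by fun_prop)
      fun_prop
    · exact (PT.inputLength.comp (PT.fst (α := Level) (β := ℕ))).polyBdd.of_le
        fun x => surfaceOffset_le x.1 x.2
    · dsimp only
      split_ifs with hj
      · have hs := List.getElem?_eq_getElem hj
        rw [surfaceOffset_succ hs, getD_surface hs (by rw [length_surface_encode]; omega),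
          length_surface_encode]
        rfl
      · simp [surfaceOffset, List.take_of_length_le (not_lt.1 hj),
          List.take_of_length_le (Nat.le_succ_of_le (not_lt.1 hj))]
  exact h.comp (hL.prodMk hf)

@[fun_prop]
theorem PT.numVerts {f : α → Surface} (hf : PT f) : PT fun a => (f a).verts.length := by
  have h : PT fun s : Surface => s.verts.length := by
    refine PT.transport_level (γ := ℕ) (PT.get (L := fun x : Level × ℕ => x.1)
      (f := fun x => surfaceOffset x.1 x.2 + 1) (by fun_prop)
      ((PT.offset .fst .snd).add_nat (.const_nat 1)))
      fun L _ n s hs => ⟨n, rfl, fun m hm => ?_⟩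
    rw [show m = L.encode.getD (surfaceOffset L n + 1) 0 from hm,
      getD_surface hs (by rw [length_surface_encode]; omega)]
    rfl
  exact h.comp hf

@[fun_prop]
theorem PT.portalable {f : α → Surface} (hf : PT f) : PT fun a => (f a).portalable := by
  have h : PT fun s : Surface => s.portalable := by
    refine PT.transport_level (γ := ℕ) (PT.get (L := fun x : Level × ℕ => x.1)
      (f := fun x => surfaceOffset x.1 x.2) (by fun_prop)
      (PT.offset .fst .snd))
      fun L _ n s hs => ⟨n, rfl, fun m hm => ?_⟩
    rw [show m = L.encode.getD (surfaceOffset L n + 0) 0 from hm,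
      getD_surface hs (by rw [length_surface_encode]; omega)]
    rfl
  exact h.comp hf

theorem getD_flatMap_encodeVec (l : List V3) (k : ℕ) (hk : k < l.length) {i : ℕ} (hi : i < 6) :
    (l.flatMap encodeVec).getD (6 * k + i) 0 = (encodeVec l[k]).getD i 0 := by
  induction l generalizing k with
  | nil => simp at hk
  | cons v l ih =>
    rw [List.flatMap_cons]
    cases k with
    | zero => rw [List.getD_append _ _ _ _ (by rw [length_encodeVec]; omega)]; simp
    | succ k =>
      rw [List.getD_append_right _ _ _ _ (by rw [length_encodeVec]; omega), length_encodeVec,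
        show 6 * (k + 1) + i - 6 = 6 * k + i by omega, ih k (by simpa using hk)]
      simp

theorem getD_surface_vert {L : Level} {j : ℕ} {s : Surface} (h : L.surfaces[j]? = some s) {k : ℕ}
    (hk : k < s.verts.length) {i : ℕ} (hi : i < 6) :
    L.encode.getD (surfaceOffset L j + (2 + (6 * k + i))) 0 = (encodeVec s.verts[k]).getD i 0 := by
  rw [getD_surface h (by rw [length_surface_encode]; omega), ← getD_flatMap_encodeVec _ k hk hi]
  rw [Surface.encode, add_comm 2]
  rfl

/-- The `k`-th vertex of a surface. -/
def Surface.vert (s : Surface) (k : ℕ) : V3 := s.verts.getD k 0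

theorem PT.vert {f : α → Surface} {g : α → ℕ} (hf : PT f) (hg : PT g) :
    PT fun a => (f a).vert (g a) := by
  have key : ∀ i : ℕ, PT fun x : Level × (ℕ × ℕ) =>
      x.1.encode.getD (surfaceOffset x.1 x.2.1 + (2 + (6 * x.2.2 + i))) 0 := by
    intro i
    refine PT.get .fst ((PT.offset .fst (by fun_prop)).add_nat (by fun_prop))
  have hlen : PT fun x : Level × (ℕ × ℕ) =>
      x.1.encode.getD (surfaceOffset x.1 x.2.1 + 1) 0 :=
    PT.get .fst ((PT.offset .fst (by fun_prop)).add_nat (by fun_prop))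
  -- The guard is needed because behind the last vertex stand the numbers of the next surface,
  -- whereas `Surface.vert` takes the default `0` there.
  have h : PT fun x : Surface × ℕ => if x.2 < x.1.verts.length then x.1.vert x.2 else 0 := by
    refine PT.transport_level (PT.ite (PT.lt_nat (f := fun x => x.2.2) (by fun_prop) hlen)
      (.vec ((key 0).natCast_sub (key 1)) ((key 2).natCast_sub (key 3))
        ((key 4).natCast_sub (key 5))) (.const_v3 0)) ?_
    rintro L hL n ⟨s, k⟩ ⟨j, k', hn, hs, hk⟩
    obtain rfl : k' = k := hk
    refine ⟨(j, k'), ⟨j, k', hn, rfl, rfl⟩, fun m hm => ?_⟩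
    dsimp only at hm ⊢
    have hlen : L.encode.getD (surfaceOffset L j + 1) 0 = s.verts.length := by
      rw [getD_surface hs (by rw [length_surface_encode]; omega)]; rfl
    rw [hlen] at hm
    split_ifs at hm ⊢ with hlt
    · have hv : ∀ i < 6, _ := fun i hi => getD_surface_vert hs hlt (i := i) hi
      rw [hv 0 (by omega), hv 1 (by omega), hv 2 (by omega), hv 3 (by omega), hv 4 (by omega),
        hv 5 (by omega)] at hm
      convert hm using 1
      have hvert : s.vert k' = s.verts[k'] := by simp [Surface.vert, hlt]
      rw [hvert]
      ext i
      fin_cases i <;> simp [encodeVec, encodeInt]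
    · exact hm
  refine (h.comp (hf.prodMk hg)).congr fun a => ?_
  dsimp only
  split_ifs with h
  · rfl
  · simp [Surface.vert, List.getElem?_eq_none (not_lt.1 h)]

end PortalGame

namespace PortalGame

/-! ## Small solutions of systems of linear inequalities -/

/-- `x` is nonnegative, and positive if `s` holds. -/
def Sat {R : Type*} [Zero R] [LE R] [LT R] (s : Prop) (x : R) : Prop := 0 ≤ x ∧ (s → 0 < x)

theorem Sat.congr {R : Type*} [Zero R] [LE R] [LT R] {s : Prop} {x y : R} (h : Sat s x)
    (hxy : x = y) : Sat s y := hxy ▸ h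

theorem Sat.add {R : Type*} [Ring R] [LinearOrder R] [IsStrictOrderedRing R] {s : Prop} {x y : R}
    (hx : Sat s x) (hy : 0 ≤ y) : Sat s (x + y) :=
  ⟨add_nonneg hx.1 hy, fun h => add_pos_of_pos_of_nonneg (hx.2 h) hy⟩

theorem Sat.mul {R : Type*} [Ring R] [LinearOrder R] [IsStrictOrderedRing R] {s : Prop} {x c : R}
    (hx : Sat s x) (hc : 0 < c) : Sat s (c * x) :=
  ⟨mul_nonneg hc.le hx.1, fun h => mul_pos hc (hx.2 h)⟩

theorem Sat.mul_iff {R : Type*} [Ring R] [LinearOrder R] [IsStrictOrderedRing R] {s : Prop}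
    {x c : R} (hc : 0 < c) : Sat s (c * x) ↔ Sat s x :=
  ⟨fun h => ⟨nonneg_of_mul_nonneg_right h.1 hc, fun hs => pos_of_mul_pos_right (h.2 hs) hc.le⟩,
    fun h => h.mul hc⟩

theorem Sat.comb {R : Type*} [Ring R] [LinearOrder R] [IsStrictOrderedRing R] {s t : Prop}
    {x y c d : R} (hx : Sat s x) (hy : Sat t y) (hc : 0 < c) (hd : 0 < d) :
    Sat (s ∨ t) (c * x + d * y) := by
  refine ⟨add_nonneg (mul_nonneg hc.le hx.1) (mul_nonneg hd.le hy.1), ?_⟩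
  rintro (h | h)
  · exact add_pos_of_pos_of_nonneg (mul_pos hc (hx.2 h)) (mul_nonneg hd.le hy.1)
  · exact add_pos_of_nonneg_of_pos (mul_nonneg hc.le hx.1) (mul_pos hd (hy.2 h))

theorem Sat.mono {R : Type*} [Zero R] [LE R] [LT R] {s t : Prop} {x : R} (h : Sat t x)
    (hst : s → t) : Sat s x := ⟨h.1, fun hs => h.2 (hst hs)⟩

/-- One step of Fourier-Motzkin elimination, backward: the value of the eliminated variable is
chosen as a mediant. -/
theorem exists_eliminated {ι : Type} [Finite ι] (c T : ι → ℤ) (s : ι → Prop) {M W : ℤ}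
    (hc : ∀ i, |c i| ≤ M) (hT : ∀ i, |T i| ≤ W) (hM : 2 ≤ M)
    (h₀ : ∀ i, c i = 0 → Sat (s i) (T i))
    (h₁ : ∀ i j, 0 < c i → c j < 0 → Sat (s i ∨ s j) (-c j * T i + c i * T j)) (hW₀ : 0 ≤ W) :
    ∃ x q : ℤ, 0 < q ∧ q ≤ 2 * M ∧ |x| ≤ 2 * W + 1 ∧ ∀ i, Sat (s i) (c i * x + q * T i) := by
  by_cases hp : ∃ i, 0 < c i <;> by_cases hn : ∃ i, c i < 0
  · have : Nonempty {i // 0 < c i} := hp.elim fun i hi => ⟨⟨i, hi⟩⟩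
    have : Nonempty {i // c i < 0} := hn.elim fun i hi => ⟨⟨i, hi⟩⟩
    -- Rows with `0 < c i` bound the unknown below by `-T i / c i`, rows with `c j < 0` bound it
    -- above by `T j / (-c j)`. Here `i₀` and `j₀` are the tightest rows of each kind.
    obtain ⟨⟨i₀, hi₀⟩, hmax⟩ := Finite.exists_min fun i : {i // 0 < c i} => (T i : ℚ) / c i
    obtain ⟨⟨j₀, hj₀⟩, hmin⟩ := Finite.exists_min fun j : {j // c j < 0} => (T j : ℚ) / (-c j : ℤ)
    have hmax' : ∀ i, 0 < c i → T i₀ * c i ≤ T i * c i₀ := fun i hi => by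
      have := hmax ⟨i, hi⟩
      rw [div_le_div_iff₀ (by exact_mod_cast hi₀) (by exact_mod_cast hi)] at this
      exact_mod_cast this
    have hmin' : ∀ j, c j < 0 → T j₀ * -c j ≤ T j * -c j₀ := fun j hj => by
      have := hmin ⟨j, hj⟩
      rw [div_le_div_iff₀ (by exact_mod_cast neg_pos.2 hj₀) (by exact_mod_cast neg_pos.2 hj)]
        at this
      exact_mod_cast this
    -- The mediant of the greatest lower bound `-T i₀ / c i₀` and the least upper bound `T j₀ / (-c
    -- j₀)`. Unlike a midpoint it involves no products of coefficients.
    refine ⟨T j₀ - T i₀, c i₀ - c j₀, by omega, ?_, ?_, fun i => ?_⟩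
    · have := abs_le.1 (hc i₀)
      have := abs_le.1 (hc j₀)
      omega
    · have := abs_le.1 (hT i₀)
      have := abs_le.1 (hT j₀)
      rw [abs_le]; omega
    · rcases lt_trichotomy (c i) 0 with hi | hi | hi
      · have := ((h₁ i₀ i hi₀ hi).mono (s := s i) Or.inr).add (sub_nonneg.2 (hmin' i hi))
        refine Sat.congr this ?_; ring
      · have := (h₀ i hi).mul (show 0 < c i₀ - c j₀ by omega)
        refine Sat.congr this ?_; rw [hi]; ring
      · have := ((h₁ i j₀ hi hj₀).mono (s := s i) Or.inl).add (sub_nonneg.2 (hmax' i hi))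
        refine Sat.congr this ?_; ring
  · push Not at hn
    -- Without upper bounds any value beyond all `|T i|` works, as each positive coefficient is at
    -- least 1.
    refine ⟨W + 1, 1, one_pos, by omega, by rw [abs_le]; omega, fun i => ?_⟩
    rcases (hn i).eq_or_lt with hi | hi
    · refine Sat.congr (h₀ i hi.symm) ?_; rw [← hi]; ring
    · have h₂ := abs_le.1 (hT i)
      have : 0 < c i * (W + 1) + 1 * T i := by nlinarith
      exact ⟨this.le, fun _ => this⟩
  · push Not at hp
    refine ⟨-(W + 1), 1, one_pos, by omega, by rw [abs_le]; omega, fun i => ?_⟩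
    rcases (hp i).eq_or_lt with hi | hi
    · refine Sat.congr (h₀ i hi) ?_; rw [hi]; ring
    · have h₂ := abs_le.1 (hT i)
      have : 0 < c i * -(W + 1) + 1 * T i := by nlinarith
      exact ⟨this.le, fun _ => this⟩
  · push Not at hp hn
    refine ⟨0, 1, one_pos, by omega, by rw [abs_le]; omega, fun i => ?_⟩
    have := le_antisymm (hp i) (hn i)
    refine Sat.congr (h₀ i this) ?_; ring

/-- A system of homogeneous linear inequalities with small integer coefficients that has a real
solution has a small integer solution. -/
theorem exists_small_solution (k : ℕ) : ∃ e : ℕ, ∀ M : ℕ, 2 ≤ M → ∀ (ι : Type) [Finite ι]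
    (r : ι → Fin k → ℤ) (s : ι → Prop), (∀ i j, |r i j| ≤ M) →
    (∃ a : Fin k → ℝ, ∀ i, Sat (s i) (∑ j, (r i j : ℝ) * a j)) →
    ∃ a : Fin k → ℤ, (∀ j, |a j| ≤ (M ^ e : ℕ)) ∧ ∀ i, Sat (s i) (∑ j, r i j * a j) := by
  induction k with
  | zero =>
    refine ⟨0, fun M hM ι _ r s hr ⟨a, ha⟩ => ⟨fun j => j.elim0, fun j => j.elim0, fun i => ?_⟩⟩
    have := ha i
    simp only [Finset.univ_eq_empty, Finset.sum_empty] at this ⊢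
    exact ⟨le_rfl, fun hs => absurd (this.2 hs) (lt_irrefl _)⟩
  | succ k ih =>
    obtain ⟨e', he'⟩ := ih
    -- The summands bound the new unknown (`2 * W + 1`, with `W` a bound for the remaining part of a
    -- row) and the old unknowns after multiplication by `q ≤ 2 * M`. The exponent depends only on
    -- `k`.
    obtain ⟨e, he⟩ : PolyBound fun M => 2 * (k * M * (M ^ 3) ^ e') + 1 + 2 * M * (M ^ 3) ^ e' :=
      .add (.add (.mul (.const 2) (.mul (.mul (.const k) .id) (.pow (.pow .id 3) e'))) (.const 1))
        (.mul (.mul (.const 2) .id) (.pow (.pow .id 3) e'))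
    refine ⟨e, fun M hM ι _ r s hr ⟨a, ha⟩ => ?_⟩
    -- Coefficients of eliminated rows are sums of two products, at most `2 * M ^ 2`, so the
    -- induction hypothesis is used with `M ^ 3`.
    have hM3 : 2 * M ^ 2 ≤ M ^ 3 := by rw [pow_succ M 2, mul_comm]; gcongr
    have hMM : M ≤ M ^ 3 := by nlinarith
    simp only [Fin.sum_univ_succ] at ha
    -- The eliminated system: the rows without the first unknown, and for each pair of rows with
    -- opposite signs the positive combination in which it cancels.
    let κ : Type := {i // r i 0 = 0} ⊕ ({i // 0 < r i 0} × {i // r i 0 < 0})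
    let r' : κ → Fin k → ℤ := Sum.elim (fun i j => r i.1 j.succ)
      fun x j => -r x.2.1 0 * r x.1.1 j.succ + r x.1.1 0 * r x.2.1 j.succ
    let s' : κ → Prop := Sum.elim (fun i => s i.1) fun x => s x.1.1 ∨ s x.2.1
    obtain ⟨b, hb, hb'⟩ := he' (M ^ 3) (by omega) κ r' s' (by
      rintro (⟨i, hi⟩ | ⟨⟨i, hi⟩, ⟨j, hj⟩⟩) l
      · exact (hr i l.succ).trans (by exact_mod_cast hMM)
      · have h₁ : |r j 0 * r i l.succ| ≤ M * M := by
          rw [abs_mul]; exact mul_le_mul (hr _ _) (hr _ _) (abs_nonneg _) (by positivity)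
        have h₂ : |r i 0 * r j l.succ| ≤ M * M := by
          rw [abs_mul]; exact mul_le_mul (hr _ _) (hr _ _) (abs_nonneg _) (by positivity)
        have h₃ : ((2 * M ^ 2 : ℕ) : ℤ) ≤ (M ^ 3 : ℕ) := by exact_mod_cast hM3
        push_cast at h₃ ⊢
        rw [abs_le] at h₁ h₂
        simp only [r', Sum.elim_inr]
        rw [abs_le]
        constructor <;> nlinarith) ⟨fun j => a j.succ, by
      rintro (⟨i, hi⟩ | ⟨⟨i, hi⟩, ⟨j, hj⟩⟩)
      · have := ha i
        rw [hi] at this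
        simpa [r', s'] using this
      · have := (ha i).comb (ha j) (c := -(r j 0 : ℝ)) (d := (r i 0 : ℝ))
          (by simpa using hj) (by exact_mod_cast hi)
        refine Sat.congr this ?_
        simp only [r', Sum.elim_inr]
        push_cast
        simp only [add_mul, Finset.sum_add_distrib, mul_add, Finset.mul_sum]
        simp only [mul_assoc]
        ring⟩
    have hbr : ∀ i, |∑ j, r i j.succ * b j| ≤ (k * M * (M ^ 3) ^ e' : ℕ) := by
      intro i
      refine (Finset.abs_sum_le_sum_abs _ _).trans ?_
      have : ∀ j ∈ Finset.univ, |r i (Fin.succ j) * b j| ≤ ((M * (M ^ 3) ^ e' : ℕ) : ℤ) := by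
        intro j _
        rw [abs_mul]; push_cast
        exact mul_le_mul (hr _ _) (by exact_mod_cast hb j) (abs_nonneg _) (by positivity)
      refine (Finset.sum_le_card_nsmul _ _ _ this).trans (le_of_eq ?_)
      simp [mul_assoc]
    obtain ⟨x, q, hq, hqM, hx, hxs⟩ := exists_eliminated (fun i => r i 0)
      (fun i => ∑ j, r i j.succ * b j) s (M := M) (fun i => hr i 0) hbr (by exact_mod_cast hM)
      (fun i hi => hb' (.inl ⟨i, hi⟩)) (fun i j hi hj => by
        have := hb' (.inr ⟨⟨i, hi⟩, ⟨j, hj⟩⟩)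
        refine Sat.congr this ?_
        simp only [r', Sum.elim_inr, add_mul, Finset.sum_add_distrib, Finset.mul_sum, mul_assoc])
      (by positivity)
    have heM := he M hM
    beta_reduce at heM
    -- The value of the first unknown is the fraction `x / q`; since the system is homogeneous,
    -- everything may be multiplied by `q`.
    refine ⟨Fin.cons x fun j => q * b j, fun j => ?_, fun i => ?_⟩
    · refine le_trans ?_ (Int.ofNat_le.2 heM)
      refine Fin.cases ?_ (fun j => ?_) j
      · simp only [Fin.cons_zero]; push_cast at hx ⊢
        refine hx.trans (le_add_of_nonneg_right (by positivity))
      · simp only [Fin.cons_succ, abs_mul, abs_of_pos hq]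
        have : q * |b j| ≤ 2 * M * ((M ^ 3) ^ e' : ℕ) :=
          mul_le_mul hqM (hb j) (abs_nonneg _) (by positivity)
        push_cast at this ⊢
        exact this.trans (le_add_of_nonneg_left (by positivity))
    · have := hxs i
      rw [Fin.sum_univ_succ]
      refine Sat.congr this ?_
      simp only [Fin.cons_zero, Fin.cons_succ, Finset.mul_sum]
      congr 1
      exact Finset.sum_congr rfl fun j _ => by ring

/-! ## Boxes that meet a surface -/

/-- The point of the surface with weights `w` at the vertices `k`, times the sum of weights. -/
def Surface.comb (s : Surface) (k w : Fin 4 → ℕ) : V3 := ∑ j, (w j : ℤ) • s.vert (k j)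

/-- The surface, enlarged by the factor `q`, has a point in the box from `lo` to `hi` (in its
interior, if `t` holds). -/
def Surface.Meets (s : Surface) (t : Prop) (q : ℕ) (lo hi : V3) : Prop :=
  ∃ x ∈ s.region, ∀ i, Sat t (q * x i - lo i) ∧ Sat t (hi i - q * x i)

/-- The point with weights `w` at the vertices `k` lies in the box. -/
def Surface.MeetsAt (s : Surface) (t : Prop) (q : ℕ) (lo hi : V3) (k w : Fin 4 → ℕ) : Prop :=
  0 < ∑ j, w j ∧ ∀ i, Sat t (q * s.comb k w i - (∑ j, w j : ℕ) * lo i) ∧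
    Sat t ((∑ j, w j : ℕ) * hi i - q * s.comb k w i)

theorem Surface.toReal_vert_mem (s : Surface) {k : ℕ} (hk : k < s.verts.length) :
    toReal (s.vert k) ∈ s.region :=
  subset_convexHull ℝ _ ⟨s.vert k, by simp [Surface.vert, hk], rfl⟩

theorem Surface.MeetsAt.meets {s : Surface} {t : Prop} {q : ℕ} {lo hi : V3} {k w : Fin 4 → ℕ}
    (h : s.MeetsAt t q lo hi k w) (hk : ∀ j, k j < s.verts.length) : s.Meets t q lo hi := by
  obtain ⟨hw, h⟩ := h
  set W := ∑ j, w j with hW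
  have hWr : (0 : ℝ) < W := by exact_mod_cast hw
  refine ⟨∑ j, ((w j : ℝ) / W) • toReal (s.vert (k j)), ?_, fun i => ?_⟩
  · refine (convex_convexHull ℝ _).sum_mem (fun j _ => by positivity) ?_
      fun j _ => s.toReal_vert_mem (hk j)
    rw [← Finset.sum_div, hW]; push_cast; rw [div_self]; rw [hW] at hWr; push_cast at hWr
    exact hWr.ne'
  · have hx : (W : ℝ) * (∑ j, ((w j : ℝ) / W) • toReal (s.vert (k j))) i = (s.comb k w i : ℤ) := by
      simp only [Surface.comb, Finset.sum_apply, Pi.smul_apply, smul_eq_mul, Finset.mul_sum]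
      push_cast
      refine Finset.sum_congr rfl fun j _ => ?_
      simp only [toReal]; field_simp
    have cast : ∀ z : ℤ, Sat t z → Sat t (z : ℝ) := fun z hz =>
      ⟨by exact_mod_cast hz.1, fun ht => by exact_mod_cast hz.2 ht⟩
    have h₁ := cast _ (h i).1
    have h₂ := cast _ (h i).2
    push_cast at h₁ h₂
    rw [← hx] at h₁ h₂
    constructor
    · rw [← Sat.mul_iff hWr]; refine Sat.congr h₁ ?_; ring
    · rw [← Sat.mul_iff hWr]; refine Sat.congr h₂ ?_; ring

/-- Carathéodory's theorem in dimension three. A fixed number of vertices keeps both the linear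
system and the brute-force search polynomial. -/
theorem Surface.exists_four (s : Surface) {x : Fin 3 → ℝ} (hx : x ∈ s.region) :
    ∃ (k : Fin 4 → ℕ) (a : Fin 4 → ℝ), (∀ j, k j < s.verts.length) ∧ (∀ j, 0 ≤ a j) ∧
      ∑ j, a j = 1 ∧ ∀ i, ∑ j, a j * (s.vert (k j) i : ℝ) = x i := by
  obtain ⟨ι, _, z, w, hz, hai, hw, hw₁, hwx⟩ := eq_pos_convex_span_of_mem_convexHull hx
  have hcard : Fintype.card ι ≤ 4 := by
    have h₁ := hai.card_le_finrank_succ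
    have h₂ := Submodule.finrank_le (vectorSpan ℝ (Set.range z))
    rw [Module.finrank_fin_fun] at h₂
    omega
  obtain ⟨f⟩ : Nonempty (ι ↪ Fin 4) := Function.Embedding.nonempty_of_card_le (by simpa using hcard)
  have hidx : ∀ i, ∃ k, k < s.verts.length ∧ toReal (s.vert k) = z i := fun i => by
    obtain ⟨v, hv, hvz⟩ := hz ⟨i, rfl⟩
    obtain ⟨k, hk, rfl⟩ := List.mem_iff_getElem.1 hv
    exact ⟨k, hk, by rw [hvz]; simp [Surface.vert, hk]⟩
  choose idx hidx hidx' using hidx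
  have hsum : ∀ g : Fin 4 → ℝ, ∑ j, Function.extend f w 0 j * g j = ∑ i, w i * g (f i) := by
    intro g
    symm
    refine Fintype.sum_of_injective f f.injective _ _ (fun j hj => ?_) fun i => ?_
    · rw [Function.extend_apply' _ _ _ (by simpa using hj)]; simp
    · rw [f.injective.extend_apply]
  -- If fewer points are needed, the list is filled up with vertex `0`, which always exists, at
  -- weight `0`.
  refine ⟨Function.extend f idx 0, Function.extend f w 0, fun j => ?_, fun j => ?_, ?_,
    fun i => ?_⟩
  · by_cases hj : ∃ i, f i = j
    · obtain ⟨i, rfl⟩ := hj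
      rw [f.injective.extend_apply]; exact hidx i
    · rw [Function.extend_apply' _ _ _ hj]
      simp [Surface.verts]
  · by_cases hj : ∃ i, f i = j
    · obtain ⟨i, rfl⟩ := hj
      rw [f.injective.extend_apply]; exact (hw i).le
    · rw [Function.extend_apply' _ _ _ hj]; simp
  · simpa [hw₁] using hsum fun _ => 1
  · rw [hsum fun j => ((s.vert (Function.extend f idx 0 j) i : ℤ) : ℝ), ← hwx, Finset.sum_apply]
    refine Finset.sum_congr rfl fun l _ => ?_
    rw [f.injective.extend_apply, Pi.smul_apply, ← hidx' l]
    rfl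

/-- A box meets a surface if and only if this is witnessed by a small combination of vertices. -/
theorem Surface.meets_iff : ∃ e : ℕ, ∀ (s : Surface) (t : Prop) (q : ℕ) (lo hi : V3) (M : ℕ),
    2 ≤ M → (∀ k < s.verts.length, ∀ i, |q * s.vert k i - lo i| ≤ M ∧
      |hi i - q * s.vert k i| ≤ M) →
    (s.Meets t q lo hi ↔ ∃ k : Fin 4 → ℕ, (∀ j, k j < s.verts.length) ∧
      ∃ w : Fin 4 → ℕ, (∀ j, w j < M ^ e + 1) ∧ s.MeetsAt t q lo hi k w) := by
  obtain ⟨e, he⟩ := exists_small_solution 4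
  refine ⟨e, fun s t q lo hi M hM hbd => ⟨?_, ?_⟩⟩
  swap
  · rintro ⟨k, hk, w, -, h⟩
    exact h.meets hk
  rintro ⟨x, hx, h⟩
  obtain ⟨k, a, hk, ha, ha₁, hax⟩ := s.exists_four hx
  -- The rows say that the weights are nonnegative, that their sum is positive, and that the point
  -- respects the lower and the upper sides of the box. Multiplying the corners of the box by the
  -- sum of weights makes the system homogeneous.
  let ι : Type := Fin 4 ⊕ Unit ⊕ Fin 3 ⊕ Fin 3
  let r : ι → Fin 4 → ℤ := Sum.elim (fun i => Pi.single i 1) (Sum.elim (fun _ _ => 1)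
    (Sum.elim (fun i j => q * s.vert (k j) i - lo i) (fun i j => hi i - q * s.vert (k j) i)))
  let st : ι → Prop := Sum.elim (fun _ => False) (Sum.elim (fun _ => True) fun _ => t)
  obtain ⟨b, hb, hb'⟩ := he M hM ι r st (by
    rintro (i | i | i | i) j
    · simp only [r, Sum.elim_inl, Pi.single_apply]
      split_ifs <;> simp <;> omega
    · simp [r]; omega
    · exact (hbd _ (hk j) i).1
    · exact (hbd _ (hk j) i).2) ⟨a, by
    rintro (i | i | i | i)
    · simp only [r, st, Sum.elim_inl, Pi.single_apply]
      simpa [Sat] using ha i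
    · simp [r, st, ha₁, Sat]
    · simp only [r, st, Sum.elim_inl, Sum.elim_inr]
      refine Sat.congr ((h i).1) ?_
      push_cast
      simp only [sub_mul, Finset.sum_sub_distrib, ← Finset.mul_sum, ha₁, mul_one]
      rw [← hax i, Finset.mul_sum]
      congr 1
      exact Finset.sum_congr rfl fun j _ => by ring
    · simp only [r, st, Sum.elim_inr]
      refine Sat.congr ((h i).2) ?_
      push_cast
      simp only [sub_mul, Finset.sum_sub_distrib, ← Finset.mul_sum, ha₁, mul_one]
      rw [← hax i, Finset.mul_sum]
      congr 1
      exact Finset.sum_congr rfl fun j _ => by ring⟩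
  have hb₀ : ∀ j, 0 ≤ b j := fun j => by
    have := (hb' (.inl j)).1
    simpa [r, Pi.single_apply] using this
  have hbn : ∀ j, (((b j).toNat : ℕ) : ℤ) = b j := fun j => Int.toNat_of_nonneg (hb₀ j)
  have hsum : ((∑ j, (b j).toNat : ℕ) : ℤ) = ∑ j, b j := by
    push_cast; exact Finset.sum_congr rfl fun j _ => hbn j
  have hcomb : ∀ i, s.comb k (fun j => (b j).toNat) i = ∑ j, b j * s.vert (k j) i := fun i => by
    simp only [Surface.comb, Finset.sum_apply, Pi.smul_apply, smul_eq_mul, hbn]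
  refine ⟨k, hk, fun j => (b j).toNat, fun j => ?_, ?_, fun i => ⟨?_, ?_⟩⟩
  · have h₁ := hb j
    have h₂ := hbn j
    rw [abs_of_nonneg (hb₀ j)] at h₁
    beta_reduce
    omega
  · have h₁ := (hb' (.inr (.inl ()))).2 trivial
    simp only [r, Sum.elim_inl, Sum.elim_inr, one_mul] at h₁
    rw [← hsum] at h₁
    exact_mod_cast h₁
  · have h₁ := hb' (.inr (.inr (.inl i)))
    simp only [r, st, Sum.elim_inl, Sum.elim_inr] at h₁
    refine Sat.congr h₁ ?_
    rw [hsum, hcomb, Finset.mul_sum, Finset.sum_mul, ← Finset.sum_sub_distrib]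
    exact Finset.sum_congr rfl fun j _ => by ring
  · have h₁ := hb' (.inr (.inr (.inr i)))
    simp only [r, st, Sum.elim_inr] at h₁
    refine Sat.congr h₁ ?_
    rw [hsum, hcomb, Finset.mul_sum, Finset.sum_mul, ← Finset.sum_sub_distrib]
    exact Finset.sum_congr rfl fun j _ => by ring

end PortalGame

namespace PortalGame

variable {α β γ δ : Type} [Rep α] [Rep β] [Rep γ] [Rep δ]

/-! ## Computing with surfaces -/

theorem PT.congr_rep {f g : α → β} (hf : PT f)
    (h : ∀ L : Level, L.WellFormed → ∀ n a, Rep.R L n a → f a = g a) : PT g :=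
  hf.transport fun L hL n a ha => ⟨a, ha, fun m hm => by rwa [← h L hL n a ha]⟩

theorem PT.sum_range {f : α → ℕ → ℕ} {n : α → ℕ} (hf : PT fun x : α × ℕ => f x.1 x.2)
    (hn : PT n) : PT fun a => ∑ k ∈ Finset.range (n a), f a k := by
  have h : PT fun x : α × ℕ => ∑ k ∈ Finset.range x.2, f x.1 k := by
    refine PT.rec (init := fun _ => 0) (body := fun x => x.2 + f x.1.1 x.1.2) (by fun_prop)
      (PT.snd.add_nat (hf.comp PT.fst)) ?_ (by simp) fun a k => Finset.sum_range_succ _ _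
    obtain ⟨e, he⟩ := hf.polyBdd
    refine ⟨e + 1, fun L hL m x hx m' hm' => ?_⟩
    obtain ⟨a, j⟩ := x
    obtain ⟨p, q, rfl, hp, hq⟩ := hx
    obtain rfl : q = j := hq
    rw [show m' = _ from hm']
    refine (Finset.sum_le_card_nsmul _ _ ((levelSize L + cpair p q + 2) ^ e) fun k hk => ?_).trans ?_
    · refine (he L hL (cpair p k) (a, k) ⟨p, k, rfl, hp, rfl⟩ _ rfl).trans ?_
      have hkq : k < q := Finset.mem_range.1 hk
      have := cpair_mono (le_refl p) hkq.le
      exact Nat.pow_le_pow_left (by omega) e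
    · have := right_le_cpair p q
      rw [Finset.card_range, smul_eq_mul, pow_succ, mul_comm]
      exact Nat.mul_le_mul_left _ (by omega)
  exact h.comp (PT.id.prodMk hn)

instance : Rep (Fin 4 → ℕ) := ⟨fun L n w => Rep.R L n (w 0, w 1, w 2, w 3)⟩

theorem PT.coord_four {f : α → Fin 4 → ℕ} (hf : PT f) (i : Fin 4) : PT fun a => f a i := by
  have h : PT fun v : Fin 4 → ℕ => (v 0, v 1, v 2, v 3) := .of_rep fun _ _ _ _ h => h
  have h' := h.comp hf
  fin_cases i
  exacts [h'.fst', h'.snd'.fst', h'.snd'.snd'.fst', h'.snd'.snd'.snd']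

/-- Four nested bounded searches; their number is fixed, so the time remains polynomial. -/
theorem PT.exists_four_lt {P : α → (Fin 4 → ℕ) → Prop} {n : α → ℕ}
    (hP : PT fun x : α × (Fin 4 → ℕ) => P x.1 x.2) (hn : PT n) :
    PT fun a => ∃ w : Fin 4 → ℕ, (∀ j, w j < n a) ∧ P a w := by
  have hv : PT fun x : ℕ × ℕ × ℕ × ℕ => (![x.1, x.2.1, x.2.2.1, x.2.2.2] : Fin 4 → ℕ) :=
    .of_rep fun _ _ _ _ h => h
  have h : PT fun x : α × ℕ × ℕ × ℕ × ℕ => P x.1 ![x.2.1, x.2.2.1, x.2.2.2.1, x.2.2.2.2] :=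
    hP.comp (PT.fst.prodMk (hv.comp .snd))
  have h₁ : PT fun x : ((((α × ℕ) × ℕ) × ℕ) × ℕ) =>
      P x.1.1.1.1 ![x.1.1.1.2, x.1.1.2, x.1.2, x.2] :=
    h.comp (f := fun x : ((((α × ℕ) × ℕ) × ℕ) × ℕ) =>
      (x.1.1.1.1, x.1.1.1.2, x.1.1.2, x.1.2, x.2)) (by fun_prop)
  have hn' := hn.comp (PT.fst (α := α) (β := ℕ))
  have hn'' := hn'.comp (PT.fst (α := α × ℕ) (β := ℕ))
  have h₂ := PT.exists_lt (P := fun (x : ((α × ℕ) × ℕ) × ℕ) k =>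
    P x.1.1.1 ![x.1.1.2, x.1.2, x.2, k]) h₁ (hn''.comp .fst)
  have h₃ := PT.exists_lt (P := fun (x : (α × ℕ) × ℕ) r =>
    ∃ k < n x.1.1, P x.1.1 ![x.1.2, x.2, r, k]) h₂ hn''
  have h₄ := PT.exists_lt (P := fun (x : α × ℕ) q =>
    ∃ r < n x.1, ∃ k < n x.1, P x.1 ![x.2, q, r, k]) h₃ hn'
  refine (PT.exists_lt (P := fun a p => ∃ q < n a, ∃ r < n a, ∃ k < n a, P a ![p, q, r, k])
    h₄ hn).congr fun a => ?_
  simp only [eq_iff_iff]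
  constructor
  · rintro ⟨p, hp, q, hq, r, hr, s, hs, h⟩
    refine ⟨_, fun j => ?_, h⟩
    fin_cases j
    exacts [hp, hq, hr, hs]
  · rintro ⟨w, hw, h⟩
    refine ⟨w 0, hw 0, w 1, hw 1, w 2, hw 2, w 3, hw 3, ?_⟩
    convert h
    ext j; fin_cases j <;> rfl

theorem PT.sat (t : Prop) {f : α → ℤ} (hf : PT f) : PT fun a => Sat t (f a) := by
  by_cases ht : t
  · exact (PT.lt_int (.const_int 0) hf).congr fun a => by
      rw [eq_iff_iff]; simp only [Sat, ht, true_imp_iff]; omega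
  · exact (PT.le_int (.const_int 0) hf).congr fun a => by simp [Sat, ht]

theorem PT.forall_fin_three {P : α → Fin 3 → Prop} (h : ∀ i, PT fun a => P a i) :
    PT fun a => ∀ i, P a i :=
  ((h 0).and ((h 1).and (h 2))).congr fun a => by simp [Fin.forall_fin_succ]

theorem PT.meetsAt (t : Prop) {f : α → Surface} {q : α → ℕ} {lo hi : α → V3}
    {k w : α → Fin 4 → ℕ} (hf : PT f) (hq : PT q) (hlo : PT lo) (hhi : PT hi) (hk : PT k)
    (hw : PT w) : PT fun a => (f a).MeetsAt t (q a) (lo a) (hi a) (k a) (w a) := by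
  have hsum : PT fun a => ∑ j, w a j := by
    simp only [Fin.sum_univ_four]
    exact (((hw.coord_four 0).add_nat (hw.coord_four 1)).add_nat (hw.coord_four 2)).add_nat
      (hw.coord_four 3)
  have hcomb : ∀ i, PT fun a => (f a).comb (k a) (w a) i := fun i => by
    have h : ∀ j, PT fun a => (w a j : ℤ) * (f a).vert (k a j) i := fun j =>
      (hw.coord_four j).natCast.mul_int ((PT.vert hf (hk.coord_four j)).coord i)
    simp only [Surface.comb, Fin.sum_univ_four, Pi.add_apply, Pi.smul_apply, smul_eq_mul]
    exact (((h 0).add_int (h 1)).add_int (h 2)).add_int (h 3)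
  refine (PT.lt_nat (.const_nat 0) hsum).and (PT.forall_fin_three fun i => ?_)
  have h₁ := hq.natCast.mul_int (hcomb i)
  exact (PT.sat t (h₁.sub_int (hsum.natCast.mul_int (hlo.coord i)))).and
    (PT.sat t ((hsum.natCast.mul_int (hhi.coord i)).sub_int h₁))

/-- The sum of the absolute values of the coordinates. -/
def absSum (v : V3) : ℕ := (v 0).natAbs + (v 1).natAbs + (v 2).natAbs

theorem abs_le_absSum (v : V3) (i : Fin 3) : |v i| ≤ (absSum v : ℤ) := by
  rw [Int.abs_eq_natAbs]
  fin_cases i <;> simp only [absSum] <;> dsimp <;> omega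

theorem PT.absSum {f : α → V3} (hf : PT f) : PT fun a => absSum (f a) :=
  ((hf.coord 0).natAbs.add_nat (hf.coord 1).natAbs).add_nat (hf.coord 2).natAbs

theorem PT.meets (t : Prop) {f : α → Surface} {q : α → ℕ} {lo hi : α → V3} (hf : PT f)
    (hq : PT q) (hlo : PT lo) (hhi : PT hi) :
    PT fun a => (f a).Meets t (q a) (lo a) (hi a) := by
  obtain ⟨e, he⟩ := Surface.meets_iff
  -- A computable number that dominates all coefficients of the linear system, for any choice of
  -- four vertices; the `2` meets the requirement `2 ≤ M`.
  obtain ⟨M, hM, hMeq⟩ : ∃ M : α → ℕ, PT M ∧ ∀ a, M a = 2 + q a * (∑ k ∈ Finset.range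
      (f a).verts.length, PortalGame.absSum ((f a).vert k)) + PortalGame.absSum (lo a) +
      PortalGame.absSum (hi a) :=
    ⟨_, ((((PT.const_nat 2).add_nat (hq.mul_nat (PT.sum_range
      (PT.absSum (PT.vert (hf.comp .fst) .snd)) hf.numVerts))).add_nat hlo.absSum).add_nat
        hhi.absSum), fun _ => rfl⟩
  have h := PT.exists_four_lt (P := fun (x : α × (Fin 4 → ℕ)) w =>
    (f x.1).MeetsAt t (q x.1) (lo x.1) (hi x.1) x.2 w)
    (PT.meetsAt t (hf.comp (by fun_prop)) (hq.comp (by fun_prop)) (hlo.comp (by fun_prop))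
      (hhi.comp (by fun_prop)) (by fun_prop) .snd)
    (((hM.comp .fst).pow_nat e).add_nat (.const_nat 1))
  refine (PT.exists_four_lt (P := fun a k => ∃ w : Fin 4 → ℕ, (∀ j, w j < M a ^ e + 1) ∧
    (f a).MeetsAt t (q a) (lo a) (hi a) k w) h hf.numVerts).congr fun a => ?_
  rw [he (f a) t (q a) (lo a) (hi a) (M a) (by rw [hMeq]; omega)]
  intro k hk i
  have h₁ : PortalGame.absSum ((f a).vert k) ≤
      ∑ k ∈ Finset.range (f a).verts.length, PortalGame.absSum ((f a).vert k) :=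
    Finset.single_le_sum (f := fun k => PortalGame.absSum ((f a).vert k))
      (fun _ _ => Nat.zero_le _) (Finset.mem_range.2 hk)
  have h₂ : |(q a : ℤ) * (f a).vert k i| ≤ (q a : ℤ) * (∑ k ∈ Finset.range (f a).verts.length,
      PortalGame.absSum ((f a).vert k) : ℕ) := by
    rw [abs_mul, Nat.abs_cast]
    exact mul_le_mul_of_nonneg_left ((abs_le_absSum _ i).trans (by exact_mod_cast h₁))
      (by positivity)
  have h₃ := abs_le_absSum (lo a) i
  have h₄ := abs_le_absSum (hi a) i
  rw [abs_le] at h₂ h₃ h₄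
  rw [abs_le, abs_le, hMeq]
  push_cast at h₂ ⊢
  refine ⟨⟨?_, ?_⟩, ?_, ?_⟩ <;> linarith

/-! ### The body of the avatar -/

theorem not_disjoint_body_iff {E : Engine} {c : Bool} {p : V3} {s : Surface} :
    ¬Disjoint (body E c p) s.region ↔ s.Meets True 1 (bodyLow E p) (bodyHigh E c p) := by
  rw [Set.not_disjoint_iff]
  refine exists_congr fun x => ?_
  rw [and_comm]
  refine and_congr_right fun _ => forall_congr' fun i => ?_
  simp only [Sat, true_imp_iff, Nat.cast_one, one_mul, sub_pos, sub_nonneg]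
  exact ⟨fun h => ⟨⟨h.1.le, h.1⟩, h.2.le, h.2⟩, fun h => ⟨h.1.2, h.2.2⟩⟩

theorem PT.bodyLow (E : Engine) {p : α → V3} (hp : PT p) : PT fun a => bodyLow E (p a) :=
  hp.sub_v3 (.const_v3 _)

@[fun_prop]
theorem PT.height (E : Engine) {c : α → Bool} (hc : PT c) : PT fun a => height E (c a) :=
  PT.ite hc.bool_eq (.const_nat _) (.const_nat _)

@[fun_prop]
theorem PT.eyeHeight (E : Engine) {c : α → Bool} (hc : PT c) : PT fun a => eyeHeight E (c a) :=
  PT.ite hc.bool_eq (.const_nat _) (.const_nat _)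

theorem PT.bodyHigh (E : Engine) {c : α → Bool} {p : α → V3} (hc : PT c) (hp : PT p) :
    PT fun a => bodyHigh E (c a) (p a) :=
  hp.add_v3 (.vec (.const_int _) (.const_int _) (hc.height E).natCast)

theorem PT.blocks (E : Engine) {c : α → Bool} {p : α → V3} {s : α → Surface} (hc : PT c)
    (hp : PT p) (hs : PT s) : PT fun a => ¬Disjoint (body E (c a) (p a)) (s a).region := by
  simp only [not_disjoint_body_iff]
  exact PT.meets True hs (.const_nat 1) (hp.bodyLow E) (hc.bodyHigh E hp)

theorem PT.free (E : Engine) {L : α → Level} {c : α → Bool} {p : α → V3} (hL : PT L) (hc : PT c)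
    (hp : PT p) : PT fun a => Free E (L a) (c a) (p a) :=
  PT.forall_surface ((PT.blocks E (hc.comp .fst) (hp.comp .fst) .snd).not.congr fun _ => propext not_not)
    hL

theorem PT.grounded (E : Engine) {L : α → Level} {c : α → Bool} {p : α → V3} (hL : PT L)
    (hc : PT c) (hp : PT p) : PT fun a => Grounded E (L a) (c a) (p a) :=
  (PT.free E hL hc (hp.sub_v3 (.const_v3 e₃))).not

/-! ### The Portal Gun -/

/-- The parameter at which a ray crosses the plane of a surface is `rayNum / rayDen`. -/
def rayNum (eye d : V3) (s : Surface) : ℤ := (s.normal ⬝ᵥ (s.a - eye)) * (s.normal ⬝ᵥ d).sign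

def rayDen (d : V3) (s : Surface) : ℕ := (s.normal ⬝ᵥ d).natAbs

/-- The point where a ray crosses the plane of a surface, times `rayDen`. -/
def rayPoint (eye d : V3) (s : Surface) : V3 := (rayDen d s : ℤ) • eye + rayNum eye d s • d

/-- The ray crosses the surface. -/
def CanHit (eye d : V3) (s : Surface) : Prop :=
  rayDen d s ≠ 0 ∧ 0 ≤ rayNum eye d s ∧
    s.Meets False (rayDen d s) (rayPoint eye d s) (rayPoint eye d s)

/-- The plane equation holds at the first three vertices by orthogonality of the cross product, at
the others by well-formedness, and it defines a convex set. -/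
theorem Surface.WellFormed.normal_dot {s : Surface} (hs : s.WellFormed) {x : Fin 3 → ℝ}
    (hx : x ∈ s.region) : ∑ i, (s.normal i : ℝ) * (x i - s.a i) = 0 := by
  have hv : ∀ v ∈ s.verts, s.normal ⬝ᵥ (v - s.a) = 0 := by
    intro v hv
    simp only [Surface.verts, List.mem_cons] at hv
    rcases hv with rfl | rfl | rfl | hv
    · simp
    · rw [Surface.normal, dotProduct_comm]; exact dot_self_cross _ _
    · rw [Surface.normal, dotProduct_comm]; exact dot_cross_self _ _
    · exact hs.2 v hv
  have hconv : Convex ℝ {x : Fin 3 → ℝ | ∑ i, (s.normal i : ℝ) * (x i - s.a i) = 0} := by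
    intro x hx y hy a b _ _ hab
    simp only [Set.mem_ofPred_eq, Fin.sum_univ_three, Pi.add_apply, Pi.smul_apply, smul_eq_mul]
      at hx hy ⊢
    obtain rfl : b = 1 - a := by linarith
    linear_combination a * hx + (1 - a) * hy
  refine convexHull_min (s := {x | ∃ v ∈ s.verts, x = toReal v}) ?_ hconv hx
  rintro _ ⟨v, hv', rfl⟩
  have := hv v hv'
  simp only [dotProduct, Pi.sub_apply] at this
  simp only [Set.mem_ofPred_eq, toReal]
  exact_mod_cast this

/-- The plane equation determines the parameter. Multiplying numerator and denominator by a sign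
makes the denominator a positive natural number, and after clearing it the remaining condition is
that a box shrunk to one point meets the enlarged surface, so `PT.meets` applies. -/
theorem hits_iff {eye d : V3} {s : Surface} (hs : s.WellFormed) {t : ℝ} :
    Hits eye d s t ↔ CanHit eye d s ∧ t = rayNum eye d s / rayDen d s := by
  by_cases hd : s.normal ⬝ᵥ d = 0
  · simp [Hits, CanHit, rayDen, hd]
  have hden : rayDen d s ≠ 0 := by simpa [rayDen] using hd
  have hdenr : (0 : ℝ) < rayDen d s := by exact_mod_cast Nat.pos_of_ne_zero hden
  have hdd : (rayDen d s : ℤ) = (s.normal ⬝ᵥ d) * (s.normal ⬝ᵥ d).sign := by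
    simp [rayDen]
  have hsign : ((s.normal ⬝ᵥ d).sign : ℝ) ≠ 0 := by
    exact_mod_cast (Int.sign_eq_zero_iff_zero.not.2 hd)
  have ht : ∀ t : ℝ, toReal eye + t • toReal d ∈ s.region →
      t = rayNum eye d s / rayDen d s := by
    intro t ht
    have h₁ := hs.normal_dot ht
    rw [eq_div_iff hdenr.ne']
    have h₂ : ((rayDen d s : ℕ) : ℝ) = ((rayDen d s : ℤ) : ℝ) := by simp
    rw [h₂, hdd]
    simp only [rayNum, dotProduct, Fin.sum_univ_three, Pi.sub_apply, Pi.add_apply, Pi.smul_apply,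
      smul_eq_mul, toReal] at h₁ ⊢
    push_cast
    linear_combination ((s.normal 0 * d 0 + s.normal 1 * d 1 + s.normal 2 * d 2).sign : ℝ) * h₁
  have hmeets : s.Meets False (rayDen d s) (rayPoint eye d s) (rayPoint eye d s) ↔
      toReal eye + ((rayNum eye d s : ℝ) / rayDen d s) • toReal d ∈ s.region := by
    have hp : ∀ i, (rayPoint eye d s i : ℝ) =
        rayDen d s * (toReal eye + ((rayNum eye d s : ℝ) / rayDen d s) • toReal d) i := by
      intro i
      simp only [rayPoint, Pi.add_apply, Pi.smul_apply, smul_eq_mul, toReal]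
      push_cast
      field_simp
    constructor
    · rintro ⟨x, hx, h⟩
      convert hx using 1
      ext i
      have h₁ := (h i).1.1
      have h₂ := (h i).2.1
      rw [hp] at h₁ h₂
      exact mul_left_cancel₀ hdenr.ne' (by linarith)
    · intro h
      refine ⟨_, h, fun i => ?_⟩
      rw [hp]
      simp [Sat]
  constructor
  · rintro ⟨h₁, h₂, h₃⟩
    have h₄ := ht t h₃
    subst h₄
    refine ⟨⟨hden, ?_, hmeets.2 h₃⟩, rfl⟩
    have := mul_nonneg h₁ hdenr.le
    rw [div_mul_cancel₀ _ hdenr.ne'] at this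
    exact_mod_cast this
  · rintro ⟨⟨h₁, h₂, h₃⟩, rfl⟩
    exact ⟨div_nonneg (by exact_mod_cast h₂) hdenr.le, hd, hmeets.1 h₃⟩

end PortalGame

namespace PortalGame

variable {α β γ δ : Type} [Rep α] [Rep β] [Rep γ] [Rep δ]

/-! ### Portals -/

instance : Rep Portal := ⟨fun L n P => Rep.R L n (P.surface, P.pos, P.normal, P.right)⟩

theorem PT.portalSurface {P : α → Portal} (hP : PT P) : PT fun a => (P a).surface := by
  have h : PT fun P : Portal => (P.surface, P.pos, P.normal, P.right) := .of_rep fun _ _ _ _ h => h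
  exact (h.comp hP).fst'

theorem PT.portalPos {P : α → Portal} (hP : PT P) : PT fun a => (P a).pos := by
  have h : PT fun P : Portal => (P.surface, P.pos, P.normal, P.right) := .of_rep fun _ _ _ _ h => h
  exact (h.comp hP).snd'.fst'

theorem PT.portalNormal {P : α → Portal} (hP : PT P) : PT fun a => (P a).normal := by
  have h : PT fun P : Portal => (P.surface, P.pos, P.normal, P.right) := .of_rep fun _ _ _ _ h => h
  exact (h.comp hP).snd'.snd'.fst'

theorem PT.portalRight {P : α → Portal} (hP : PT P) : PT fun a => (P a).right := by
  have h : PT fun P : Portal => (P.surface, P.pos, P.normal, P.right) := .of_rep fun _ _ _ _ h => h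
  exact (h.comp hP).snd'.snd'.snd'

theorem PT.portalMk {s : α → Surface} {p n r : α → V3} (hs : PT s) (hp : PT p) (hn : PT n)
    (hr : PT r) : PT fun a => Portal.mk (s a) (p a) (n a) (r a) :=
  (hs.prodMk (hp.prodMk (hn.prodMk hr))).transport fun _ _ _ a ha => ⟨a, ha, fun _ h => h⟩

theorem PT.surfaceA {s : α → Surface} (hs : PT s) : PT fun a => (s a).a := hs.vert (.const_nat 0)

theorem PT.normal {s : α → Surface} (hs : PT s) : PT fun a => (s a).normal :=
  PT.cross ((hs.vert (.const_nat 1)).sub_v3 (hs.vert (.const_nat 0)))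
    ((hs.vert (.const_nat 2)).sub_v3 (hs.vert (.const_nat 0)))

theorem PT.viewDir (E : Engine) {inp : α → Input E} (h : PT inp) :
    PT fun a => viewDir E (inp a).cursor :=
  (PT.of_input (f := fun i => PortalGame.viewDir E i.cursor) fun _ => .const_v3 _).comp h

theorem PT.rightDir (E : Engine) {inp : α → Input E} (h : PT inp) :
    PT fun a => rightDir E (inp a).cursor :=
  (PT.of_input (f := fun i => PortalGame.rightDir E i.cursor) fun _ => .const_v3 _).comp h

theorem PT.rayNum {eye d : α → V3} {s : α → Surface} (he : PT eye) (hd : PT d) (hs : PT s) :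
    PT fun a => rayNum (eye a) (d a) (s a) :=
  (PT.dot hs.normal (hs.surfaceA.sub_v3 he)).mul_int (PT.dot hs.normal hd).sign

theorem PT.rayDen {d : α → V3} {s : α → Surface} (hd : PT d) (hs : PT s) :
    PT fun a => rayDen (d a) (s a) := (PT.dot hs.normal hd).natAbs

theorem PT.rayPoint {eye d : α → V3} {s : α → Surface} (he : PT eye) (hd : PT d) (hs : PT s) :
    PT fun a => rayPoint (eye a) (d a) (s a) :=
  ((hd.rayDen hs).natCast.smul_v3 he).add_v3 ((he.rayNum hd hs).smul_v3 hd)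

theorem PT.canHit {eye d : α → V3} {s : α → Surface} (he : PT eye) (hd : PT d) (hs : PT s) :
    PT fun a => CanHit (eye a) (d a) (s a) :=
  ((hd.rayDen hs).eq_nat (.const_nat 0)).not.and (((PT.const_int 0).le_int (he.rayNum hd hs)).and
    (hs.meets False (hd.rayDen hs) (he.rayPoint hd hs) (he.rayPoint hd hs)))

/-- The portal that a shot creates on the surface `s`, in integer arithmetic. -/
noncomputable def portalAt (E : Engine) (eye : V3) (o : Orientation E) (s : Surface) : Portal :=
  let d := viewDir E o
  let n : V3 := if s.normal ⬝ᵥ d < 0 then s.normal else -s.normal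
  { surface := s
    pos := fun i => (2 * rayPoint eye d s i + rayDen d s) / ((2 * rayDen d s : ℕ) : ℤ)
    normal := n
    right := if n 0 = 0 ∧ n 1 = 0 then rightDir E o else crossProduct e₃ n }

/-- Rounding is the floor of `x + 1 / 2`, and for `x = p / q` this is the integer quotient of `2 * p
+ q` by `2 * q`. -/
theorem newPortal_eq {E : Engine} {eye : V3} {o : Orientation E} {s : Surface}
    (h : rayDen (viewDir E o) s ≠ 0) :
    newPortal E eye o s (rayNum eye (viewDir E o) s / rayDen (viewDir E o) s) =
      portalAt E eye o s := by
  unfold newPortal portalAt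
  dsimp only
  congr 1
  ext i
  set d := viewDir E o
  have hq : (0 : ℝ) < rayDen d s := by exact_mod_cast Nat.pos_of_ne_zero h
  have hq' : (0 : ℤ) < ((2 * rayDen d s : ℕ) : ℤ) := by
    have := Nat.pos_of_ne_zero h
    omega
  have hp : (eye i : ℝ) + (rayNum eye d s : ℝ) / rayDen d s * d i = rayPoint eye d s i / rayDen d s := by
    simp only [rayPoint, Pi.add_apply, Pi.smul_apply, smul_eq_mul]
    push_cast
    field_simp
  rw [hp, round_eq, Int.floor_eq_iff]
  have h₁ := Int.ediv_mul_le (2 * rayPoint eye d s i + rayDen d s) hq'.ne'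
  have h₂ := Int.lt_ediv_add_one_mul_self (2 * rayPoint eye d s i + rayDen d s) hq'
  set z := (2 * rayPoint eye d s i + rayDen d s) / ((2 * rayDen d s : ℕ) : ℤ)
  have h₃ : (z : ℝ) * (2 * rayDen d s) ≤ 2 * rayPoint eye d s i + rayDen d s := by
    exact_mod_cast h₁
  have h₄ : (2 * rayPoint eye d s i + rayDen d s : ℝ) < (z + 1) * (2 * rayDen d s) := by
    exact_mod_cast h₂
  have h₅ : (rayPoint eye d s i : ℝ) / rayDen d s + 1 / 2 =
      (2 * rayPoint eye d s i + rayDen d s) / (2 * rayDen d s) := by field_simp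
  rw [h₅]
  exact ⟨(le_div_iff₀ (by positivity)).2 h₃, (div_lt_iff₀ (by positivity)).2 h₄⟩

theorem PT.portalAt (E : Engine) {eye : α → V3} {inp : α → Input E} {s : α → Surface}
    (he : PT eye) (hi : PT inp) (hs : PT s) :
    PT fun a => portalAt E (eye a) (inp a).cursor (s a) := by
  have hd := hi.viewDir
  have hn := PT.ite ((PT.dot hs.normal hd).lt_int (.const_int 0)) hs.normal hs.normal.neg_v3
  have hpos : ∀ i, PT fun a =>
      (2 * PortalGame.rayPoint (eye a) (PortalGame.viewDir E (inp a).cursor) (s a) i +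
        PortalGame.rayDen (PortalGame.viewDir E (inp a).cursor) (s a)) /
      ((2 * PortalGame.rayDen (PortalGame.viewDir E (inp a).cursor) (s a) : ℕ) : ℤ) := fun i =>
    (((PT.const_int 2).mul_int ((he.rayPoint hd hs).coord i)).add_int
      (hd.rayDen hs).natCast).ediv ((PT.const_nat 2).mul_nat (hd.rayDen hs))
  exact PT.portalMk hs (.v3 (hpos 0) (hpos 1) (hpos 2)) hn
    (PT.ite (((hn.coord 0).eq_int (.const_int 0)).and ((hn.coord 1).eq_int (.const_int 0)))
      hi.rightDir (PT.cross (.const_v3 _) hn))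

/-- The `j`-th surface is the closest one that the ray crosses. -/
def IsClosest (L : Level) (eye d : V3) (j : ℕ) : Prop :=
  (L.surfaces[j]?).elim False fun s => CanHit eye d s ∧ ∀ j' < L.surfaces.length,
    (L.surfaces[j']?).elim True fun s' => CanHit eye d s' →
      rayNum eye d s * rayDen d s' < rayNum eye d s' * rayDen d s ∨
        rayNum eye d s * rayDen d s' = rayNum eye d s' * rayDen d s ∧ j ≤ j'

theorem PT.isClosest {L : α → Level} {eye d : α → V3} {j : α → ℕ} (hL : PT L) (he : PT eye)
    (hd : PT d) (hj : PT j) : PT fun a => IsClosest (L a) (eye a) (d a) (j a) := by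
  refine PT.elim (PT.surface hL hj) (.const_prop _) ?_
  refine PT.and (PT.canHit (he.comp .fst) (hd.comp .fst) .snd) ?_
  refine PT.forall_lt ?_ ((PT.numSurfaces hL).comp .fst)
  refine PT.elim (PT.surface (hL.comp (by fun_prop)) .snd) (.const_prop _) ?_
  have h₁ : PT fun x : ((α × Surface) × ℕ) × Surface => eye x.1.1.1 := he.comp (by fun_prop)
  have h₂ : PT fun x : ((α × Surface) × ℕ) × Surface => d x.1.1.1 := hd.comp (by fun_prop)
  have h₃ : PT fun x : ((α × Surface) × ℕ) × Surface => x.1.1.2 := by fun_prop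
  have h₄ : PT fun x : ((α × Surface) × ℕ) × Surface => x.2 := by fun_prop
  have h₅ := (h₁.rayNum h₂ h₃).mul_int (h₂.rayDen h₄).natCast
  have h₆ := (h₁.rayNum h₂ h₄).mul_int (h₂.rayDen h₃).natCast
  exact (PT.canHit h₁ h₂ h₄).imp ((h₅.lt_int h₆).or ((h₅.eq_int h₆).and
    ((hj.comp (by fun_prop)).le_nat (by fun_prop))))

/-- Each surface is hit at only one parameter, so the quantifier over real parameters disappears,
and fractions with positive denominators are compared by cross-multiplication. -/
theorem closestHit_iff {L : Level} (hL : L.WellFormed) {eye d : V3} {j : Fin L.surfaces.length}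
    {t : ℝ} : ClosestHit L eye d j t ↔
      IsClosest L eye d j ∧ t = rayNum eye d (L.surfaces.get j) / rayDen d (L.surfaces.get j) := by
  have hw : ∀ j, (L.surfaces.get j).WellFormed := fun j => hL _ (List.get_mem _ _)
  have hlt : ∀ {n n' : ℤ} {q q' : ℕ}, q ≠ 0 → q' ≠ 0 →
      ((n : ℝ) / q < n' / q' ↔ n * q' < n' * q) ∧ ((n : ℝ) / q = n' / q' ↔ n * q' = n' * q) := by
    intro n n' q q' hq hq'
    have h₁ : (0 : ℝ) < q := by exact_mod_cast Nat.pos_of_ne_zero hq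
    have h₂ : (0 : ℝ) < q' := by exact_mod_cast Nat.pos_of_ne_zero hq'
    rw [div_lt_div_iff₀ h₁ h₂, div_eq_div_iff h₁.ne' h₂.ne']
    constructor <;> norm_cast
  rw [ClosestHit, hits_iff (hw j), IsClosest, List.getElem?_eq_getElem j.2]
  simp only [Option.elim_some, List.get_eq_getElem]
  constructor
  · rintro ⟨⟨h₁, h₂⟩, h₃⟩
    refine ⟨⟨h₁, fun j' hj' => ?_⟩, h₂⟩
    rw [List.getElem?_eq_getElem hj']
    simp only [Option.elim_some]
    intro h₄
    have h₅ := h₃ ⟨j', hj'⟩ _ ((hits_iff (hw ⟨j', hj'⟩)).2 ⟨h₄, rfl⟩)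
    rw [h₂] at h₅
    simp only [List.get_eq_getElem] at h₅
    rwa [(hlt h₁.1 h₄.1).1, (hlt h₁.1 h₄.1).2] at h₅
  · rintro ⟨⟨h₁, h₃⟩, h₂⟩
    refine ⟨⟨h₁, h₂⟩, fun j' t' h' => ?_⟩
    obtain ⟨h₄, rfl⟩ := (hits_iff (hw j')).1 h'
    have h₅ := h₃ j' j'.2
    rw [List.getElem?_eq_getElem j'.2] at h₅
    simp only [Option.elim_some] at h₅
    replace h₅ := h₅ h₄
    rw [h₂]
    simp only [List.get_eq_getElem] at h₄ ⊢
    rwa [(hlt h₁.1 h₄.1).1, (hlt h₁.1 h₄.1).2]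

theorem ClosestHit.unique {L : Level} {eye d : V3} {j j' : Fin L.surfaces.length} {t t' : ℝ}
    (h : ClosestHit L eye d j t) (h' : ClosestHit L eye d j' t') : j = j' ∧ t = t' := by
  rcases h.2 j' t' h'.1 with h₁ | ⟨rfl, h₁⟩ <;> rcases h'.2 j _ h.1 with h₂ | ⟨h₂, h₃⟩
  · exact absurd h₁ h₂.not_gt
  · exact absurd h₂ h₁.ne'
  · exact absurd h₂ (lt_irrefl _)
  · exact ⟨le_antisymm h₁ h₃, rfl⟩

-- The closest hit is unique, so the arbitrary choice in `shot` is the one that a search through the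
-- indices finds.
open scoped Classical in
theorem shot_eq (E : Engine) {L : Level} (hL : L.WellFormed) (eye : V3) (o : Orientation E) :
    shot E L eye o = ((List.range L.surfaces.length).find? fun j =>
      decide (IsClosest L eye (viewDir E o) j)).elim none fun j =>
        (L.surfaces[j]?).elim none fun s =>
          if s.portalable = true then some (portalAt E eye o s) else none := by
  have hIs : ∀ {j : ℕ}, IsClosest L eye (viewDir E o) j → j < L.surfaces.length := by
    intro j hj
    by_contra hlt
    rw [IsClosest, List.getElem?_eq_none (not_lt.1 hlt)] at hj
    exact hj
  unfold shot
  split_ifs with h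
  · have hspec := h.choose_spec
    obtain ⟨h₁, h₂⟩ := (closestHit_iff hL).1 hspec
    rw [find_range_eq (i := h.choose.1) h.choose.1.2 (by simpa using h₁)]
    · have hden : rayDen (viewDir E o) (L.surfaces.get h.choose.1) ≠ 0 := by
        have := h₁
        rw [IsClosest, List.getElem?_eq_getElem h.choose.1.2] at this
        exact this.1.1
      simp only [Option.elim_some, List.getElem?_eq_getElem h.choose.1.2]
      rw [h₂, newPortal_eq hden]
      rfl
    · intro j hj
      rw [decide_eq_false_iff_not]
      intro hc
      have h₃ := (closestHit_iff hL (j := ⟨j, hj.trans h.choose.1.2⟩)).2 ⟨hc, rfl⟩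
      have h₄ := (h₃.unique hspec).1
      have h₅ : j = h.choose.1 := congrArg Fin.val h₄
      omega
  · rw [List.find?_eq_none.2]
    · rfl
    · intro j hj
      simp only [decide_eq_true_eq]
      intro hc
      exact h ⟨(⟨j, hIs hc⟩, _), (closestHit_iff hL (j := ⟨j, hIs hc⟩)).2 ⟨hc, rfl⟩⟩

theorem PT.shot (E : Engine) {L : α → Level} {eye : α → V3} {inp : α → Input E} (hL : PT L)
    (he : PT eye) (hi : PT inp) : PT fun a => shot E (L a) (eye a) (inp a).cursor := by
  classical
  have hwf : PT fun x : Level × V3 × Input E => PortalGame.shot E x.1 x.2.1 x.2.2.cursor := by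
    have h₁ : PT fun x : Level × V3 × Input E => x.1 := by fun_prop
    have h₂ : PT fun x : Level × V3 × Input E => x.2.1 := by fun_prop
    have h₃ : PT fun x : Level × V3 × Input E => x.2.2 := by fun_prop
    have h₄ : PT fun y : ((Level × V3 × Input E) × ℕ) × Surface =>
        if y.2.portalable = true then
          Option.some (PortalGame.portalAt E y.1.1.2.1 y.1.1.2.2.cursor y.2) else Option.none :=
      PT.ite (PT.portalable .snd).bool_eq (PT.some (PT.portalAt E (by fun_prop) (by fun_prop)
        .snd)) .none
    have h₅ : PT fun y : (Level × V3 × Input E) × ℕ => (y.1.1.surfaces[y.2]?).elim Option.none fun s =>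
        if s.portalable = true then
          Option.some (PortalGame.portalAt E y.1.2.1 y.1.2.2.cursor s) else Option.none :=
      PT.elim (PT.surface (h₁.comp .fst) .snd) .none h₄
    have h₆ : PT fun y : (Level × V3 × Input E) × ℕ =>
        IsClosest y.1.1 y.1.2.1 (PortalGame.viewDir E y.1.2.2.cursor) y.2 :=
      PT.isClosest (h₁.comp .fst) (h₂.comp .fst) (h₃.viewDir.comp .fst) .snd
    have h₇ := PT.elim (PT.find_range (P := fun (x : Level × V3 × Input E) j =>
      IsClosest x.1 x.2.1 (PortalGame.viewDir E x.2.2.cursor) j) h₆ h₁.numSurfaces) .none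
      (g := fun x j => (x.1.surfaces[j]?).elim Option.none fun s => if s.portalable = true then
          Option.some (PortalGame.portalAt E x.2.1 x.2.2.cursor s) else Option.none) h₅
    -- The integer form of a shot is valid on well-formed levels only, and only those occur as
    -- represented levels.
    refine PT.congr_rep h₇ ?_
    rintro L hL n ⟨L', eye, inp⟩ ⟨_, _, _, hL', _⟩
    obtain rfl : L' = L := hL'
    rw [shot_eq E hL]
  exact hwf.comp (hL.prodMk (he.prodMk hi))

theorem PT.of_input_prop {E : Engine} (P : Input E → Prop) {inp : α → Input E} (h : PT inp) :
    PT fun a => P (inp a) := (PT.of_input fun _ => .const_prop _).comp h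

theorem PT.shoot (E : Engine) {L : α → Level} {eye : α → V3} {inp : α → Input E}
    {bo : α → Option Portal × Option Portal} (hL : PT L) (he : PT eye) (hi : PT inp)
    (hbo : PT bo) : PT fun a => shoot E (L a) (eye a) (inp a).cursor (inp a).fire (bo a) := by
  classical
  have hs := PT.shot E hL he hi
  refine (PT.ite (PT.of_input_prop (fun i => i.fire = Option.some .blue) hi)
    ((hs.or_option hbo.fst').prodMk hbo.snd')
    (PT.ite (PT.of_input_prop (fun i => i.fire = Option.some .orange) hi)
      (hbo.fst'.prodMk (hs.or_option hbo.snd')) hbo)).congr fun a => ?_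
  unfold PortalGame.shoot
  rcases (inp a).fire with _ | _ | _ <;> simp

end PortalGame

namespace PortalGame

variable {α β γ δ : Type} [Rep α] [Rep β] [Rep γ] [Rep δ]

/-! ### Passing through portals -/

theorem PT.clamp {L : α → Level} {v : α → V3} (hL : PT L) (hv : PT v) :
    PT fun a => (L a).clamp (v a) := by
  have h : ∀ i, PT fun a => max (-((L a).terminalVelocity : ℤ))
      (min ((L a).terminalVelocity : ℤ) (v a i)) := fun i =>
    (hL.terminalVelocity.natCast.neg_int).max_int (hL.terminalVelocity.natCast.min_int (hv.coord i))
  exact .v3 (h 0) (h 1) (h 2)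

theorem PT.transfer {u w v : α → V3} (hu : PT u) (hw : PT w) (hv : PT v) :
    PT fun a => transfer (u a) (w a) (v a) := by
  have h : ∀ i, PT fun a => ((v a ⬝ᵥ u a) * w a i).tdiv
      (Nat.sqrt ((u a ⬝ᵥ u a) * (w a ⬝ᵥ w a)).toNat : ℤ) := fun i =>
    ((hv.dot hu).mul_int (hw.coord i)).tdiv (((hu.dot hu).mul_int (hw.dot hw)).toNat.sqrt)
  exact .v3 (h 0) (h 1) (h 2)

theorem PT.turnVelocity {P Q : α → Portal} {v : α → V3} (hP : PT P) (hQ : PT Q) (hv : PT v) :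
    PT fun a => turnVelocity (P a) (Q a) (v a) :=
  ((PT.transfer hP.portalRight hQ.portalRight hv).neg_v3.add_v3
    (PT.transfer (hP.portalNormal.cross hP.portalRight) (hQ.portalNormal.cross hQ.portalRight)
      hv)).sub_v3 (PT.transfer hP.portalNormal hQ.portalNormal hv)

theorem PT.exitPos (E : Engine) {c : α → Bool} {Q : α → Portal} {k : α → ℕ} (hc : PT c)
    (hQ : PT Q) (hk : PT k) : PT fun a => exitPos E (c a) (Q a) (k a) := by
  have h : ∀ i, PT fun a => (Q a).pos i + ((k a : ℤ) * (Q a).normal i).tdiv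
      (Nat.sqrt ((Q a).normal ⬝ᵥ (Q a).normal).toNat : ℤ) := fun i =>
    (hQ.portalPos.coord i).add_int ((hk.natCast.mul_int (hQ.portalNormal.coord i)).tdiv
      ((hQ.portalNormal.dot hQ.portalNormal).toNat.sqrt))
  exact (PT.v3 (h 0) (h 1) (h 2)).sub_v3 (.vec (.const_int 0) (.const_int 0)
    ((hc.height E).div_nat (.const_nat 2)).natCast)

open scoped Classical in
theorem exit_eq (E : Engine) (L : Level) (c : Bool) (Q : Portal) :
    exit E L c Q = ((List.range (2 * E.halfWidth + E.standHeight + 5)).find? fun k =>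
      decide (Free E L c (exitPos E c Q k))).map (exitPos E c Q) := by
  rw [exit, List.find?_map]
  rfl

theorem PT.exit (E : Engine) {L : α → Level} {c : α → Bool} {Q : α → Portal} (hL : PT L)
    (hc : PT c) (hQ : PT Q) : PT fun a => exit E (L a) (c a) (Q a) := by
  classical
  have h₁ : PT fun x : α × ℕ => PortalGame.exitPos E (c x.1) (Q x.1) x.2 :=
    PT.exitPos E (hc.comp .fst) (hQ.comp .fst) .snd
  refine (PT.map_option (g := fun a k => PortalGame.exitPos E (c a) (Q a) k)
    (PT.find_range (P := fun a k => Free E (L a) (c a) (PortalGame.exitPos E (c a) (Q a) k))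
    (PT.free E (hL.comp .fst) (hc.comp .fst) h₁)
    (.const_nat (2 * E.halfWidth + E.standHeight + 5))) h₁).congr fun a => ?_
  rw [exit_eq]

theorem PT.enters (E : Engine) {c : α → Bool} {u p : α → V3} {P : α → Portal} (hc : PT c)
    (hu : PT u) (hp : PT p) (hP : PT P) : PT fun a => Enters E (c a) (u a) (p a) (P a) :=
  ((hu.dot hP.portalNormal).lt_int (.const_int 0)).and ((PT.blocks E hc hp hP.portalSurface).and
    (PT.forall_fin_three fun i =>
      ((((hp.bodyLow E).coord i).sub_int (.const_int _)).le_int (hP.portalPos.coord i)).and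
        ((hP.portalPos.coord i).le_int (((hc.bodyHigh E hp).coord i).add_int (.const_int _)))))

theorem PT.passOne (E : Engine) {L : α → Level} {c : α → Bool} {u p v : α → V3}
    {P Q : α → Option Portal} (hL : PT L) (hc : PT c) (hu : PT u) (hp : PT p) (hv : PT v)
    (hP : PT P) (hQ : PT Q) :
    PT fun a => passOne E (L a) (c a) (u a) (p a) (v a) (P a) (Q a) := by
  classical
  have h₀ : PT fun x : (α × Portal) × Portal => x.1.1 := by fun_prop
  have h₁ : PT fun x : (α × Portal) × Portal => x.1.2 := by fun_prop
  have h₂ : PT fun x : (α × Portal) × Portal => x.2 := by fun_prop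
  have h₃ : PT fun x : (α × Portal) × Portal =>
      (PortalGame.exit E (L x.1.1) (c x.1.1) x.2).map fun p' =>
        (p', (L x.1.1).clamp (PortalGame.turnVelocity x.1.2 x.2 (v x.1.1))) :=
    PT.map_option (g := fun (x : (α × Portal) × Portal) p' =>
      (p', (L x.1.1).clamp (PortalGame.turnVelocity x.1.2 x.2 (v x.1.1))))
      (PT.exit E (hL.comp h₀) (hc.comp h₀) h₂)
      (PT.prodMk .snd ((PT.clamp (hL.comp h₀) (PT.turnVelocity h₁ h₂ (hv.comp h₀))).comp .fst))
  have h₄ : PT fun x : (α × Portal) × Portal =>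
      if Enters E (c x.1.1) (u x.1.1) (p x.1.1) x.1.2 then
        (PortalGame.exit E (L x.1.1) (c x.1.1) x.2).map fun p' =>
          (p', (L x.1.1).clamp (PortalGame.turnVelocity x.1.2 x.2 (v x.1.1)))
      else Option.none :=
    PT.ite (PT.enters E (hc.comp h₀) (hu.comp h₀) (hp.comp h₀) h₁) h₃ .none
  have h₅ := PT.elim (α := α × Portal) (o := fun x => Q x.1) (f := fun _ => Option.none)
    (g := fun x Q => if Enters E (c x.1) (u x.1) (p x.1) x.2 then
        (PortalGame.exit E (L x.1) (c x.1) Q).map fun p' =>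
          (p', (L x.1).clamp (PortalGame.turnVelocity x.2 Q (v x.1)))
      else Option.none) (hQ.comp .fst) .none h₄
  refine (PT.elim (f := fun _ => Option.none) (g := fun a P => (Q a).elim Option.none fun Q =>
      if Enters E (c a) (u a) (p a) P then
        (PortalGame.exit E (L a) (c a) Q).map fun p' =>
          (p', (L a).clamp (PortalGame.turnVelocity P Q (v a)))
      else Option.none) hP .none h₅).congr fun a => ?_
  unfold PortalGame.passOne
  rcases P a with _ | P <;> rcases Q a with _ | Q <;> simp

theorem PT.pass (E : Engine) {L : α → Level} {c : α → Bool} {u p v : α → V3}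
    {bo : α → Option Portal × Option Portal} (hL : PT L) (hc : PT c) (hu : PT u) (hp : PT p)
    (hv : PT v) (hbo : PT bo) : PT fun a => pass E (L a) (c a) (u a) (p a) (v a) (bo a) :=
  (PT.passOne E hL hc hu hp hv hbo.fst' hbo.snd').or_option
    (PT.passOne E hL hc hu hp hv hbo.snd' hbo.fst')

/-! ### Motion -/

instance : Rep Motion := ⟨fun L n m => Rep.R L n (m.pos, m.vel, m.disp, m.done)⟩

theorem PT.motionMk {p v d : α → V3} {b : α → Bool} (hp : PT p) (hv : PT v) (hd : PT d)
    (hb : PT b) : PT fun a => Motion.mk (p a) (v a) (d a) (b a) :=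
  (hp.prodMk (hv.prodMk (hd.prodMk hb))).transport fun _ _ _ a ha => ⟨a, ha, fun _ h => h⟩

theorem PT.motion_fields {m : α → Motion} (hm : PT m) :
    (PT fun a => (m a).pos) ∧ (PT fun a => (m a).vel) ∧ (PT fun a => (m a).disp) ∧
      PT fun a => (m a).done := by
  have h : PT fun m : Motion => (m.pos, m.vel, m.disp, m.done) := .of_rep fun _ _ _ _ h => h
  have h' := h.comp hm
  exact ⟨h'.fst', h'.snd'.fst', h'.snd'.snd'.fst', h'.snd'.snd'.snd'⟩

theorem PT.climb (E : Engine) {L : α → Level} {c : α → Bool} {p u : α → V3} (hL : PT L)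
    (hc : PT c) (hp : PT p) (hu : PT u) : PT fun a => climb E (L a) (c a) (p a) (u a) := by
  classical
  have hup : ∀ {β : Type} [Rep β] {q : β → V3} {k : β → ℕ}, PT q → PT k →
      PT fun b => q b + (k b : ℤ) • e₃ := fun hq hk =>
    hq.add_v3 (hk.natCast.smul_v3 (.const_v3 e₃))
  refine PT.find_range (P := fun a k => Grounded E (L a) (c a) (p a) ∧
    (∀ j ≤ k, Free E (L a) (c a) (p a + (j : ℤ) • e₃)) ∧
      Free E (L a) (c a) (p a + (k : ℤ) • e₃ + u a)) ?_ (.const_nat _)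
  refine (PT.grounded E (hL.comp .fst) (hc.comp .fst) (hp.comp .fst)).and (.and ?_ ?_)
  · refine (PT.forall_lt (P := fun (x : α × ℕ) j =>
      Free E (L x.1) (c x.1) (p x.1 + (j : ℤ) • e₃)) (n := fun x => x.2 + 1) ?_
      (by fun_prop)).congr fun x => by simp
    exact PT.free E (hL.comp (by fun_prop)) (hc.comp (by fun_prop))
      (hup (hp.comp (by fun_prop)) .snd)
  · exact PT.free E (hL.comp .fst) (hc.comp .fst)
      ((hup (hp.comp .fst) .snd).add_v3 (hu.comp .fst))

theorem PT.update_zero {v : α → V3} (hv : PT v) (i : Fin 3) :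
    PT fun a => (Function.update (v a) i 0 : V3) := by
  have h : ∀ j, PT fun a => (Function.update (v a) i 0 : V3) j := fun j => by
    by_cases hj : j = i
    · subst hj; simpa using PT.const_int 0
    · simpa [Function.update_apply, hj] using hv.coord j
  exact .v3 (h 0) (h 1) (h 2)

theorem PT.single {ε : α → ℤ} (hε : PT ε) (i : Fin 3) : PT fun a => (Pi.single i (ε a) : V3) := by
  have h : ∀ j, PT fun a => (Pi.single i (ε a) : V3) j := fun j => by
    by_cases hj : j = i
    · subst hj; simpa using hε
    · simpa [Pi.single_apply, hj] using PT.const_int 0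
  exact .v3 (h 0) (h 1) (h 2)

-- A form built from `if` and `Option.elim` alone, to which the closure rules of `PT` apply.
open scoped Classical in
theorem moveAxis_eq (E : Engine) (L : Level) (c : Bool) (bo : Option Portal × Option Portal)
    (i : Fin 3) (ε : ℤ) (m : Motion) : moveAxis E L c bo i ε m =
      if m.done = true ∨ ε = 0 then m
      else if Free E L c (m.pos + Pi.single i ε) then
        ⟨m.pos + Pi.single i ε, m.vel, m.disp, m.done⟩
      else (pass E L c (Pi.single i ε) (m.pos + Pi.single i ε) m.vel bo).elim
        ((if i = 2 then none else climb E L c m.pos (Pi.single i ε)).elim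
          ⟨m.pos, Function.update m.vel i 0, Function.update m.disp i 0, m.done⟩
          fun k => ⟨m.pos + (k : ℤ) • e₃ + Pi.single i ε, m.vel, m.disp, m.done⟩)
        fun x => ⟨x.1, x.2, m.disp, true⟩ := by
  unfold moveAxis
  dsimp only
  split_ifs <;> try rfl
  all_goals
    generalize pass E L c _ _ _ _ = x
    rcases x with _ | ⟨p, v⟩
    all_goals try rfl
  simp only [Option.elim_none]
  generalize climb E L c _ _ = k
  rcases k with _ | k <;> rfl

theorem PT.moveAxis (E : Engine) {L : α → Level} {c : α → Bool}
    {bo : α → Option Portal × Option Portal} (i : Fin 3) {ε : α → ℤ} {m : α → Motion} (hL : PT L)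
    (hc : PT c) (hbo : PT bo) (hε : PT ε) (hm : PT m) :
    PT fun a => moveAxis E (L a) (c a) (bo a) i (ε a) (m a) := by
  classical
  obtain ⟨hp, hv, hd, hdone⟩ := hm.motion_fields
  have hu := hε.single i
  have hpu := hp.add_v3 hu
  have hstill := PT.motionMk hp (hv.update_zero i) (hd.update_zero i) hdone
  have hclimb : PT fun a => if i = 2 then Option.none else
      PortalGame.climb E (L a) (c a) (m a).pos (Pi.single i (ε a)) :=
    PT.ite (.const_prop _) .none (PT.climb E hL hc hp hu)
  have hup : PT fun x : α × ℕ => Motion.mk ((m x.1).pos + (x.2 : ℤ) • e₃ + Pi.single i (ε x.1))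
      (m x.1).vel (m x.1).disp (m x.1).done :=
    PT.motionMk (((hp.comp .fst).add_v3 ((PT.natCast .snd).smul_v3 (.const_v3 e₃))).add_v3
      (hu.comp .fst)) (hv.comp .fst) (hd.comp .fst) (hdone.comp .fst)
  have hthrough : PT fun x : α × (V3 × V3) => Motion.mk x.2.1 x.2.2 (m x.1).disp true :=
    PT.motionMk (by fun_prop) (by fun_prop) (hd.comp .fst) (.const_bool true)
  refine (PT.ite (hdone.bool_eq.or (hε.eq_int (.const_int 0))) hm
    (PT.ite (PT.free E hL hc hpu) (PT.motionMk hpu hv hd hdone)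
      (PT.elim (g := fun a (x : V3 × V3) => Motion.mk x.1 x.2 (m a).disp true)
        (PT.pass E hL hc hu hpu hv hbo)
        (PT.elim (g := fun a (k : ℕ) => Motion.mk ((m a).pos + (k : ℤ) • e₃ + Pi.single i (ε a))
          (m a).vel (m a).disp (m a).done) hclimb hstill hup) hthrough))).congr fun a => ?_
  rw [moveAxis_eq]

@[fun_prop]
theorem PT.part {N k : α → ℕ} {x : α → ℤ} (hN : PT N) (hk : PT k) (hx : PT x) :
    PT fun a => part (N a) (k a) (x a) := by
  unfold PortalGame.part
  fun_prop

theorem PT.subMove (E : Engine) {L : α → Level} {c : α → Bool}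
    {bo : α → Option Portal × Option Portal} {N k : α → ℕ} {m : α → Motion} (hL : PT L)
    (hc : PT c) (hbo : PT bo) (hN : PT N) (hm : PT m) (hk : PT k) :
    PT fun a => subMove E (L a) (c a) (bo a) (N a) (m a) (k a) := by
  have h₀ := PT.moveAxis E 0 hL hc hbo (hN.part hk (hm.motion_fields.2.2.1.coord 0)) hm
  have h₁ := PT.moveAxis E 1 hL hc hbo (hN.part hk (h₀.motion_fields.2.2.1.coord 1)) h₀
  exact PT.moveAxis E 2 hL hc hbo (hN.part hk (h₁.motion_fields.2.2.1.coord 2)) h₁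

/-! ### Bounds for the motion in one time step -/

/-- Bounds for the coordinates of position, velocity and displacement. -/
structure Motion.Bounded (p v d : ℕ) (m : Motion) : Prop where
  pos : ∀ i, (m.pos i).natAbs ≤ p
  vel : ∀ i, (m.vel i).natAbs ≤ v
  disp : ∀ i, (m.disp i).natAbs ≤ d

/-- A bound for the positions in front of a portal. -/
def exitBound (E : Engine) (P : Option Portal) : ℕ :=
  P.elim 0 fun P => absSum P.pos + (2 * E.halfWidth + E.standHeight + 5) * absSum P.normal +
    E.standHeight

theorem PT.exitBound (E : Engine) {P : α → Option Portal} (hP : PT P) :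
    PT fun a => exitBound E (P a) := by
  refine PT.elim hP (.const_nat 0) ?_
  have h : PT fun x : α × Portal => x.2 := .snd
  exact (h.portalPos.absSum.add_nat ((PT.const_nat _).mul_nat h.portalNormal.absSum)).add_nat
    (.const_nat _)

theorem natAbs_le_absSum (v : V3) (i : Fin 3) : (v i).natAbs ≤ absSum v := by
  have := abs_le_absSum v i
  rw [Int.abs_eq_natAbs] at this
  omega

theorem exit_bound {E : Engine} {L : Level} {c : Bool} {Q : Portal} {p : V3}
    (h : exit E L c Q = some p) (i : Fin 3) : (p i).natAbs ≤ exitBound E (some Q) := by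
  classical
  rw [exit_eq, Option.map_eq_some_iff] at h
  obtain ⟨k, hk, rfl⟩ := h
  have hk' := List.mem_range.1 (List.mem_of_find?_eq_some hk)
  have h₁ := natAbs_le_absSum Q.pos i
  have h₂ : (((k : ℤ) * Q.normal i).tdiv
      (Nat.sqrt (Q.normal ⬝ᵥ Q.normal).toNat : ℤ)).natAbs ≤
      (2 * E.halfWidth + E.standHeight + 5) * absSum Q.normal := by
    rw [Int.natAbs_tdiv, Int.natAbs_mul, Int.natAbs_natCast]
    exact (Nat.div_le_self _ _).trans (Nat.mul_le_mul hk'.le (natAbs_le_absSum _ _))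
  have h₃ : ((![0, 0, ((height E c / 2 : ℕ) : ℤ)] : V3) i).natAbs ≤ E.standHeight := by
    have : height E c ≤ E.standHeight := by
      unfold height; split_ifs; exacts [E.crouchHeight_le, le_rfl]
    fin_cases i <;> simp <;> omega
  simp only [exitPos, exitBound, Option.elim_some, Pi.sub_apply]
  omega

theorem clamp_bound (L : Level) (v : V3) (i : Fin 3) :
    (L.clamp v i).natAbs ≤ L.terminalVelocity := by
  simp only [Level.clamp]; omega

theorem pass_bound {E : Engine} {L : Level} {c : Bool} {u p v : V3}
    {bo : Option Portal × Option Portal} {x : V3 × V3} (h : pass E L c u p v bo = some x)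
    (i : Fin 3) : (x.1 i).natAbs ≤ exitBound E bo.1 + exitBound E bo.2 ∧
      (x.2 i).natAbs ≤ L.terminalVelocity := by
  classical
  have key : ∀ {P Q : Option Portal}, passOne E L c u p v P Q = some x →
      (x.1 i).natAbs ≤ exitBound E Q ∧ (x.2 i).natAbs ≤ L.terminalVelocity := by
    intro P Q h
    rcases P with _ | P <;> rcases Q with _ | Q <;> simp only [passOne, reduceCtorEq] at h
    split_ifs at h
    rw [Option.map_eq_some_iff] at h
    obtain ⟨p', hp', rfl⟩ := h
    exact ⟨exit_bound hp' i, clamp_bound _ _ _⟩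
  rw [pass, Option.or_eq_some_iff] at h
  rcases h with h | ⟨-, h⟩
  · have := key h; omega
  · have := key h; omega

/-- A displacement is only ever set to zero, and a velocity is set to zero or replaced by a clamped
one. A position shifts by `ε` and the height of a step, or jumps to an exit, which is already within
`p`. -/
theorem Motion.Bounded.moveAxis {E : Engine} {L : Level} {c : Bool}
    {bo : Option Portal × Option Portal} {i : Fin 3} {ε : ℤ} {m : Motion} {p v d e : ℕ}
    (hm : m.Bounded p v d) (hp : exitBound E bo.1 + exitBound E bo.2 ≤ p)
    (hv : L.terminalVelocity ≤ v) (hε : ε.natAbs ≤ e) :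
    (moveAxis E L c bo i ε m).Bounded (p + E.stepHeight + e) v d := by
  classical
  have hs : ∀ j, ((Pi.single i ε : V3) j).natAbs ≤ e := fun j => by
    rw [Pi.single_apply]; split_ifs <;> simp [hε]
  have hup : ∀ w : V3, (∀ j, (w j).natAbs ≤ v) → ∀ j, (Function.update w i 0 j).natAbs ≤ v :=
    fun w hw j => by rw [Function.update_apply]; split_ifs <;> simp [hw]
  have hud : ∀ j, (Function.update m.disp i 0 j).natAbs ≤ d :=
    fun j => by rw [Function.update_apply]; split_ifs <;> simp [hm.disp]
  rw [moveAxis_eq]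
  split_ifs with h₁ h₂
  · exact ⟨fun j => (hm.pos j).trans (by omega), hm.vel, hm.disp⟩
  · refine ⟨fun j => ?_, hm.vel, hm.disp⟩
    have := hs j
    have := hm.pos j
    simp only [Pi.add_apply]; omega
  all_goals
    cases hx : pass E L c (Pi.single i ε) (m.pos + Pi.single i ε) m.vel bo with
    | some x =>
      refine ⟨fun j => ?_, fun j => (pass_bound hx j).2.trans hv, hm.disp⟩
      have := (pass_bound hx j).1
      simp only [Option.elim_some]; omega
    | none => ?_
  · exact ⟨fun j => (hm.pos j).trans (by omega), hup _ hm.vel, hud⟩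
  · cases hk : climb E L c m.pos (Pi.single i ε) with
    | none => exact ⟨fun j => (hm.pos j).trans (by omega), hup _ hm.vel, hud⟩
    | some k =>
      refine ⟨fun j => ?_, hm.vel, hm.disp⟩
      have hk' := List.mem_range.1 (List.mem_of_find?_eq_some hk)
      have h₃ := hs j
      have h₄ := hm.pos j
      have h₅ : ((k : ℤ) • e₃ : V3) j = 0 ∨ ((k : ℤ) • e₃ : V3) j = k := by
        fin_cases j <;> simp [e₃]
      simp only [Option.elim_none, Option.elim_some, Pi.add_apply]
      omega

theorem natAbs_part_le (N k : ℕ) (x : ℤ) : (part N k x).natAbs ≤ x.natAbs := by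
  rw [part, Int.natAbs_mul, Int.natAbs_natCast]
  have h₁ : x.sign.natAbs ≤ 1 := by
    rcases lt_trichotomy x 0 with h | h | h
    · simp [Int.sign_eq_neg_one_of_neg h]
    · simp [h]
    · simp [Int.sign_eq_one_of_pos h]
  have h₂ : (k + 1) * x.natAbs / N - k * x.natAbs / N ≤ x.natAbs := by
    rcases Nat.eq_zero_or_pos N with rfl | hN
    · simp
    · have h₃ : (k + 1) * x.natAbs / N ≤ (k * x.natAbs + x.natAbs * N) / N :=
        Nat.div_le_div_right (by
          rw [Nat.add_mul, one_mul]
          exact Nat.add_le_add_left (Nat.le_mul_of_pos_right _ hN) _)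
      rw [Nat.add_mul_div_right _ _ hN] at h₃
      omega
  calc _ ≤ 1 * x.natAbs := Nat.mul_le_mul h₁ h₂
    _ = _ := one_mul _

theorem Motion.Bounded.subMove {E : Engine} {L : Level} {c : Bool}
    {bo : Option Portal × Option Portal} {N k : ℕ} {m : Motion} {p v d : ℕ}
    (hm : m.Bounded p v d) (hp : exitBound E bo.1 + exitBound E bo.2 ≤ p)
    (hv : L.terminalVelocity ≤ v) :
    (subMove E L c bo N m k).Bounded (p + 3 * (E.stepHeight + d)) v d := by
  have h₀ := hm.moveAxis (E := E) (bo := bo) (c := c) (i := 0) hp hv ((natAbs_part_le N k _).trans (hm.disp 0))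
  have h₁ := h₀.moveAxis (E := E) (bo := bo) (c := c) (i := 1) (by omega) hv
    ((natAbs_part_le N k _).trans (h₀.disp 1))
  have h₂ := h₁.moveAxis (E := E) (bo := bo) (c := c) (i := 2) (by omega) hv
    ((natAbs_part_le N k _).trans (h₁.disp 2))
  refine ⟨fun i => (h₂.pos i).trans (by omega), h₂.vel, h₂.disp⟩

/-- The growth per part is additive and passages through portals do not add to it, so the bound is
linear in the number of parts. -/
theorem Motion.Bounded.foldl {E : Engine} {L : Level} {c : Bool}
    {bo : Option Portal × Option Portal} {N : ℕ} {m : Motion} {p v d : ℕ}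
    (hm : m.Bounded p v d) (hp : exitBound E bo.1 + exitBound E bo.2 ≤ p)
    (hv : L.terminalVelocity ≤ v) (k : ℕ) :
    ((List.range k).foldl (PortalGame.subMove E L c bo N) m).Bounded
      (p + k * (3 * (E.stepHeight + d))) v d := by
  induction k with
  | zero => simpa using hm
  | succ k ih =>
    rw [List.range_succ, List.foldl_append]
    have := ih.subMove (E := E) (bo := bo) (c := c) (N := N) (k := k) (by omega) hv
    exact ⟨fun i => (this.pos i).trans (le_of_eq (by ring)), this.vel, this.disp⟩

/-! ### Computability of a whole time step -/

theorem PolyBdd.v3 {f : α → V3} {g : α → ℕ} (hg : PolyBdd g) (h : ∀ a i, (f a i).natAbs ≤ g a) :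
    PolyBdd f :=
  (PolyBdd.int hg fun a => h a 0).prodMk ((PolyBdd.int hg fun a => h a 1).prodMk
    (PolyBdd.int hg fun a => h a 2))

theorem PolyBdd.bool (f : α → Bool) : PolyBdd f :=
  PolyBdd.of_code_le (g := fun _ => 1) (PT.const_nat 1).polyBdd fun _ a m hm => by
    rw [show m = (f a).toNat from hm]; cases f a <;> simp

theorem PolyBdd.motion {f : α → Motion} {p v d : α → ℕ} (hp : PolyBdd p) (hv : PolyBdd v)
    (hd : PolyBdd d) (h : ∀ a, (f a).Bounded (p a) (v a) (d a)) : PolyBdd f :=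
  (PolyBdd.v3 hp fun a => (h a).pos).prodMk ((PolyBdd.v3 hv fun a => (h a).vel).prodMk
    ((PolyBdd.v3 hd fun a => (h a).disp).prodMk (PolyBdd.bool fun a => (f a).done)))

/-- The parts of the motion are iterated by `PT.rec`, for which `Motion.Bounded.foldl` supplies the
bound on all intermediate motions. There are as many parts as the largest displacement, which is
affordable because time is measured by values. -/
theorem PT.travel (E : Engine) {L : α → Level} {c : α → Bool}
    {bo : α → Option Portal × Option Portal} {m : α → Motion} (hL : PT L) (hc : PT c)
    (hbo : PT bo) (hm : PT m) : PT fun a => travel E (L a) (c a) (bo a) (m a) := by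
  obtain ⟨hp, hv, hd, -⟩ := hm.motion_fields
  have hN := (hd.coord 0).natAbs.max_nat ((hd.coord 1).natAbs.max_nat (hd.coord 2).natAbs)
  obtain ⟨N, hN, hNeq⟩ : ∃ N : α → ℕ, PT N ∧ ∀ a, N a = max ((m a).disp 0).natAbs
    (max ((m a).disp 1).natAbs ((m a).disp 2).natAbs) := ⟨_, hN, fun _ => rfl⟩
  have h : PT fun x : α × ℕ => (List.range x.2).foldl
      (PortalGame.subMove E (L x.1) (c x.1) (bo x.1) (N x.1)) (m x.1) := by
    refine PT.rec (body := fun x => PortalGame.subMove E (L x.1.1) (c x.1.1) (bo x.1.1) (N x.1.1)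
      x.2 x.1.2) hm (PT.subMove E (hL.comp (by fun_prop)) (hc.comp (by fun_prop))
        (hbo.comp (by fun_prop)) (hN.comp (by fun_prop)) .snd (by fun_prop)) ?_ (fun a => rfl)
        fun a k => by simp only [List.range_succ, List.foldl_append, List.foldl_cons,
          List.foldl_nil]
    have h₁ : PT fun a => PortalGame.absSum (m a).pos + (PortalGame.exitBound E (bo a).1 +
        PortalGame.exitBound E (bo a).2) :=
      hp.absSum.add_nat ((PT.exitBound E hbo.fst').add_nat (PT.exitBound E hbo.snd'))
    have h₂ : PT fun a => PortalGame.absSum (m a).vel + (L a).terminalVelocity :=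
      hv.absSum.add_nat hL.terminalVelocity
    have h₃ : PT fun a => PortalGame.absSum (m a).disp := hd.absSum
    refine PolyBdd.motion ((h₁.comp .fst).add_nat (PT.mul_nat .snd ((PT.const_nat 3).mul_nat
      ((PT.const_nat E.stepHeight).add_nat (h₃.comp .fst))))).polyBdd (h₂.comp .fst).polyBdd
      (h₃.comp .fst).polyBdd fun x => Motion.Bounded.foldl
        ⟨fun i => ?_, fun i => ?_, fun i => natAbs_le_absSum _ _⟩ ?_ ?_ _
    · have := natAbs_le_absSum (m x.1).pos i; omega
    · have := natAbs_le_absSum (m x.1).vel i; omega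
    · omega
    · omega
  refine (h.comp (PT.id.prodMk hN)).congr fun a => ?_
  simp only [PortalGame.travel, hNeq]

theorem PT.wish (E : Engine) (speed : ℕ) {inp : α → Input E} (h : PT inp) :
    PT fun a => wish E speed (inp a) :=
  (PT.of_input (f := fun i => PortalGame.wish E speed i) fun _ => .const_v3 _).comp h

/-! ### States -/

theorem PT.const_fin {n : ℕ} (k : Fin n) : PT fun _ : α => k :=
  (PT.const_nat (k : ℕ)).transport fun _ _ _ a ha => ⟨a, ha, fun _ h => h⟩

theorem PT.cursor {E : Engine} {inp : α → Input E} (h : PT inp) : PT fun a => (inp a).cursor :=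
  (PT.of_input (f := fun i => i.cursor) fun i => (PT.const_fin i.cursor.1).prodMk
    (PT.const_fin i.cursor.2)).comp h

instance (E : Engine) : Rep (State E) :=
  ⟨fun L n s => Rep.R L n (s.pos, s.vel, s.crouched, s.blue, s.orange, s.orientation)⟩

theorem PT.state_fields {E : Engine} {s : α → State E} (hs : PT s) :
    (PT fun a => (s a).pos) ∧ (PT fun a => (s a).vel) ∧ (PT fun a => (s a).crouched) ∧
      (PT fun a => (s a).blue) ∧ PT fun a => (s a).orange := by
  have h : PT fun s : State E => (s.pos, s.vel, s.crouched, s.blue, s.orange, s.orientation) :=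
    .of_rep fun _ _ _ _ h => h
  have h' := h.comp hs
  exact ⟨h'.fst', h'.snd'.fst', h'.snd'.snd'.fst', h'.snd'.snd'.snd'.fst',
    h'.snd'.snd'.snd'.snd'.fst'⟩

theorem PT.stateMk {E : Engine} {p v : α → V3} {o : α → Orientation E} {c : α → Bool}
    {b r : α → Option Portal} (hp : PT p) (hv : PT v) (ho : PT o) (hc : PT c) (hb : PT b)
    (hr : PT r) : PT fun a => State.mk (p a) (v a) (o a) (c a) (b a) (r a) :=
  (hp.prodMk (hv.prodMk (hc.prodMk (hb.prodMk (hr.prodMk ho))))).transport fun _ _ _ a ha =>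
    ⟨a, ha, fun _ h => h⟩

theorem PT.next (E : Engine) {L : α → Level} {s : α → State E} {inp : α → Input E} (hL : PT L)
    (hs : PT s) (hi : PT inp) : PT fun a => next E (L a) (s a) (inp a) := by
  classical
  obtain ⟨hp, hv, -, hb, ho⟩ := hs.state_fields
  have hjump : PT fun a => (inp a).jump = true :=
    PT.of_input_prop (fun i => i.jump = true) hi
  have hcr : PT fun a => (inp a).crouch || !Decidable.decide (Free E (L a) false (s a).pos) :=
    PT.bor ((PT.of_input (f := fun i : Input E => i.crouch) fun _ => .const_bool _).comp hi)
      (PT.free E hL (.const_bool false) hp).decide.bnot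
  have hbo := PT.shoot E hL (hp.add_v3 ((hcr.eyeHeight E).natCast.smul_v3 (.const_v3 e₃))) hi
    (hb.prodMk ho)
  have hfall := hv.sub_v3 ((PT.const_int (E.gravity : ℤ)).smul_v3 (.const_v3 e₃))
  have hrun := hi.wish E E.runSpeed
  have hv₁ := PT.clamp hL (PT.vec (hrun.coord 0) (hrun.coord 1)
    (PT.ite hjump (.const_int (E.jumpSpeed : ℤ)) (hfall.coord 2)))
  have hf₁ := PT.clamp hL hfall
  have hvd := PT.ite (PT.grounded E hL hcr hp) (hv₁.prodMk hv₁)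
    (hf₁.prodMk (PT.clamp hL (hf₁.add_v3 (hi.wish E E.airSpeed))))
  have hm := PT.travel E hL hcr hbo (PT.motionMk hp hvd.fst' hvd.snd' (.const_bool false))
  exact PT.stateMk hm.motion_fields.1 hm.motion_fields.2.1 (PT.cursor hi) hcr hbo.fst' hbo.snd'

end PortalGame

namespace PortalGame

open RAM

variable {α β γ δ : Type} [Rep α] [Rep β] [Rep γ] [Rep δ]

/-! ## Searching the reachable states -/

/-- The sets of codes that arise from a code of `start` when, for `q = 0, 1, 2, …`, a code of
`f x q` is inserted if the code `src q` is already present and represents `x`. -/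
inductive Marks {σ : Type} [Rep σ] (L : Level) (start : σ) (src : ℕ → ℕ) (f : σ → ℕ → σ) :
    ℕ → Set ℕ → Prop
  | init {n : ℕ} : Rep.R L n start → Marks L start src f 0 {n}
  | skip {q : ℕ} {M : Set ℕ} : Marks L start src f q M → src q ∉ M → Marks L start src f (q + 1) M
  | mark {q m : ℕ} {M : Set ℕ} {x : σ} : Marks L start src f q M → src q ∈ M →
      Rep.R L (src q) x → Rep.R L m (f x q) → Marks L start src f (q + 1) (insert m M)

theorem Marks.exists_rep {σ : Type} [Rep σ] {L : Level} {start : σ} {src : ℕ → ℕ}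
    {f : σ → ℕ → σ} {q : ℕ} {M : Set ℕ} (h : Marks L start src f q M) {n : ℕ} (hn : n ∈ M) :
    ∃ x : σ, Rep.R L n x := by
  induction h with
  | init h => exact ⟨_, (Set.mem_singleton_iff.1 hn) ▸ h⟩
  | skip _ _ ih => exact ih hn
  | mark _ _ _ hm ih =>
    rcases hn with rfl | hn
    exacts [⟨_, hm⟩, ih hn]

/-- Register `1` counts the rounds left, register `2` is the round `q`, and the code `s` has its
mark in the cell `L.encode.length + s`. The marks lie behind the input, which therefore stays loaded
for the subroutines. `Marks` is a relation because an object may have several codes, and which of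
them a program returns is unspecified; the hypothesis covers every outcome. -/
theorem solvable_of_marks {σ : Type} [Rep σ] {T : Level → ℕ} {start : Level → σ}
    {src : Level × ℕ → ℕ} {f : (Level × σ) × ℕ → σ} (hT : PT T) (hstart : PT start)
    (hsrc : PT src) (hf : PT f) {P : Level → Prop}
    (h : ∀ L : Level, L.WellFormed → ∀ M, Marks L (start L) (fun q => src (L, q))
      (fun x q => f ((L, x), q)) (T L) M → (P L ↔ 0 ∈ M)) :
    SolvableInPseudopolynomialTime Level.encode Level.WellFormed P := by
  obtain ⟨cT, i, hcT⟩ := hT 1 le_rfl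
  obtain ⟨cs, j, hcs⟩ := hstart 2 (by omega)
  obtain ⟨c₁, k, hc₁⟩ := hsrc 4 (by omega)
  obtain ⟨c₂, l, hc₂⟩ := hf 6 (by omega)
  have hb : PolyBound fun N => (N + (N ^ i + 1) ^ 2) ^ k :=
    .pow (.add .id (.pow (.add (.pow .id _) (.const _)) _)) _
  have hu : PolyBound fun N => (((N + (N ^ i + 1) ^ 2) ^ k + 1) ^ 2 + N ^ i + 1) ^ 2 :=
    .pow (.add (.add (.pow (.add hb (.const _)) _) (.pow .id _)) (.const _)) _
  obtain ⟨K, hK⟩ : PolyBound fun N => 10 + N ^ i + N ^ j + N ^ i * (60 + 8 * N ^ i +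
      9 * (N + (N ^ i + 1) ^ 2) ^ k + 4 * ((N + (N ^ i + 1) ^ 2) ^ k + 1) ^ 2 +
      (N + (((N + (N ^ i + 1) ^ 2) ^ k + 1) ^ 2 + N ^ i + 1) ^ 2) ^ l) :=
    .add (.add (.add (.const _) (.pow .id _)) (.pow .id _)) (.mul (.pow .id _)
      (.add (.add (.add (.add (.const 60) (.mul (.const _) (.pow .id _)))
        (.mul (.const _) hb)) (.mul (.const _) (.pow (.add hb (.const _)) _)))
          (.pow (.add .id hu) _)))
  refine ⟨.seq cT (.seq (.const 2 0) (.seq cs (.seq (.add 2 2 0) (.seq (.const 3 1) (.seq (.store 2 3)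
    (.seq (.const 2 0) (.seq (.loop 1
      (.seq (.const 3 0) (.seq (pairProg 3 2 4) (.seq c₁ (.seq (.add 5 4 0) (.seq (.load 5 5)
        (.seq (.cond 5 (.seq (pairProg 3 4 5) (.seq (pairProg 5 2 6) (.seq c₂ (.seq (.add 6 6 0)
          (.seq (.const 7 1) (.store 6 7)))))) (.const 5 0))
          (.seq (.const 3 1) (.seq (.add 2 2 3) (.sub 1 1 3)))))))))) (.load 0 0)))))))),
    (.X + .C 2) ^ K, fun L hL => ?_⟩
  have hKL := hK (levelSize L + 2) (by omega)
  beta_reduce at hKL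
  clear hb hu
  set N := levelSize L + 2 with hN
  have hP := h L hL
  -- In turn: `t₁` bounds the time and the value of `src`, `u` the code of the argument of `f`, `t₂`
  -- the time of `f`, and `B` the time of one round.
  set t₁ := (N + (N ^ i + 1) ^ 2) ^ k with ht₁
  set u := ((t₁ + 1) ^ 2 + N ^ i + 1) ^ 2 with hu
  set t₂ := (N + u) ^ l with ht₂
  set w := (t₁ + 1) ^ 2 with hw
  set B := 1 + (4 * N ^ i + 10 + (t₁ + (1 + (1 + ((4 * t₁ + 10 + (4 * (w + N ^ i) + 10 +
    (t₂ + (1 + (1 + 1)))) + 1) + (1 + (1 + 1))))))) with hB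
  suffices hr : Runs _ (RAM.init L.encode) (N ^ i + (1 + (N ^ j + (1 + (1 + (1 + (1 + (N ^ i *
      (B + 1) + 1 + 1))))))))
      fun τ => ∃ M, Marks L (start L) (fun q => src (L, q)) (fun x q => f ((L, x), q)) (T L) M ∧
        (τ.reg 0 ≠ 0 ↔ 0 ∈ M) by
    obtain ⟨t, τ, g₁, g₂, M, g₃, g₄⟩ := hr
    refine ⟨t, τ, g₁, ?_, by rw [g₄, hP M g₃]⟩
    simp only [Polynomial.eval_pow, Polynomial.eval_add, Polynomial.eval_X, Polynomial.eval_C]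
    refine g₂.trans (le_trans ?_ hKL)
    have := Nat.mul_le_mul_left (N ^ i) (show B + 1 ≤ 60 + 8 * N ^ i + 9 * t₁ + 4 * w + t₂ by
      omega)
    omega
  have hload : Loaded L (RAM.init L.encode) := ⟨rfl, fun _ _ => rfl⟩
  refine Runs.seq ((hcT L hL 0 L rfl _ hload rfl).mono le_rfl ?_)
  rintro τ ⟨h₁, h₂, h₃⟩
  replace h₃ : τ.reg 1 = T L := h₃
  have hτ : Keeps 2 τ { τ with reg := Function.update τ.reg 2 0 } := (Keeps.refl _ _).update
  refine Runs.seq (runs_const (Runs.seq ((hcs L hL 0 L rfl _ ((hload.keeps h₁).keeps hτ)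
    (by simp)).mono le_rfl ?_)))
  rintro υ ⟨h₄, -, h₅⟩
  replace h₄ := hτ.trans h₄
  have hυ : Keeps 1 (RAM.init L.encode) υ := h₁.trans h₄
  have hlυ := hload.keeps hυ
  have h₆ : υ.reg 1 = T L := (h₄.2 1 (by omega)).trans h₃
  have h₇ : T L ≤ N ^ i := h₃ ▸ h₂
  refine Runs.seq (runs_add (Runs.seq (runs_const (Runs.seq (runs_store (Runs.seq (runs_const
    (Runs.seq ?_))))))))
  -- No initialisation of the marks is needed, since the memory behind the input starts at `0`.
  refine Runs.mono (runs_loop (fun q ω => Loaded L ω ∧ ω.reg 1 = q ∧ ω.reg 2 + q = T L ∧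
    ∃ M, Marks L (start L) (fun q => src (L, q)) (fun x q => f ((L, x), q)) (ω.reg 2) M ∧
      ∀ s, ω.mem (L.encode.length + s) ≠ 0 ↔ s ∈ M) B ?_ ?_ (T L) _ ?_) ?_ ?_
  · exact fun ω h => h.2.1
  · rintro q ω ⟨g₁, g₂, g₃, M, hM, g₄⟩
    refine ⟨by omega, ?_⟩
    have hcp : cpair 0 (ω.reg 2) ≤ (N ^ i + 1) ^ 2 :=
      (cpair_le _ _).trans (Nat.pow_le_pow_left (by omega) 2)
    -- The `0` put into register `3` serves as the code of the level, here and in the argument of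
    -- `f`.
    refine Runs.seq (runs_const (Runs.seq ?_))
    refine (runs_pairProg (by omega) _).mono ?_ ?_
    · simp; omega
    rintro ω₁ ⟨u₁, u₂⟩
    simp at u₂
    have v₁ : Keeps 3 ω ω₁ := (Keeps.refl 3 ω).update.trans u₁
    have v₂ : ω₁.reg 3 = 0 := by simpa using u₁.2 3 (by omega)
    have ht : (levelSize L + cpair 0 (ω.reg 2) + 2) ^ k ≤ t₁ :=
      Nat.pow_le_pow_left (by omega) k
    refine Runs.seq ((hc₁ L hL _ (L, ω.reg 2) ⟨0, _, u₂, rfl, rfl⟩ ω₁ (g₁.keeps v₁) rfl).mono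
      (by rwa [u₂]) ?_)
    rintro ω₂ ⟨u₃, u₄, u₅⟩
    replace u₅ : ω₂.reg 4 = src (L, ω.reg 2) := u₅
    rw [u₂] at u₄
    have u₆ := u₅ ▸ u₄.trans ht
    have v₃ : Keeps 3 ω ω₂ := v₁.trans u₃
    have v₄ : ω₂.reg 3 = 0 := (u₃.2 3 (by omega)).trans v₂
    have v₅ := v₃.2 2 (by omega)
    have v₆ := v₃.2 1 (by omega)
    have v₇ := g₁.keeps v₃
    have v₈ : ω₂.reg 0 = _ := v₇.1
    refine Runs.seq (runs_add (Runs.seq (runs_load (Runs.seq (runs_cond (fun hx => ?_)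
      (fun hx => ?_))))))
    · simp [u₅, v₈, v₃.1, add_comm _ L.encode.length] at hx
      rw [← ne_eq, g₄] at hx
      obtain ⟨x, hx'⟩ := hM.exists_rep hx
      refine Runs.seq ((runs_pairProg (by omega) _).mono ?_ ?_)
      · simp [v₄, u₅]; omega
      rintro ω₃ ⟨w₁, w₂⟩
      simp [v₄, u₅] at w₂
      have x₁ : Keeps 3 ω ω₃ := v₃.trans ((Keeps.refl 3 ω₂).update.update.trans w₁)
      have x₂ := x₁.2 2 (by omega)
      have hw' : cpair 0 (src (L, ω.reg 2)) ≤ w :=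
        (cpair_le _ _).trans (Nat.pow_le_pow_left (by omega) 2)
      have hu' : cpair (cpair 0 (src (L, ω.reg 2))) (ω.reg 2) ≤ u :=
        (cpair_le _ _).trans (Nat.pow_le_pow_left (by omega) 2)
      refine Runs.seq ((runs_pairProg (by omega) _).mono ?_ ?_)
      · simp only [w₂, x₂]; omega
      rintro ω₃' ⟨y₁, y₂⟩
      rw [w₂, x₂] at y₂
      have z₁ : Keeps 3 ω ω₃' := x₁.trans y₁
      refine Runs.seq ((hc₂ L hL _ ((L, x), ω.reg 2) ⟨_, _, y₂, ⟨0, _, rfl, rfl, hx'⟩, rfl⟩ ω₃'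
        (g₁.keeps z₁) rfl).mono (Nat.pow_le_pow_left (by omega) l) ?_)
      rintro ω₄ ⟨w₃, -, w₅⟩
      have x₃ : Keeps 3 ω ω₄ := z₁.trans w₃
      have x₅ := x₃.2 2 (by omega)
      have x₆ := x₃.2 1 (by omega)
      have x₇ := g₁.keeps x₃
      have x₈ : ω₄.reg 0 = _ := x₇.1
      refine Runs.seq (runs_add (Runs.seq (runs_const (runs_store (Runs.seq (runs_const
        (Runs.seq (runs_add (runs_sub ?_)))))))))
      refine ⟨⟨?_, fun s hs => ?_⟩, ?_, ?_, insert (ω₄.reg 6) M, ?_, fun s => ?_⟩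
      · simp [x₈]
      · have : s ≠ ω₄.reg 6 + L.encode.length := by omega
        simpa [Function.update_apply, x₈, this] using x₇.2 s hs
      · simp [x₆, g₂]
      · simp [x₅]; omega
      · simpa [x₅] using hM.mark hx hx' w₅
      · have h₁ := g₄ s
        by_cases hst : s = ω₄.reg 6
        · simp [x₈, hst, add_comm _ L.encode.length]
        · simpa [Function.update_apply, x₈, hst, add_comm _ L.encode.length, x₃.1] using h₁
    · simp [u₅, v₈, v₃.1, add_comm _ L.encode.length] at hx
      have hx' : src (L, ω.reg 2) ∉ M := fun hc => (g₄ _).2 hc hx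
      refine (runs_const (Runs.seq (runs_const (Runs.seq (runs_add (runs_sub ?_)))))).mono
        (by omega) (fun _ h => h)
      refine ⟨⟨?_, fun s hs => ?_⟩, ?_, ?_, M, ?_, fun s => ?_⟩
      · simp [v₈]
      · simpa using v₇.2 s hs
      · simp [v₆, g₂]
      · simp [v₅]; omega
      · simpa [v₅] using hM.skip hx'
      · simpa [v₃.1] using g₄ s
  · refine ⟨⟨?_, fun s hs => ?_⟩, ?_, ?_, {υ.reg 2}, ?_, fun s => ?_⟩
    · simp [hlυ.1]
    · have : s ≠ L.encode.length + υ.reg 2 := by omega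
      simpa [Function.update_apply, hlυ.1, add_comm (υ.reg 2), this] using hlυ.2 s hs
    · simp [h₆]
    · simp
    · simpa using Marks.init h₅
    · have h₀ : υ.mem (L.encode.length + s) = 0 := by rw [hυ.1]; simp [RAM.init]
      by_cases hst : s = υ.reg 2
      · simp [hst, hlυ.1, add_comm]
      · simp [hst, hlυ.1, add_comm (υ.reg 2), h₀]
  · exact Nat.add_le_add_right (Nat.mul_le_mul_right (B + 1) h₇) 1
  · rintro ω ⟨g₁, g₂, g₃, M, hM, g₄⟩
    rw [add_zero] at g₃
    rw [g₃] at hM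
    -- Register `0` still holds the length of the input, so it is itself the address of the mark of
    -- code `0`.
    refine runs_load ⟨M, hM, ?_⟩
    have := g₄ 0
    rw [add_zero] at this
    simpa [g₁.1] using this

end PortalGame

namespace PortalGame

variable {α β γ δ : Type} [Rep α] [Rep β] [Rep γ] [Rep δ]

/-- A number is a code of at most one object. -/
class RepInj (α : Type) [Rep α] : Prop where
  inj : ∀ {L : Level} {n : ℕ} {a b : α}, Rep.R L n a → Rep.R L n b → a = b

/-! ### Soundness and completeness of the marking process -/

section Search

variable {σ : Type} [Rep σ] {L : Level} {start : σ} {f : σ → ℕ → σ} {S K : ℕ}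

theorem Marks.exists_start {src : ℕ → ℕ} {q : ℕ} {M : Set ℕ} (h : Marks L start src f q M) :
    ∃ n ∈ M, Rep.R L n start := by
  induction h with
  | init h => exact ⟨_, rfl, h⟩
  | skip _ _ ih => exact ih
  | mark _ _ _ _ ih =>
    obtain ⟨n, hn, h⟩ := ih
    exact ⟨n, Or.inr hn, h⟩

/-- Marks are never removed, so whatever is marked at the beginning of a stretch of `j` rounds is
treated when its turn comes, and the result is present at the end. Injectivity of codes ensures that
the treated object is the intended one. -/
theorem Marks.split {src : ℕ → ℕ} {q j : ℕ} {M : Set ℕ} (h : Marks L start src f (q + j) M)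
    [RepInj σ] : ∃ M₀ ⊆ M, Marks L start src f q M₀ ∧ ∀ i < j, src (q + i) ∈ M₀ →
      ∀ x, Rep.R L (src (q + i)) x → ∃ m ∈ M, Rep.R L m (f x (q + i)) := by
  induction j generalizing M with
  | zero => exact ⟨M, subset_rfl, h, fun i hi => absurd hi (by omega)⟩
  | succ j ih =>
    rw [← add_assoc] at h
    cases h with
    | skip h hs =>
      obtain ⟨M₀, h₁, h₂, h₃⟩ := ih h
      refine ⟨M₀, h₁, h₂, fun i hi hm x hx => ?_⟩
      rcases Nat.lt_succ_iff_lt_or_eq.1 hi with hi | rfl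
      exacts [h₃ i hi hm x hx, absurd (h₁ hm) hs]
    | @mark _ m M x h hs hx hm =>
      obtain ⟨M₀, h₁, h₂, h₃⟩ := ih h
      refine ⟨M₀, h₁.trans (Set.subset_insert _ _), h₂, fun i hi hm' y hy => ?_⟩
      rcases Nat.lt_succ_iff_lt_or_eq.1 hi with hi | rfl
      · obtain ⟨m', h₄, h₅⟩ := h₃ i hi hm' y hy
        exact ⟨m', Or.inr h₄, h₅⟩
      · obtain rfl := RepInj.inj hx hy
        exact ⟨m, Or.inl rfl, hm⟩

/-- The objects that arise from `start` by applying `f` with parameters less than `K`. -/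
def Reachable (start : σ) (f : σ → ℕ → σ) (K : ℕ) (x : σ) : Prop :=
  Relation.ReflTransGen (fun x y => ∃ k < K, f x k = y) start x

theorem Marks.reachable {src : ℕ → ℕ} {q : ℕ} {M : Set ℕ} (hK : 0 < K)
    (h : Marks L start src (fun x q => f x (q % K)) q M) [RepInj σ] {n : ℕ} (hn : n ∈ M) :
    ∃ x : σ, Rep.R L n x ∧ Reachable start f K x := by
  induction h generalizing n with
  | init h => exact ⟨start, (Set.mem_singleton_iff.1 hn) ▸ h, .refl⟩
  | skip _ _ ih => exact ih hn
  | @mark q _ _ _ _ hs hx hm ih =>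
    rcases hn with rfl | hn
    · obtain ⟨y, h₁, h₂⟩ := ih hs
      obtain rfl := RepInj.inj h₁ hx
      exact ⟨_, hm, h₂.tail ⟨q % K, Nat.mod_lt _ hK, rfl⟩⟩
    · exact ih hn

/-- A pass of `S * K` rounds tries every code below `S` with every parameter below `K`. If it marks
nothing new, the marked set represents everything reachable, being closed and containing the start;
otherwise it has grown by at least one. The count begins at one because of the start. -/
theorem Marks.complete_or_card [RepInj σ] (hK : 0 < K)
    (hS : ∀ x, Reachable start f K x → ∀ n, Rep.R L n x → n < S) (r : ℕ) (M : Set ℕ)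
    (h : Marks L start (fun q => q / K % S) (fun x q => f x (q % K)) (r * S * K) M) :
    (∀ x, Reachable start f K x → ∃ n ∈ M, Rep.R L n x) ∨ r + 1 ≤ M.ncard := by
  have hfin : ∀ {q : ℕ} {M : Set ℕ}, Marks L start (fun q => q / K % S)
      (fun x q => f x (q % K)) q M → M ⊆ Set.Iio S := by
    intro q M h n hn
    obtain ⟨x, h₁, h₂⟩ := h.reachable hK hn
    exact hS x h₂ n h₁
  induction r generalizing M with
  | zero =>
    obtain ⟨n, hn, -⟩ := h.exists_start
    exact Or.inr ((Set.ncard_pos ((Set.finite_Iio S).subset (hfin h))).2 ⟨n, hn⟩)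
  | succ r ih =>
    rw [show (r + 1) * S * K = r * S * K + S * K by ring] at h
    obtain ⟨M₀, h₁, h₂, h₃⟩ := h.split
    rcases ih M₀ h₂ with h₄ | h₄
    · left
      intro x hx
      obtain ⟨n, hn, hnx⟩ := h₄ x hx
      exact ⟨n, h₁ hn, hnx⟩
    · by_cases heq : M₀ = M
      · subst heq
        left
        intro x hx
        induction hx with
        | refl => exact h.exists_start
        | @tail x y hx hxy ihx =>
          obtain ⟨n, hn, hnx⟩ := ihx
          obtain ⟨k, hk, rfl⟩ := hxy
          have hnS := hS x hx n hnx
          have hlt : n * K + k < S * K := by nlinarith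
          -- Round `n * K + k` of a pass treats the code `n` with the parameter `k`; the completed
          -- passes vanish modulo `S` and modulo `K`.
          have hdiv : (r * S * K + (n * K + k)) / K % S = n := by
            rw [show r * S * K + (n * K + k) = k + K * (n + S * r) by ring,
              Nat.add_mul_div_left _ _ hK, Nat.div_eq_of_lt hk, zero_add, Nat.add_mul_mod_self_left,
              Nat.mod_eq_of_lt hnS]
          have hmod : (r * S * K + (n * K + k)) % K = k := by
            rw [show r * S * K + (n * K + k) = k + K * (n + S * r) by ring,
              Nat.add_mul_mod_self_left, Nat.mod_eq_of_lt hk]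
          have := h₃ (n * K + k) hlt (by simpa only [hdiv] using hn) x
            (by simpa only [hdiv] using hnx)
          simpa only [hmod] using this
      · right
        have := Set.ncard_lt_ncard (h₁.ssubset_of_ne heq) ((Set.finite_Iio S).subset (hfin h))
        omega

end Search

/-- All marked codes are below `S L`, so after `S L` passes the alternative of having more than `S
L` marks is impossible and the search is complete. Since `0` codes `none` and nothing else, its mark
gives the answer. -/
theorem solvable_of_reachable {σ : Type} [Rep σ] [RepInj (Option σ)] {S : Level → ℕ} {start : Level → Option σ}
    {f : (Level × Option σ) × ℕ → Option σ} {K : ℕ} (hK : 0 < K) (hS : PT S) (hstart : PT start) (hf : PT f)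
    (hcode : ∀ L : Level, L.WellFormed → ∀ x,
      Reachable (start L) (fun x k => f ((L, x), k)) K x → ∀ n, Rep.R L n x → n < S L)
    {P : Level → Prop} (hP : ∀ L : Level, L.WellFormed → (P L ↔
      Reachable (start L) (fun x k => f ((L, x), k)) K none)) :
    SolvableInPseudopolynomialTime Level.encode Level.WellFormed P := by
  refine solvable_of_marks (T := fun L => S L * S L * K) (src := fun x => x.2 / K % S x.1)
    (f := fun x => f (x.1, x.2 % K)) ((hS.mul_nat hS).mul_nat (.const_nat K)) hstart
    ((PT.div_nat .snd (.const_nat K)).mod_nat (hS.comp .fst))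
    (hf.comp (f := fun x : (Level × Option σ) × ℕ => (x.1, x.2 % K))
      (PT.fst.prodMk (PT.mod_nat .snd (.const_nat K)))) fun L hL M hM => ?_
  have hsub : M ⊆ Set.Iio (S L) := fun n hn => by
    obtain ⟨x, h₁, h₂⟩ := Marks.reachable (f := fun x k => f ((L, x), k)) hK hM hn
    exact hcode L hL x h₂ n h₁
  have hcomplete := (Marks.complete_or_card (f := fun x k => f ((L, x), k)) hK (hcode L hL) (S L) M
    hM).resolve_right fun h => by
      have := Set.ncard_le_ncard hsub (Set.finite_Iio _)
      rw [Set.ncard_Iio_nat] at this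
      omega
  rw [hP L hL]
  constructor
  · intro hx
    obtain ⟨n, hn, rfl⟩ := hcomplete none hx
    exact hn
  · intro h₀
    obtain ⟨x, h₁, h₂⟩ := Marks.reachable (f := fun x k => f ((L, x), k)) hK hM h₀
    obtain rfl : x = none := RepInj.inj h₁ (show Rep.R L 0 (none : Option σ) from rfl)
    exact h₂

/-! ### Codes determine objects -/

instance : RepInj ℤ := ⟨fun ha hb => by
  have h := cpair_inj (Eq.trans (Eq.symm ha) hb)
  omega⟩

instance [RepInj α] [RepInj β] : RepInj (α × β) := ⟨by
  rintro L n ⟨a, b⟩ ⟨a', b'⟩ ⟨p, q, h, h₁, h₂⟩ ⟨p', q', h', h₃, h₄⟩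
  obtain ⟨rfl, rfl⟩ := cpair_inj (h.symm.trans h')
  exact Prod.ext (RepInj.inj h₁ h₃) (RepInj.inj h₂ h₄)⟩

instance [RepInj α] : RepInj (Option α) := ⟨by
  rintro L n (_ | a) (_ | b) ha hb
  · rfl
  · obtain ⟨m, hm, -⟩ := hb
    have : n = 0 := ha
    omega
  · obtain ⟨m, hm, -⟩ := ha
    have : n = 0 := hb
    omega
  · obtain ⟨m, rfl, ha⟩ := ha
    obtain ⟨m', hm, hb⟩ := hb
    obtain rfl : m = m' := by omega
    exact congrArg some (RepInj.inj ha hb)⟩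

instance : RepInj Bool := ⟨by
  rintro L n (_ | _) (_ | _) ha hb
  all_goals first | rfl | exact absurd (Eq.trans (Eq.symm ha) hb) (by decide)⟩

instance (k : ℕ) : RepInj (Fin k) := ⟨fun ha hb => Fin.ext (Eq.trans (Eq.symm ha) hb)⟩

instance : RepInj Surface :=
  ⟨fun ha hb => Option.some_inj.1 (Eq.trans (Eq.symm ha) hb)⟩

instance : RepInj (Fin 3 → ℤ) := ⟨fun {L n a b} ha hb => by
  have h := RepInj.inj (L := L) (n := n) (a := (a 0, a 1, a 2)) (b := (b 0, b 1, b 2)) ha hb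
  simp only [Prod.mk.injEq] at h
  ext i
  fin_cases i
  exacts [h.1, h.2.1, h.2.2]⟩

instance : RepInj Portal := ⟨by
  rintro L n ⟨s, p, m, r⟩ ⟨s', p', m', r'⟩ ha hb
  have h := RepInj.inj (L := L) (n := n) (a := (s, p, m, r)) (b := (s', p', m', r')) ha hb
  simpa using h⟩

instance (E : Engine) : RepInj (State E) := ⟨by
  rintro L n ⟨p, v, o, c, b, r⟩ ⟨p', v', o', c', b', r'⟩ ha hb
  have h := RepInj.inj (L := L) (n := n) (a := (p, v, c, b, r, o)) (b := (p', v', c', b', r', o'))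
    ha hb
  simp only [Prod.mk.injEq] at h
  obtain ⟨rfl, rfl, rfl, rfl, rfl, rfl⟩ := h
  rfl⟩

end PortalGame

namespace PortalGame

variable {α β γ δ : Type} [Rep α] [Rep β] [Rep γ] [Rep δ]

/-! ### Bounds for the codes of the reachable states -/

/-- The codes of the objects with the property `G L` are polynomially bounded. -/
def CodesBdd (G : Level → α → Prop) : Prop :=
  ∃ g : ℕ → ℕ, PolyBound g ∧ ∀ L : Level, L.WellFormed → ∀ a, G L a →
    ∀ m, Rep.R L m a → m ≤ g (levelSize L + 2)

theorem CodesBdd.prod {G : Level → α → Prop} {H : Level → β → Prop} (hG : CodesBdd G)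
    (hH : CodesBdd H) : CodesBdd fun L (x : α × β) => G L x.1 ∧ H L x.2 := by
  obtain ⟨g, hg, hG⟩ := hG
  obtain ⟨h, hh, hH⟩ := hH
  refine ⟨fun N => (g N + h N + 1) ^ 2, .pow (.add (.add hg hh) (.const 1)) 2, ?_⟩
  rintro L hL ⟨a, b⟩ ⟨h₁, h₂⟩ m ⟨p, q, rfl, hp, hq⟩
  have h₃ := hG L hL a h₁ p hp
  have h₄ := hH L hL b h₂ q hq
  exact (cpair_le p q).trans (Nat.pow_le_pow_left (by omega) 2)

theorem CodesBdd.option {G : Level → α → Prop} (hG : CodesBdd G) :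
    CodesBdd fun L (o : Option α) => ∀ a ∈ o, G L a := by
  obtain ⟨g, hg, hG⟩ := hG
  refine ⟨fun N => g N + 1, .add hg (.const 1), ?_⟩
  rintro L hL (_ | a) ho m hm
  · rw [show m = 0 from hm]; omega
  · obtain ⟨p, rfl, hp⟩ := hm
    have := hG L hL a (ho a rfl) p hp
    beta_reduce; omega

theorem CodesBdd.of_le {g : Level → ℕ} (hg : PT g) {G : Level → α → Prop}
    (h : ∀ L a, G L a → ∀ m, Rep.R L m a → m ≤ g L) : CodesBdd G := by
  obtain ⟨k, hk⟩ := hg.polyBdd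
  exact ⟨fun N => N ^ k, .pow .id k, fun L hL a ha m hm =>
    (h L a ha m hm).trans (hk L hL 0 L rfl _ rfl)⟩

theorem CodesBdd.int {g : Level → ℕ} (hg : PT g) :
    CodesBdd fun L (z : ℤ) => z.natAbs ≤ g L :=
  .of_le (g := fun L => (g L + g L + 1) ^ 2)
    (((hg.add_nat hg).add_nat (.const_nat 1)).pow_nat 2) fun L z hz m hm => by
      rw [show m = cpair z.toNat (-z).toNat from hm]
      exact (cpair_le _ _).trans (Nat.pow_le_pow_left (by omega) 2)

theorem CodesBdd.v3 {g : Level → ℕ} (hg : PT g) :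
    CodesBdd fun L (v : V3) => ∀ i, (v i).natAbs ≤ g L := by
  obtain ⟨h, h₁, h₂⟩ := (CodesBdd.int hg).prod ((CodesBdd.int hg).prod (CodesBdd.int hg))
  exact ⟨h, h₁, fun L hL v hv m hm => h₂ L hL (v 0, v 1, v 2) ⟨hv 0, hv 1, hv 2⟩ m hm⟩

theorem CodesBdd.bool : CodesBdd fun _ (_ : Bool) => True :=
  .of_le (.const_nat 1) fun L b _ m hm => by
    rw [show m = b.toNat from hm]; cases b <;> simp

theorem CodesBdd.fin (n : ℕ) : CodesBdd fun _ (_ : Fin n) => True :=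
  .of_le (.const_nat n) fun L k _ m hm => by
    rw [show m = (k : ℕ) from hm]; exact k.2.le

theorem CodesBdd.surface : CodesBdd fun _ (_ : Surface) => True :=
  .of_le (PT.id (α := Level)).numSurfaces fun L s _ m hm =>
    (List.getElem?_eq_some_iff.1 (show L.surfaces[m]? = some s from hm)).1.le

/-! ### Size bounds in terms of the input numbers -/

/-- The sum of the numbers that describe the level. -/
def inputSum (L : Level) : ℕ := ∑ i ∈ Finset.range L.encode.length, L.encode.getD i 0

theorem PT.inputSum : PT inputSum :=
  PT.sum_range (f := fun (L : Level) i => L.encode.getD i 0) PT.inputGet PT.inputLength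

theorem getD_le_inputSum (L : Level) (i : ℕ) : L.encode.getD i 0 ≤ inputSum L := by
  by_cases hi : i < L.encode.length
  · exact Finset.single_le_sum (f := fun i => L.encode.getD i 0) (fun _ _ => Nat.zero_le _)
      (Finset.mem_range.2 hi)
  · simp [List.getElem?_eq_none (not_lt.1 hi)]

/-- The machine must compute the bound for the codes by itself. The sum of the input numbers is
easily computed and may replace their maximum. -/
theorem levelSize_le (L : Level) : levelSize L ≤ L.encode.length + inputSum L := by
  have h : ∀ l : List ℕ, ∀ m, (∀ i, l.getD i 0 ≤ m) → l.foldr max 0 ≤ m := by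
    intro l m h
    induction l with
    | nil => simp
    | cons a l ih =>
      have h₀ := h 0
      have h₁ := ih fun i => by simpa using h (i + 1)
      simp at h₀
      simp [h₀, h₁]
  exact Nat.add_le_add_left (h _ _ (getD_le_inputSum L)) _

theorem terminalVelocity_le (L : Level) : L.terminalVelocity ≤ inputSum L :=
  getD_le_inputSum L 0

theorem bound_le (L : Level) : L.bound ≤ inputSum L := getD_le_inputSum L 1

theorem natAbs_le_of_encodeInt {z : ℤ} {m : ℕ} (h₁ : z.toNat ≤ m) (h₂ : (-z).toNat ≤ m) :
    z.natAbs ≤ m := by omega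

theorem natAbs_start_le (L : Level) (i : Fin 3) : (L.start i).natAbs ≤ inputSum L := by
  fin_cases i
  exacts [natAbs_le_of_encodeInt (getD_le_inputSum L 2) (getD_le_inputSum L 3),
    natAbs_le_of_encodeInt (getD_le_inputSum L 4) (getD_le_inputSum L 5),
    natAbs_le_of_encodeInt (getD_le_inputSum L 6) (getD_le_inputSum L 7)]

theorem natAbs_vert_le {L : Level} {s : Surface} (hs : s ∈ L.surfaces) {v : V3}
    (hv : v ∈ s.verts) (i : Fin 3) : (v i).natAbs ≤ inputSum L := by
  obtain ⟨j, hj, rfl⟩ := List.mem_iff_getElem.1 hs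
  obtain ⟨k, hk, rfl⟩ := List.mem_iff_getElem.1 hv
  have h : ∀ n < 6, (encodeVec (L.surfaces[j].verts[k])).getD n 0 ≤ inputSum L := fun n hn => by
    rw [← getD_surface_vert (List.getElem?_eq_getElem hj) hk hn]
    exact getD_le_inputSum L _
  fin_cases i
  exacts [natAbs_le_of_encodeInt (h 0 (by omega)) (h 1 (by omega)),
    natAbs_le_of_encodeInt (h 2 (by omega)) (h 3 (by omega)),
    natAbs_le_of_encodeInt (h 4 (by omega)) (h 5 (by omega))]

theorem natAbs_cross_le {u v : V3} {p q : ℕ} (hu : ∀ i, (u i).natAbs ≤ p)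
    (hv : ∀ i, (v i).natAbs ≤ q) (i : Fin 3) : (crossProduct u v i).natAbs ≤ 2 * p * q := by
  have h : ∀ i j, (u i * v j).natAbs ≤ p * q := fun i j => by
    rw [Int.natAbs_mul]; exact Nat.mul_le_mul (hu i) (hv j)
  have h₁ : ∀ a b : ℤ, a.natAbs ≤ p * q → b.natAbs ≤ p * q → (a - b).natAbs ≤ 2 * p * q := by
    intro a b ha hb
    rw [mul_assoc]
    omega
  rw [cross_apply]
  fin_cases i
  exacts [h₁ _ _ (h _ _) (h _ _), h₁ _ _ (h _ _) (h _ _), h₁ _ _ (h _ _) (h _ _)]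

theorem natAbs_normal_le {L : Level} {s : Surface} (hs : s ∈ L.surfaces) (i : Fin 3) :
    (s.normal i).natAbs ≤ 8 * inputSum L ^ 2 := by
  have ha := natAbs_vert_le hs (v := s.a) (by simp [Surface.verts])
  have hb := natAbs_vert_le hs (v := s.b) (by simp [Surface.verts])
  have hc := natAbs_vert_le hs (v := s.c) (by simp [Surface.verts])
  refine (natAbs_cross_le (p := 2 * inputSum L) (q := 2 * inputSum L) (fun i => ?_) (fun i => ?_)
    i).trans (le_of_eq (by ring))
  · have := ha i; have := hb i
    simp only [Pi.sub_apply]; omega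
  · have := ha i; have := hc i
    simp only [Pi.sub_apply]; omega

theorem natAbs_round_le {x : ℝ} {n : ℕ} (h : |x| ≤ n) : (round x).natAbs ≤ n := by
  have h₁ := abs_sub_round x
  rw [abs_le] at h h₁
  have h₂ : (round x : ℝ) < (n : ℤ) + 1 := by push_cast; linarith
  have h₃ : (-(n : ℤ) - 1 : ℝ) < (round x : ℝ) := by push_cast; linarith
  have h₄ : round x < (n : ℤ) + 1 := by exact_mod_cast h₂
  have h₅ : -(n : ℤ) - 1 < round x := by exact_mod_cast h₃
  omega

theorem natAbs_rightDir_le (E : Engine) (o : Orientation E) (i : Fin 3) :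
    (rightDir E o i).natAbs ≤ E.dirScale := by
  have h : ∀ y : ℝ, |y| ≤ 1 → |(E.dirScale : ℝ) * y| ≤ E.dirScale := fun y hy => by
    rw [abs_mul, Nat.abs_cast]
    exact mul_le_of_le_one_right (Nat.cast_nonneg _) hy
  fin_cases i
  · exact natAbs_round_le (h _ (Real.abs_sin_le_one _))
  · exact natAbs_round_le (by rw [abs_neg]; exact h _ (Real.abs_cos_le_one _))
  · exact Nat.zero_le _

/-- A cube is convex, so it contains the hull of the vertices as soon as it contains the vertices.
-/
theorem abs_le_of_mem_region {L : Level} {s : Surface} (hs : s ∈ L.surfaces) {x : Fin 3 → ℝ}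
    (hx : x ∈ s.region) (i : Fin 3) : |x i| ≤ inputSum L := by
  have h : s.region ⊆ Set.univ.pi fun _ => Set.Icc (-(inputSum L : ℝ)) (inputSum L) := by
    refine convexHull_min ?_ (convex_pi fun _ _ => convex_Icc _ _)
    rintro _ ⟨v, hv, rfl⟩ i -
    have h₁ := natAbs_vert_le hs hv i
    have h₂ : |v i| ≤ (inputSum L : ℤ) := by rw [Int.abs_eq_natAbs]; exact_mod_cast h₁
    have h₃ : |(v i : ℝ)| ≤ inputSum L := by exact_mod_cast h₂
    exact abs_le.1 h₃
  exact abs_le.2 (h hx i trivial)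

/-- Bounds for the portals that can be created in a level. -/
structure Portal.Bounded (E : Engine) (L : Level) (P : Portal) : Prop where
  pos : ∀ i, (P.pos i).natAbs ≤ inputSum L
  normal : ∀ i, (P.normal i).natAbs ≤ 8 * inputSum L ^ 2
  right : ∀ i, (P.right i).natAbs ≤ E.dirScale + 16 * inputSum L ^ 2

/-- The point of the crossing belongs to a surface of the level, so its size depends neither on the
eye nor on the history of the game. The same holds for the normal and the right direction. -/
theorem shot_bounded {E : Engine} {L : Level} {eye : V3} {o : Orientation E} {P : Portal}
    (h : shot E L eye o = some P) : P.Bounded E L := by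
  unfold shot at h
  split_ifs at h with h₁
  dsimp only at h
  split_ifs at h
  obtain ⟨⟨-, -, hmem⟩, -⟩ := h₁.choose_spec
  set s := L.surfaces.get h₁.choose.1
  set t := h₁.choose.2
  have hs : s ∈ L.surfaces := List.get_mem _ _
  obtain rfl := Option.some_inj.1 h
  have hn : ∀ i, ((if s.normal ⬝ᵥ viewDir E o < 0 then s.normal else -s.normal) i).natAbs ≤
      8 * inputSum L ^ 2 := fun i => by
    have := natAbs_normal_le hs i
    split_ifs
    · exact this
    · simpa using this
  refine ⟨fun i => natAbs_round_le (abs_le_of_mem_region hs hmem i), hn, fun i => ?_⟩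
  simp only [newPortal]
  generalize (if s.normal ⬝ᵥ viewDir E o < 0 then s.normal else -s.normal : V3) = n at hn ⊢
  -- With this the cross product of `e₃` and the normal is at most `2 * 1 * (8 * inputSum L ^ 2)`,
  -- the second summand in the bound for `right`.
  have he : ∀ i, (e₃ i).natAbs ≤ 1 := fun i => by fin_cases i <;> simp [e₃]
  have hc := natAbs_cross_le he hn i
  split_ifs
  · exact (natAbs_rightDir_le E o i).trans (Nat.le_add_right _ _)
  · omega

/-- Bounds for the states that can be reached in a level. -/
structure State.Bounded {E : Engine} (L : Level) (s : State E) : Prop where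
  pos : ∀ i, (s.pos i).natAbs ≤ inputSum L
  vel : ∀ i, (s.vel i).natAbs ≤ inputSum L
  blue : ∀ P ∈ s.blue, P.Bounded E L
  orange : ∀ P ∈ s.orange, P.Bounded E L

theorem codesBdd_state (E : Engine) : CodesBdd fun L (s : State E) => s.Bounded L := by
  have hA : PT inputSum := PT.inputSum
  have hB : PT fun L => 8 * inputSum L ^ 2 := (PT.const_nat 8).mul_nat (hA.pow_nat 2)
  have hC : PT fun L => E.dirScale + 16 * inputSum L ^ 2 :=
    (PT.const_nat _).add_nat ((PT.const_nat 16).mul_nat (hA.pow_nat 2))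
  have hP : CodesBdd fun L (P : Portal) => P.Bounded E L := by
    obtain ⟨g, h₁, h₂⟩ := CodesBdd.surface.prod
      ((CodesBdd.v3 hA).prod ((CodesBdd.v3 hB).prod (CodesBdd.v3 hC)))
    exact ⟨g, h₁, fun L hL P h m hm => h₂ L hL (P.surface, P.pos, P.normal, P.right)
      ⟨trivial, h.pos, h.normal, h.right⟩ m hm⟩
  obtain ⟨g, h₁, h₂⟩ := (CodesBdd.v3 hA).prod ((CodesBdd.v3 hA).prod (CodesBdd.bool.prod
    (hP.option.prod (hP.option.prod ((CodesBdd.fin E.yawSteps).prod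
      (CodesBdd.fin (E.pitchSteps + 1)))))))
  exact ⟨g, h₁, fun L hL s h m hm => h₂ L hL
    (s.pos, s.vel, s.crouched, s.blue, s.orange, s.orientation)
    ⟨h.pos, h.vel, trivial, h.blue, h.orange, trivial, trivial⟩ m hm⟩

theorem shoot_bounded {E : Engine} {L : Level} {eye : V3} {o : Orientation E}
    {fire : Option Colour} {bo : Option Portal × Option Portal}
    (h₁ : ∀ P ∈ bo.1, P.Bounded E L) (h₂ : ∀ P ∈ bo.2, P.Bounded E L) :
    (∀ P ∈ (shoot E L eye o fire bo).1, P.Bounded E L) ∧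
      ∀ P ∈ (shoot E L eye o fire bo).2, P.Bounded E L := by
  have key : ∀ x : Option Portal, (∀ P ∈ x, P.Bounded E L) →
      ∀ P ∈ (shot E L eye o).or x, P.Bounded E L := by
    intro x hx P hP
    rcases Option.or_eq_some_iff.1 hP with h | ⟨-, h⟩
    exacts [shot_bounded h, hx P h]
  rcases fire with _ | _ | _
  exacts [⟨h₁, h₂⟩, ⟨key _ h₁, h₂⟩, ⟨h₁, key _ h₂⟩]

theorem natAbs_vel_travel_le {E : Engine} {L : Level} {c : Bool}
    {bo : Option Portal × Option Portal} {m : Motion}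
    (hm : ∀ i, (m.vel i).natAbs ≤ L.terminalVelocity) (i : Fin 3) :
    ((travel E L c bo m).vel i).natAbs ≤ L.terminalVelocity := by
  have h : m.Bounded (absSum m.pos + (exitBound E bo.1 + exitBound E bo.2)) L.terminalVelocity
      (absSum m.disp) :=
    ⟨fun i => (natAbs_le_absSum _ i).trans (Nat.le_add_right _ _), hm, natAbs_le_absSum _⟩
  exact (h.foldl (Nat.le_add_left _ _) le_rfl _).vel i

/-- The bounds are invariant and do not deteriorate with time: the position is limited by survival,
the velocity by clamping, and portals are old ones or come from `shot_bounded`. -/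
theorem next_bounded {E : Engine} {L : Level} {s : State E} (hs : s.Bounded L) (inp : Input E)
    (hpos : ∀ i, ((next E L s inp).pos i).natAbs ≤ L.bound) : (next E L s inp).Bounded L := by
  refine ⟨fun i => (hpos i).trans (bound_le L), fun i => ?_, (shoot_bounded hs.blue hs.orange).1,
    (shoot_bounded hs.blue hs.orange).2⟩
  refine (natAbs_vel_travel_le (fun i => ?_) i).trans (terminalVelocity_le L)
  dsimp only
  split_ifs <;> exact clamp_bound _ _ _

/-! ## The game -/

theorem PT.wins (E : Engine) {L : α → Level} {s : α → State E} (hL : PT L) (hs : PT s) :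
    PT fun a => Wins E (L a) (s a) := by
  obtain ⟨hp, -, hc, -, -⟩ := hs.state_fields
  exact PT.forall_fin_three fun i =>
    ((((hp.bodyLow E).coord i).le_int (hL.goal.coord i)).and
      ((hL.goal.coord i).le_int ((hc.bodyHigh E hp).coord i)))

/-! ### The search graph and its reachable states -/

theorem PT.const_input {E : Engine} (i : Input E) : PT fun _ : α => i :=
  (PT.const_nat (Finite.equivFin (Input E) i : ℕ)).transport fun _ _ _ a ha =>
    ⟨a, ha, fun _ h => h⟩

theorem exists_inputs (E : Engine) : ∃ (K : ℕ) (inp : ℕ → Input E), PT inp ∧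
    ∀ i, ∃ k < K, inp k = i := by
  let e := Finite.equivFin (Input E)
  let i₀ : Input E := ⟨(⟨0, E.yawSteps_pos⟩, 0), 0, 0, false, false, none⟩
  let g : ℕ → Input E := fun n => if h : n < Nat.card (Input E) then e.symm ⟨n, h⟩ else i₀
  refine ⟨_, _, PT.table (g := g) (fun k => .const_input _) (Nat.card (Input E)),
    fun i => ⟨e i, (e i).2, ?_⟩⟩
  rw [if_pos (e i).2]
  simp [g]

open scoped Classical in
/-- Number the inputs; the number `K` stands for the end of the game, which succeeds if the end
location lies within the avatar. -/
noncomputable def play (E : Engine) (K : ℕ) (inp : ℕ → Input E) (L : Level) (s : State E) (k : ℕ) :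
    Option (State E) :=
  if k = K then if Wins E L s then none else some s
  else if ∀ i, ((next E L s (inp k)).pos i).natAbs ≤ L.bound then some (next E L s (inp k))
  else some s

theorem PT.play (E : Engine) (K : ℕ) {inp : ℕ → Input E} (hinp : PT inp) {L : α → Level}
    {s : α → State E} {k : α → ℕ} (hL : PT L) (hs : PT s) (hk : PT k) :
    PT fun a => play E K inp (L a) (s a) (k a) := by
  classical
  have hn := PT.next E hL hs (hinp.comp hk)
  exact PT.ite (hk.eq_nat (.const_nat K)) (PT.ite (PT.wins E hL hs) .none hs.some)
    (PT.ite (PT.forall_fin_three fun i => (hn.state_fields.1.coord i).natAbs.le_nat hL.bound)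
      hn.some hs.some)

theorem PT.initial (E : Engine) : PT (initial E) :=
  PT.stateMk (PT.start .id) (.const_v3 0) (.prodMk (.const_fin _) (.const_fin _)) (.const_bool false)
    .none .none

/-- The start location need not lie within `L.bound`; therefore positions are bounded by `inputSum`
in `State.Bounded`. -/
theorem initial_bounded (E : Engine) (L : Level) : (initial E L).Bounded L :=
  ⟨natAbs_start_le L, fun _ => Nat.zero_le _, by simp [initial], by simp [initial]⟩

/-- Every edge of `play` is a legal step, a stay in place, or the transition from a winning state to
`none`, which is never left. Staying in place makes `play` total without adding reachable states. -/
theorem traversable_iff {E : Engine} {K : ℕ} {inp : ℕ → Input E}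
    (hinp : ∀ i, ∃ k < K, inp k = i) (L : Level) : Traversable E L ↔
      Reachable (some (initial E L)) (fun x k => x.elim none fun s => play E K inp L s k) (K + 1)
        none := by
  classical
  constructor
  · rintro ⟨s, hs, hw⟩
    have h : Reachable (some (initial E L)) (fun x k => x.elim none fun s => play E K inp L s k)
        (K + 1) (some s) := by
      clear hw
      induction hs with
      | refl => exact .refl
      | tail _ h ih =>
        obtain ⟨⟨i, rfl⟩, h⟩ := h
        obtain ⟨k, hk, rfl⟩ := hinp i
        refine ih.tail ⟨k, by omega, ?_⟩
        have h' : ∀ i, ((next E L _ (inp k)).pos i).natAbs ≤ L.bound := fun i => by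
          have := h i
          rw [Int.abs_eq_natAbs] at this
          exact_mod_cast this
        simp [play, hk.ne, h']
    exact h.tail ⟨K, by omega, by simp [play, hw]⟩
  · intro h
    -- The invariant along a path: a state is reachable by legal steps, and at `none` the level has
    -- been found traversable.
    suffices key : ∀ x, Reachable (some (initial E L))
        (fun x k => x.elim none fun s => play E K inp L s k) (K + 1) x →
        x.elim (Traversable E L) fun s => Relation.ReflTransGen (Step E L) (initial E L) s from
      key none h
    intro x hx
    induction hx with
    | refl => exact .refl
    | @tail x y _ hxy ih =>
      obtain ⟨k, -, rfl⟩ := hxy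
      rcases x with _ | s
      · exact ih
      · simp only [Option.elim_some] at ih ⊢
        unfold play
        split_ifs with h₁ h₂ h₃
        · exact ⟨s, ih, h₂⟩
        · exact ih
        · refine ih.tail ⟨⟨inp k, rfl⟩, fun i => ?_⟩
          rw [Int.abs_eq_natAbs]
          exact_mod_cast h₃ i
        · exact ih

theorem Reachable.bounded {E : Engine} {K : ℕ} {inp : ℕ → Input E} {L : Level}
    {x : Option (State E)} (h : Reachable (some (initial E L))
      (fun x k => x.elim none fun s => play E K inp L s k) (K + 1) x) :
    ∀ s ∈ x, s.Bounded L := by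
  classical
  induction h with
  | refl => rintro _ ⟨⟩; exact initial_bounded E L
  | @tail x y _ hxy ih =>
    obtain ⟨k, -, rfl⟩ := hxy
    rcases x with _ | s
    · exact ih
    · have hs := ih s rfl
      simp only [Option.elim_some]
      unfold play
      split_ifs with h₁ h₂ h₃
      · exact fun s hs => nomatch hs
      · exact ih
      · rintro _ ⟨⟩; exact next_bounded hs _ h₃
      · exact ih

end PortalGame

theorem mainTheorem11 (E : PortalGame.Engine) :
    SolvableInPseudopolynomialTime PortalGame.Level.encode PortalGame.Level.WellFormed
      (PortalGame.Traversable E) := by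
  obtain ⟨K, inp, hinp, hsurj⟩ := PortalGame.exists_inputs E
  obtain ⟨g, ⟨e, he⟩, hg⟩ := (PortalGame.codesBdd_state E).option
  refine PortalGame.solvable_of_reachable (K := K + 1)
    -- The polynomial bound for the codes of reachable states, with `levelSize` replaced by a
    -- computable majorant, and `+ 1` to make the inequality strict.
    (S := fun L => (L.encode.length + PortalGame.inputSum L + 2) ^ e + 1)
    (start := fun L => some (PortalGame.initial E L))
    (f := fun x => x.1.2.elim none fun s => PortalGame.play E K inp x.1.1 s x.2)
    (Nat.succ_pos K) ?_ (PortalGame.PT.initial E).some ?_ ?_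
    fun L _ => PortalGame.traversable_iff hsurj L
  · exact (((PortalGame.PT.inputLength.add_nat PortalGame.PT.inputSum).add_nat
      (.const_nat 2)).pow_nat e).add_nat (.const_nat 1)
  · refine PortalGame.PT.elim (PortalGame.PT.fst.snd') .none ?_
    exact PortalGame.PT.play E K hinp PortalGame.PT.fst.fst'.fst' .snd PortalGame.PT.fst.snd'
  · intro L hL x hx n hn
    have h₁ := (hg L hL x hx.bounded n hn).trans (he _ (by omega))
    have h₂ : (PortalGame.levelSize L + 2) ^ e ≤
        (L.encode.length + PortalGame.inputSum L + 2) ^ e :=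
      Nat.pow_le_pow_left (by have := PortalGame.levelSize_le L; omega) e
    exact Nat.lt_succ_of_le (h₁.trans h₂)
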